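/- **Setting.** Let $\Lambda$ be a ring with identity, $\mathrm{Proj}\,\Lambda$ the category of projective $\Lambda$-modules and $\mathrm{proj}\,\Lambda$ the category of finitely generated ones; $C(-)$ and $K(-)$ denote categories of unbounded complexes and their homotopy categories. *Tilting complex.* Let $T$ be a tilting complex over $\Lambda$, that is, a bounded complex of finitely generated projective modules such that $\mathrm{Hom}_{K(\mathrm{Proj}\,\Lambda)}(T,T[n])=0$ for all $n\neq 0$ and such that $\mathrm{add}\,T$ generates $K^b(\mathrm{proj}\,\Lambda)$ as a triangulated category. Let $\mathrm{Sum}\,T$ be the full subcategory of $K(\mathrm{Proj}\,\Lambda)$ consisting of the direct sums $T^{(I)}$ of copies of $T$ ($I$ any set). A complex $X$ in $\mathrm{Sum}\,T$ is written $(X^{**},\delta_0,\delta_1)$: the complex $(X^{*,q},\delta_0)$ of projective modules is the object of $\mathrm{Sum}\,T$ in degree $q$, and the chain map $\delta_1\colon X^{*,q}\to X^{*,q+1}$ represents the differential of $X$. *Graded objects.* For an additive category $\mathcal A$ let $\mathrm{gr}\,\mathcal A$ be the category of $\mathbb Z$-graded objects $X=(X^j)_{j\in\mathbb Z}$ of $\mathcal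 A$, where a morphism $f\colon X\to Y$ is a family of maps $f_n^j\colon X^j\to Y^{j+n}$ ($n\ge 0$, $j\in\mathbb Z$) and $(gf)_n^j=\sum_{p+q=n}g_p^{j+q}f_q^j$. Let $\mathrm{gr}^b\mathcal A$ be the full subcategory of the objects with finitely many nonzero components. Put $X(1)^j=X^{j+1}$, $f(1)_n^j=f_n^{j+1}$, and let $\eta_X=\{0,\mathrm{Id},0,\dots\}\colon X(1)\to X$. For $\mathcal B=\mathrm{gr}\,\mathcal A$ or $\mathrm{gr}^b\mathcal A$ an $\eta$-conflation in $C(\mathcal B)$ is a sequence isomorphic to $Y\to\mathrm{cone}(f)\to X[1]$ for a chain map $f\colon X\to Y$ which factors through $\eta_Y\colon Y(1)\to Y$. These sequences form a Frobenius exact structure; $K_\eta(\mathcal B)$ is its stable category, the quotient of $C(\mathcal B)$ by the maps that factor through an injective object. It is triangulated, with suspension $[1](1)$ and with distinguished triangles the triangles isomorphic to $X\xrightarrow{f}Y\to\mathrm{cone}(f\eta_X)\to X(1)[1]$ for chain maps $f\colon X\to Y$. *The category $G(\mathcal A)$.* An object is a bigraded object $X^{**}$ of $\mathcal A$ with endomorphisms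 $d_n$ of degree $(1-n,n)$, $n\ge 0$, such that $d_0d_n+d_1d_{n-1}+\dots+d_nd_0=0$ for $n\ge 0$. A morphism is a family $\alpha_n$ of graded maps of degree $(-n,n)$, $n\ge 0$, with $\sum_{p+q=n}\alpha_pd_q=\sum_{p+q=n}d_p\alpha_q$ for $n\ge 0$. Let $\Psi(X)^{ij}=X^{i-j,j}$, $d_n^{ij}=d_n^{i-j,j}$, $\Psi(\alpha)_n^{ij}=\alpha_n^{i-j,j}$; this gives complexes in $\mathrm{gr}\,\mathcal A$ and chain maps between them. The total complex of $X$ (when each total degree contains finitely many nonzero objects) is $\bigoplus_j X^{m-j,j}$ in degree $m$, with differential $\sum_n d_n$, and $\alpha$ induces $\sum_n\alpha_n$ on total complexes. *The operation $(-)^{**}$ and the functors.* One can choose, for every $X\in C(\mathrm{Sum}\,T)$, an object $X^{**}$ of $G(\mathrm{Proj}\,\Lambda)$ on the bigraded module $X^{**}$ with $d_0=\delta_0$ and $d_1^{pq}=(-1)^{p+q}\delta_1^{pq}$, and, for every morphism $\alpha\colon X\to Y$ of $C(\mathrm{Sum}\,T)$, a morphism $\alpha^{**}=\{\alpha_n\}\colon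 X^{**}\to Y^{**}$ of $G(\mathrm{Proj}\,\Lambda)$ such that $\alpha_0$ represents $\alpha$. Fix any such choice (it need not be functorial), and let * $\Phi$ be the operation $X\mapsto\mathrm{Tot}(X^{**})$, $\alpha\mapsto\mathrm{Tot}(\alpha^{**})$ from $C(\mathrm{Sum}\,T)$ to $K(\mathrm{Proj}\,\Lambda)$; * $\Theta$ be the operation $X\mapsto\Psi(X^{**})$, $\alpha\mapsto\Psi(\alpha^{**})$ from $C(\mathrm{Sum}\,T)$ to $K_\eta(\mathrm{gr}\,\mathrm{Proj}\,\Lambda)$; since $T$ is bounded it takes values in $K_\eta(\mathrm{gr}^b\mathrm{Proj}\,\Lambda)$; * $\Xi\colon C(\mathrm{gr}^b\mathrm{Proj}\,\Lambda)\to C(\mathrm{Proj}\,\Lambda)$ be the functor which in each degree is $X\mapsto\bigoplus_jX^j$, a morphism $f$ being sent to the lower triangular matrix with entries $f_{k-j}^j\colon X^j\to Y^k$. **Theorem.** 1. The inclusion induces a fully faithful triangle functor $J\colon K_\eta(\mathrm{gr}^b\mathrm{Proj}\,\Lambda)\to K_\eta(\mathrm{gr}\,\mathrm{Proj}\,\Lambda)$,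 and $\Xi$ induces a triangle functor $\Xi\colon K_\eta(\mathrm{gr}^b\mathrm{Proj}\,\Lambda)\to K(\mathrm{Proj}\,\Lambda)$. 2. Choices $(-)^{**}$ as above exist. For each of them, $\Phi$ induces a triangle functor $\Phi\colon K(\mathrm{Sum}\,T)\to K(\mathrm{Proj}\,\Lambda)$, and $\Theta$ induces a triangle functor $\Theta\colon K(\mathrm{Sum}\,T)\to K_\eta(\mathrm{gr}\,\mathrm{Proj}\,\Lambda)$ which is the composite of $J$ with a triangle functor $\Theta^b\colon K(\mathrm{Sum}\,T)\to K_\eta(\mathrm{gr}^b\mathrm{Proj}\,\Lambda)$ (induced by $\Theta$). 3. $\Phi=\Xi\circ\Theta^b$. That is, Rickard's functor $\Phi$ is the composite of the triangle functors $\Theta$ and $\Xi$. -/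

import Mathlib

open CategoryTheory CategoryTheory.Limits

noncomputable section

namespace EtaStable

universe v u w

/-! ### The category of complexes with the exact structure attached to `η : (1) ⟶ Id` -/

/-- A category `B` with the powers `X ↦ X⟦n⟧` (`n : ℤ`) of an autoequivalence `(1)`, and a natural
transformation `η : (1) ⟶ Id` which commutes with these powers: `η_{X(n)} = η_X(n)`. (For `n = 1`
this is `η_{X(1)} = η_X(1)`, which implies the other cases.) -/
class EtaTwist (B : Type u) [Category.{v} B] [HasShift B ℤ] where
  eta : shiftFunctor B (1 : ℤ) ⟶ 𝟭 B
  eta_shift : ∀ (X : B) (n : ℤ), eta.app (X⟦n⟧) =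
    (shiftFunctorComm B n (1 : ℤ)).hom.app X ≫ (eta.app X)⟦n⟧'

/-- The component `η_X : X(1) ⟶ X`. -/
def etaApp {B : Type u} [Category.{v} B] [HasShift B ℤ] [EtaTwist B] (X : B) : X⟦(1 : ℤ)⟧ ⟶ X :=
  EtaTwist.eta.app X

lemma etaApp_naturality {B : Type u} [Category.{v} B] [HasShift B ℤ] [EtaTwist B] {X Y : B}
    (f : X ⟶ Y) : f⟦(1 : ℤ)⟧' ≫ etaApp Y = etaApp X ≫ f :=
  EtaTwist.eta.naturality f

lemma etaApp_shift_aux {B : Type u} [Category.{v} B] [HasShift B ℤ] [EtaTwist B] (n : ℤ)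
    {P₀ P₁ Pₙ P₁ₙ Q : B} (u : Q ⟶ Pₙ⟦(1 : ℤ)⟧) (e : Pₙ ≅ P₀⟦n⟧) (w : P₁ ≅ P₀⟦(1 : ℤ)⟧)
    (z : P₁ₙ ≅ P₁⟦n⟧) (m : P₁ₙ ⟶ Pₙ) (h : m ≫ e.hom = z.hom ≫ (w.hom ≫ etaApp P₀)⟦n⟧') :
    u ≫ etaApp Pₙ = (u ≫ e.hom⟦(1 : ℤ)⟧' ≫ (shiftFunctorComm B n (1 : ℤ)).hom.app P₀ ≫
      w.inv⟦n⟧' ≫ z.inv) ≫ m := by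
  have h₃ : etaApp (P₀⟦n⟧) = (shiftFunctorComm B n (1 : ℤ)).hom.app P₀ ≫ (etaApp P₀)⟦n⟧' :=
    EtaTwist.eta_shift P₀ n
  have h₄ : m = z.hom ≫ (w.hom ≫ etaApp P₀)⟦n⟧' ≫ e.inv := by
    rw [← cancel_mono e.hom, h]
    simp
  have h₅ := etaApp_naturality e.hom
  rw [← cancel_mono e.hom, Category.assoc, ← h₅, h₃, h₄]
  have h₆ : w.inv⟦n⟧' ≫ (w.hom ≫ etaApp P₀)⟦n⟧' = (etaApp P₀)⟦n⟧' := by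
    rw [← Functor.map_comp, Iso.inv_hom_id_assoc]
  simp only [Category.assoc, Iso.inv_hom_id_assoc, Iso.inv_hom_id, Category.comp_id]
  rw [h₆]

/-- The natural transformation `η` restricts to every full subcategory stable under `(n)`, `n ∈ ℤ`. -/
instance EtaTwist.fullSubcategory {B : Type u} [Category.{v} B] [HasShift B ℤ] [EtaTwist B]
    (P : ObjectProperty B) [P.IsStableUnderShift ℤ] : EtaTwist P.FullSubcategory where
  eta :=
    { app := fun X => P.homMk ((P.ι.commShiftIso (1 : ℤ)).hom.app X ≫ etaApp X.obj)
      naturality := fun X Y f => by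
        apply P.ι.map_injective
        have h₁ := P.ι.commShiftIso_hom_naturality f (1 : ℤ)
        have h₂ := etaApp_naturality (P.ι.map f)
        change P.ι.map (f⟦(1 : ℤ)⟧') ≫ (P.ι.commShiftIso (1 : ℤ)).hom.app Y ≫ etaApp (P.ι.obj Y) =
          ((P.ι.commShiftIso (1 : ℤ)).hom.app X ≫ etaApp (P.ι.obj X)) ≫ P.ι.map f
        rw [← Category.assoc, h₁, Category.assoc, h₂, Category.assoc] }
  eta_shift X n := by
    apply P.ι.map_injective
    rw [Functor.map_comp, Functor.map_shiftFunctorComm_hom_app]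
    exact etaApp_shift_aux n ((P.ι.commShiftIso (1 : ℤ)).hom.app (X⟦n⟧))
      ((P.ι.commShiftIso n).app X) ((P.ι.commShiftIso (1 : ℤ)).app X)
      ((P.ι.commShiftIso n).app (X⟦(1 : ℤ)⟧)) _
      (P.ι.commShiftIso_hom_naturality (P.homMk ((P.ι.commShiftIso (1 : ℤ)).hom.app X ≫
        etaApp X.obj) : X⟦(1 : ℤ)⟧ ⟶ X) n)

section General

set_option linter.unusedSectionVars false

variable (B : Type u) [Category.{v} B] [Preadditive B] [HasShift B ℤ]
  [∀ n : ℤ, (shiftFunctor B n).Additive]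

/-- The automorphism `(n)` of the category of complexes in `B`, applied degreewise. -/
def twist (n : ℤ) : CochainComplex B ℤ ⥤ CochainComplex B ℤ :=
  (shiftFunctor B n).mapHomologicalComplex (ComplexShape.up ℤ)

instance (n : ℤ) : (twist B n).Additive := by unfold twist; infer_instance

@[simp] lemma twist_obj_X (n : ℤ) (K : CochainComplex B ℤ) (i : ℤ) :
    ((twist B n).obj K).X i = (K.X i)⟦n⟧ := rfl

@[simp] lemma twist_obj_d (n : ℤ) (K : CochainComplex B ℤ) (i j : ℤ) :
    ((twist B n).obj K).d i j = (K.d i j)⟦n⟧' := rfl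

@[simp] lemma twist_map_f (n : ℤ) {K L : CochainComplex B ℤ} (f : K ⟶ L) (i : ℤ) :
    ((twist B n).map f).f i = (f.f i)⟦n⟧' := rfl

variable {B} in
/-- The natural transformation `η_X : X(1) ⟶ X` on complexes, given degreewise by `η`. -/
def etaC [EtaTwist B] (K : CochainComplex B ℤ) : (twist B 1).obj K ⟶ K where
  f i := etaApp (K.X i)
  comm' i j _ := (etaApp_naturality (K.d i j)).symm

variable {B} in
lemma etaC_naturality [EtaTwist B] {K L : CochainComplex B ℤ} (f : K ⟶ L) :
    (twist B 1).map f ≫ etaC L = etaC K ≫ f := by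
  ext i
  exact etaApp_naturality (f.f i)

/-- The functor `[n](n)` on complexes in `B`. -/
def twistShift (n : ℤ) : CochainComplex B ℤ ⥤ CochainComplex B ℤ :=
  twist B n ⋙ shiftFunctor (CochainComplex B ℤ) n

@[simp] lemma twistShift_obj_X (n : ℤ) (K : CochainComplex B ℤ) (i : ℤ) :
    ((twistShift B n).obj K).X i = (K.X (i + n))⟦n⟧ := rfl

@[simp] lemma twistShift_obj_d (n : ℤ) (K : CochainComplex B ℤ) (i j : ℤ) :
    ((twistShift B n).obj K).d i j = n.negOnePow • (K.d (i + n) (j + n))⟦n⟧' := rfl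

@[simp] lemma twistShift_map_f (n : ℤ) {K L : CochainComplex B ℤ} (f : K ⟶ L) (i : ℤ) :
    ((twistShift B n).map f).f i = (f.f (i + n))⟦n⟧' := rfl

instance (n : ℤ) : (twistShift B n).Additive := by unfold twistShift; infer_instance

variable {B}

lemma zero_comm_d (K : CochainComplex B ℤ) (i j : ℤ) :
    ((shiftFunctorZero B ℤ).hom.app (K.X (i + 0)) ≫ (K.XIsoOfEq (add_zero i)).hom) ≫ K.d i j =
      ((0 : ℤ).negOnePow • (K.d (i + 0) (j + 0))⟦(0 : ℤ)⟧') ≫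
        (shiftFunctorZero B ℤ).hom.app (K.X (j + 0)) ≫ (K.XIsoOfEq (add_zero j)).hom := by
  rw [Int.negOnePow_zero, one_smul, (shiftFunctorZero B ℤ).hom.naturality_assoc]
  simp

lemma zero_comm_f {K L : CochainComplex B ℤ} (f : K ⟶ L) (i : ℤ) :
    (f.f (i + 0))⟦(0 : ℤ)⟧' ≫ (shiftFunctorZero B ℤ).hom.app (L.X (i + 0)) ≫
        (L.XIsoOfEq (add_zero i)).hom =
      ((shiftFunctorZero B ℤ).hom.app (K.X (i + 0)) ≫ (K.XIsoOfEq (add_zero i)).hom) ≫ f.f i := by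
  rw [(shiftFunctorZero B ℤ).hom.naturality_assoc]
  simp [HomologicalComplex.XIsoOfEq_hom_naturality]

lemma add_comm_d (n m : ℤ) (K : CochainComplex B ℤ) (i j : ℤ) (hi : i + (n + m) = i + m + n)
    (hj : j + (n + m) = j + m + n) :
    ((shiftFunctorAdd B n m).hom.app (K.X (i + (n + m))) ≫
        (((K.XIsoOfEq hi).hom)⟦n⟧')⟦m⟧') ≫
        (m.negOnePow • (n.negOnePow • (K.d (i + m + n) (j + m + n))⟦n⟧')⟦m⟧') =
      ((n + m).negOnePow • (K.d (i + (n + m)) (j + (n + m)))⟦n + m⟧') ≫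
        (shiftFunctorAdd B n m).hom.app (K.X (j + (n + m))) ≫
          (((K.XIsoOfEq hj).hom)⟦n⟧')⟦m⟧' := by
  simp only [Linear.comp_units_smul, Linear.units_smul_comp, Category.assoc,
    Functor.map_units_smul, smul_smul, (shiftFunctorAdd B n m).hom.naturality_assoc]
  rw [Int.negOnePow_add, mul_comm, Functor.comp_map, ← Functor.map_comp, ← Functor.map_comp,
    ← Functor.map_comp, ← Functor.map_comp, HomologicalComplex.XIsoOfEq_hom_comp_d,
    HomologicalComplex.d_comp_XIsoOfEq_hom]

lemma add_comm_f (n m : ℤ) {K L : CochainComplex B ℤ} (f : K ⟶ L) (i : ℤ)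
    (hi : i + (n + m) = i + m + n) :
    (f.f (i + (n + m)))⟦n + m⟧' ≫ (shiftFunctorAdd B n m).hom.app (L.X (i + (n + m))) ≫
        (((L.XIsoOfEq hi).hom)⟦n⟧')⟦m⟧' =
      ((shiftFunctorAdd B n m).hom.app (K.X (i + (n + m))) ≫
        (((K.XIsoOfEq hi).hom)⟦n⟧')⟦m⟧') ≫ ((f.f (i + m + n))⟦n⟧')⟦m⟧' := by
  rw [(shiftFunctorAdd B n m).hom.naturality_assoc, Functor.comp_map, Category.assoc,
    ← Functor.map_comp, ← Functor.map_comp,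
    ← Functor.map_comp, ← Functor.map_comp, HomologicalComplex.XIsoOfEq_hom_naturality]

variable (B)

/-- `[0](0) ≅ Id`. -/
def twistShiftZero : twistShift B 0 ≅ 𝟭 (CochainComplex B ℤ) :=
  NatIso.ofComponents (fun K => HomologicalComplex.Hom.isoOfComponents
    (fun i => (shiftFunctorZero B ℤ).app (K.X (i + 0)) ≪≫ K.XIsoOfEq (add_zero i))
    (fun i j _ => zero_comm_d K i j))
    (fun {K L} f => by
      ext i
      exact zero_comm_f f i)

lemma twistShiftZero_hom_app_f (K : CochainComplex B ℤ) (i : ℤ) :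
    ((twistShiftZero B).hom.app K).f i =
      (shiftFunctorZero B ℤ).hom.app (K.X (i + 0)) ≫ (K.XIsoOfEq (add_zero i)).hom := rfl

lemma twistShiftZero_inv_app_f (K : CochainComplex B ℤ) (i : ℤ) :
    ((twistShiftZero B).inv.app K).f i =
      (K.XIsoOfEq (add_zero i)).inv ≫ (shiftFunctorZero B ℤ).inv.app (K.X (i + 0)) := rfl

/-- `[n + m](n + m) ≅ [m](m) ∘ [n](n)`. -/
def twistShiftAdd (n m : ℤ) : twistShift B (n + m) ≅ twistShift B n ⋙ twistShift B m :=
  NatIso.ofComponents (fun K => HomologicalComplex.Hom.isoOfComponents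
    (fun i => (shiftFunctorAdd B n m).app (K.X (i + (n + m))) ≪≫
      (shiftFunctor B m).mapIso ((shiftFunctor B n).mapIso
        (K.XIsoOfEq (show i + (n + m) = i + m + n by lia))))
    (fun i j _ => add_comm_d n m K i j (by lia) (by lia)))
    (fun {K L} f => by
      ext i
      exact add_comm_f n m f i (by lia))

lemma twistShiftAdd_hom_app_f (n m : ℤ) (K : CochainComplex B ℤ) (i : ℤ) :
    ((twistShiftAdd B n m).hom.app K).f i = (shiftFunctorAdd B n m).hom.app (K.X (i + (n + m))) ≫
      (((K.XIsoOfEq (show i + (n + m) = i + m + n by lia)).hom)⟦n⟧')⟦m⟧' := rfl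

lemma twistShift_eqToHom_f {n n' : ℤ} (h : n = n') (K : CochainComplex B ℤ) (i : ℤ)
    (e : (twistShift B n).obj K = (twistShift B n').obj K) :
    (eqToHom e).f i = (K.XIsoOfEq (show i + n = i + n' by rw [h])).hom⟦n⟧' ≫
      eqToHom (show (K.X (i + n'))⟦n⟧ = (K.X (i + n'))⟦n'⟧ by rw [h]) := by
  subst h
  simp

lemma twistShift_XIsoOfEq (n : ℤ) (K : CochainComplex B ℤ) {i j : ℤ} (h : i = j) :
    (((twistShift B n).obj K).XIsoOfEq h).hom =
      (K.XIsoOfEq (show i + n = j + n by rw [h])).hom⟦n⟧' := by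
  subst h
  simp

variable {B} in
lemma shift_assoc_aux (K : CochainComplex B ℤ) (a b c p q r s t : ℤ)
    (h₁ : p = q) (h₂ : q = r) (h₀ : p = s) (h₃ : s = t) (h₄ : t = r)  :
    ((shiftFunctorAdd B (a + b) c).hom.app (K.X p) ≫ (((K.XIsoOfEq h₁).hom)⟦a + b⟧')⟦c⟧') ≫
      ((shiftFunctorAdd B a b).hom.app (K.X q) ≫ (((K.XIsoOfEq h₂).hom)⟦a⟧')⟦b⟧')⟦c⟧' =
    (((K.XIsoOfEq h₀).hom)⟦a + b + c⟧' ≫ eqToHom (by rw [add_assoc])) ≫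
      ((shiftFunctorAdd B a (b + c)).hom.app (K.X s) ≫
        (((K.XIsoOfEq h₃).hom)⟦a⟧')⟦b + c⟧') ≫
      (shiftFunctorAdd B b c).hom.app ((K.X t)⟦a⟧) ≫
        ((((K.XIsoOfEq h₄).hom)⟦a⟧')⟦b⟧')⟦c⟧' := by
  subst h₁ h₂ h₃ h₀
  have := shiftFunctorAdd_assoc_hom_app a b c (K.X p)
  simp only [shiftFunctorAdd', Iso.trans_hom, NatTrans.comp_app, eqToIso.hom, eqToHom_app,
    Category.assoc] at this
  simpa using this

variable {B} in
lemma shift_zero_add_aux (K : CochainComplex B ℤ) (n p q r : ℤ)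
    (h₁ : p = q) (h₀ : p = r) (h₂ : r = q) :
    (shiftFunctorAdd B 0 n).hom.app (K.X p) ≫ (((K.XIsoOfEq h₁).hom)⟦(0 : ℤ)⟧')⟦n⟧' =
      (((K.XIsoOfEq h₀).hom)⟦0 + n⟧' ≫ eqToHom (by rw [zero_add])) ≫
        ((K.XIsoOfEq h₂).hom ≫ (shiftFunctorZero B ℤ).inv.app (K.X q))⟦n⟧' := by
  subst h₁ h₀
  simpa using shiftFunctorAdd_zero_add_hom_app n (K.X p)

variable {B} in
lemma shift_add_zero_aux (K : CochainComplex B ℤ) (n p q r : ℤ)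
    (h₁ : p = q) (h₀ : p = r) (h₂ : r = q) :
    (shiftFunctorAdd B n 0).hom.app (K.X p) ≫ (((K.XIsoOfEq h₁).hom)⟦n⟧')⟦(0 : ℤ)⟧' =
      (((K.XIsoOfEq h₀).hom)⟦n + 0⟧' ≫ eqToHom (by rw [add_zero])) ≫
        (K.XIsoOfEq h₂).hom⟦n⟧' ≫ (shiftFunctorZero B ℤ).inv.app ((K.X q)⟦n⟧) := by
  subst h₁ h₀
  simpa using shiftFunctorAdd_add_zero_hom_app n (K.X p)

/-- The powers of the autoequivalence `[1](1)` of the category of complexes in `B`. -/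
def twistShiftCore : ShiftMkCore (CochainComplex B ℤ) ℤ where
  F := twistShift B
  zero := twistShiftZero B
  add := twistShiftAdd B
  assoc_hom_app a b c K := by
    ext i
    rw [HomologicalComplex.comp_f, HomologicalComplex.comp_f, HomologicalComplex.comp_f,
      twistShiftAdd_hom_app_f, twistShiftAdd_hom_app_f, twistShiftAdd_hom_app_f,
      twistShift_eqToHom_f B (add_assoc a b c), twistShift_map_f, twistShiftAdd_hom_app_f,
      twistShift_XIsoOfEq]
    exact shift_assoc_aux K a b c _ _ _ _ _ _ _ _ _ _
  zero_add_hom_app n K := by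
    ext i
    rw [HomologicalComplex.comp_f, twistShiftAdd_hom_app_f,
      twistShift_eqToHom_f B (zero_add n), twistShift_map_f, twistShiftZero_inv_app_f]
    exact shift_zero_add_aux K n _ _ _ _ _ (by lia)
  add_zero_hom_app n K := by
    ext i
    have h : (((twistShift B n).obj K).XIsoOfEq (add_zero i)).inv =
        (K.XIsoOfEq (show i + n = i + 0 + n by lia)).hom⟦n⟧' := by
      rw [← twistShift_XIsoOfEq B n K (add_zero i).symm]
      simp only [HomologicalComplex.XIsoOfEq, eqToIso.inv, eqToIso.hom]
    rw [HomologicalComplex.comp_f, twistShiftAdd_hom_app_f,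
      twistShift_eqToHom_f B (add_zero n), twistShiftZero_inv_app_f, h]
    exact shift_add_zero_aux K n _ _ _ _ _ (by lia)

/-- The category of complexes in `B`, equipped with the autoequivalence `[1](1)` as its shift. -/
def EtaComplex := CochainComplex B ℤ

instance : Category (EtaComplex B) := inferInstanceAs (Category (CochainComplex B ℤ))

instance : Preadditive (EtaComplex B) := inferInstanceAs (Preadditive (CochainComplex B ℤ))

instance : HasShift (EtaComplex B) ℤ := hasShiftMk (CochainComplex B ℤ) ℤ (twistShiftCore B)

instance (n : ℤ) : (shiftFunctor (EtaComplex B) n).Additive :=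
  inferInstanceAs (twistShift B n).Additive

variable [HasBinaryBiproducts B] [EtaTwist B]

variable {B}

/-- The sequence `Y ⟶ cone(f) ⟶ X[1]` attached to a chain map `f : X ⟶ Y`. -/
def standardPair {X Y : CochainComplex B ℤ} (f : X ⟶ Y) : ShortComplex (CochainComplex B ℤ) :=
  ShortComplex.mk (CochainComplex.mappingCone.inr f) (CochainComplex.mappingCone.triangle f).mor₃ (CochainComplex.mappingCone.inr_triangleδ f)

/-- The `η`-conflations: the sequences isomorphic to the sequence `Y ⟶ cone(f) ⟶ X[1]` of a chain
map `f : X ⟶ Y` that factors through `η_Y : Y(1) ⟶ Y`. -/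
def IsEtaConflation (S : ShortComplex (CochainComplex B ℤ)) : Prop :=
  ∃ (X Y : CochainComplex B ℤ) (f : X ⟶ Y) (g : X ⟶ (twist B 1).obj Y),
    g ≫ etaC Y = f ∧ Nonempty (S ≅ standardPair f)

/-- The injective objects for the exact structure given by the `η`-conflations. -/
def IsEtaInjective (I : CochainComplex B ℤ) : Prop :=
  ∀ S : ShortComplex (CochainComplex B ℤ), IsEtaConflation S →
    ∀ f : S.X₁ ⟶ I, ∃ g : S.X₂ ⟶ I, S.f ≫ g = f

/-- Two chain maps are identified when their difference factors through an injective object. -/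
def StablyEqual {X Y : CochainComplex B ℤ} (f g : X ⟶ Y) : Prop :=
  ∃ (I : CochainComplex B ℤ) (a : X ⟶ I) (b : I ⟶ Y), IsEtaInjective I ∧ f - g = a ≫ b

lemma isEtaConflation_standardPair_etaC (K : CochainComplex B ℤ) :
    IsEtaConflation (standardPair (etaC K)) :=
  ⟨_, _, etaC K, 𝟙 _, Category.id_comp _, ⟨Iso.refl _⟩⟩

open CochainComplex.HomComplex in
/-- A chain map whose composition with `f` is null-homotopic extends to the cone of `f`. -/
lemma exists_extension {X Y Z : CochainComplex B ℤ} (f : X ⟶ Y) (a : Y ⟶ Z)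
    (h : Homotopy (f ≫ a) 0) : ∃ b : CochainComplex.mappingCone f ⟶ Z, CochainComplex.mappingCone.inr f ≫ b = a := by
  refine ⟨CochainComplex.mappingCone.desc f ((Cochain.equivHomotopy _ _) h).1 a ?_, by simp⟩
  have := ((Cochain.equivHomotopy _ _) h).2
  simp only [Cochain.ofHom_zero, add_zero] at this
  exact this.symm

open CochainComplex.HomComplex in
lemma homotopy_comp_inr {X Y : CochainComplex B ℤ} (f : X ⟶ Y) :
    Nonempty (Homotopy (f ≫ CochainComplex.mappingCone.inr f) 0) :=
  ⟨(Cochain.equivHomotopy _ _).symm ⟨CochainComplex.mappingCone.inl f, by simp⟩⟩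

lemma eta_obj_one (K : B) :
    etaApp (K⟦(1 : ℤ)⟧) = (etaApp K)⟦(1 : ℤ)⟧' := by
  unfold etaApp
  rw [EtaTwist.eta_shift, shiftFunctorComm_eq _ _ _ _ rfl]
  simp

lemma eta_cone_null_aux {C D E C' E' : B} (fst : C ⟶ E⟦(1 : ℤ)⟧) (snd : C ⟶ D)
    (inl : E⟦(1 : ℤ)⟧ ⟶ C) (inr : D ⟶ C) (dD : D ⟶ E) (inl' : D⟦(1 : ℤ)⟧ ⟶ C')
    (d' : C' ⟶ C) (d : C ⟶ E') (snd' : E' ⟶ E)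
    (e₁ : inl' ≫ d' = etaApp D ≫ inr - dD⟦(1 : ℤ)⟧' ≫ inl)
    (e₂ : d ≫ snd' = fst ≫ etaApp E + snd ≫ dD)
    (e₃ : fst ≫ inl + snd ≫ inr = 𝟙 C) :
    etaApp C = (snd⟦(1 : ℤ)⟧' ≫ inl') ≫ d' +
      (0 : ℤ).negOnePow • d⟦(1 : ℤ)⟧' ≫ snd'⟦(1 : ℤ)⟧' ≫ inl := by
  have k₁ := etaApp_naturality fst
  have k₂ := etaApp_naturality snd
  have h : etaApp C = etaApp C ≫ (fst ≫ inl + snd ≫ inr) := by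
    rw [e₃, Category.comp_id]
  rw [h, Int.negOnePow_zero, one_smul, ← Category.assoc (d⟦(1 : ℤ)⟧'), ← Functor.map_comp, e₂,
    Functor.map_add, Functor.map_comp, Functor.map_comp, ← eta_obj_one, Category.assoc, e₁,
    Preadditive.comp_add, ← Category.assoc, ← k₁, ← Category.assoc (etaApp C), ← k₂,
    Preadditive.add_comp, Preadditive.comp_sub]
  simp only [Category.assoc]
  abel

open CochainComplex.HomComplex in
/-- The natural transformation `η` is null-homotopic on `cone(η_K)`. -/
lemma eta_cone_null (K : CochainComplex B ℤ) :
    Nonempty (Homotopy (etaC (CochainComplex.mappingCone (etaC K))) 0) := by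
  let s : Cochain ((twist B 1).obj (CochainComplex.mappingCone (etaC K))) (CochainComplex.mappingCone (etaC K)) (-1) :=
    Cochain.mk (fun p q hpq => ((CochainComplex.mappingCone.snd (etaC K)).v p p (add_zero p))⟦(1 : ℤ)⟧' ≫
      (CochainComplex.mappingCone.inl (etaC K)).v p q hpq)
  refine ⟨(Cochain.equivHomotopy _ _).symm ⟨s, ?_⟩⟩
  ext p
  have e₁ := CochainComplex.mappingCone.inl_v_d (etaC K) p (p - 1) (p + 1) (by lia) (by lia)
  have e₂ := CochainComplex.mappingCone.d_snd_v (etaC K) p (p + 1) rfl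
  have e₃ := CochainComplex.mappingCone.id_X (etaC K) p (p + 1) rfl
  rw [Cochain.add_v, Cochain.ofHom_v, Cochain.ofHom_v, HomologicalComplex.zero_f, add_zero,
    δ_v (-1) 0 (by lia) s p p (by lia) (p - 1) (p + 1) rfl rfl]
  exact eta_cone_null_aux _ _ _ _ (K.d p (p + 1)) _ _ _ _ e₁ e₂ e₃

/-- The objects `cone(η_K)` are injective. -/
lemma isEtaInjective_cone (K : CochainComplex B ℤ) :
    IsEtaInjective (CochainComplex.mappingCone (etaC K)) := by
  rintro S ⟨X, Y, f, g, rfl, ⟨e⟩⟩ a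
  obtain ⟨h⟩ := eta_cone_null K
  have H : Homotopy ((g ≫ etaC Y) ≫ e.inv.τ₁ ≫ a) 0 := by
    have h' := h.compLeft (g ≫ (twist B 1).map (e.inv.τ₁ ≫ a))
    rwa [comp_zero, Category.assoc, etaC_naturality, ← Category.assoc] at h'
  obtain ⟨b, hb⟩ := exists_extension _ _ H
  refine ⟨e.hom.τ₂ ≫ b, ?_⟩
  have h₁ : S.f ≫ e.hom.τ₂ = e.hom.τ₁ ≫ CochainComplex.mappingCone.inr (g ≫ etaC Y) :=
    e.hom.comm₁₂.symm
  have h₂ : e.hom.τ₁ ≫ e.inv.τ₁ = 𝟙 _ := by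
    rw [← ShortComplex.comp_τ₁, e.hom_inv_id, ShortComplex.id_τ₁]
  exact ((Category.assoc _ _ _).symm.trans (congrArg (· ≫ b) h₁)).trans
    ((Category.assoc _ _ _).trans ((congrArg (e.hom.τ₁ ≫ ·) hb).trans
      ((Category.assoc _ _ _).symm.trans ((congrArg (· ≫ a) h₂).trans (Category.id_comp a)))))

/-- The relation `StablyEqual` is the `η`-homotopy relation. -/
lemma stablyEqual_iff {X Y : CochainComplex B ℤ} (f g : X ⟶ Y) :
    StablyEqual f g ↔ Nonempty (Homotopy (etaC X ≫ f) (etaC X ≫ g)) := by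
  constructor
  · rintro ⟨I, a, b, hI, hab⟩
    obtain ⟨a', ha'⟩ : ∃ a' : CochainComplex.mappingCone (etaC X) ⟶ I,
      CochainComplex.mappingCone.inr (etaC X) ≫ a' = a :=
        hI _ (isEtaConflation_standardPair_etaC X) a
    obtain ⟨h⟩ := homotopy_comp_inr (etaC X)
    have h' := h.compRight (a' ≫ b)
    rw [zero_comp, Category.assoc, ← Category.assoc _ a', ha', ← hab, Preadditive.comp_sub] at h'
    exact ⟨(Homotopy.equivSubZero).symm h'⟩
  · rintro ⟨h⟩
    have h' := Homotopy.equivSubZero h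
    rw [← Preadditive.comp_sub] at h'
    obtain ⟨b, hb⟩ := exists_extension _ _ h'
    exact ⟨_, _, b, isEtaInjective_cone X, hb.symm⟩

lemma StablyEqual.comp_left {X Y Z : CochainComplex B ℤ} (f : X ⟶ Y) {g g' : Y ⟶ Z}
    (h : StablyEqual g g') : StablyEqual (f ≫ g) (f ≫ g') := by
  rw [stablyEqual_iff] at h ⊢
  obtain ⟨h⟩ := h
  have h' := h.compLeft ((twist B 1).map f)
  rw [← Category.assoc, ← Category.assoc, etaC_naturality, Category.assoc, Category.assoc] at h'
  exact ⟨h'⟩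

lemma StablyEqual.comp_right {X Y Z : CochainComplex B ℤ} {f f' : X ⟶ Y} (g : Y ⟶ Z)
    (h : StablyEqual f f') : StablyEqual (f ≫ g) (f' ≫ g) := by
  rw [stablyEqual_iff] at h ⊢
  obtain ⟨h⟩ := h
  have h' := h.compRight g
  rw [Category.assoc, Category.assoc] at h'
  exact ⟨h'⟩

lemma StablyEqual.add {X Y : CochainComplex B ℤ} {f₁ f₂ g₁ g₂ : X ⟶ Y} (h : StablyEqual f₁ f₂)
    (h' : StablyEqual g₁ g₂) : StablyEqual (f₁ + g₁) (f₂ + g₂) := by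
  rw [stablyEqual_iff] at h h' ⊢
  rw [Preadditive.comp_add, Preadditive.comp_add]
  exact ⟨h.some.add h'.some⟩

lemma stablyEqual_equivalence (X Y : CochainComplex B ℤ) :
    _root_.Equivalence (StablyEqual : (X ⟶ Y) → (X ⟶ Y) → Prop) where
  refl f := (stablyEqual_iff f f).2 ⟨Homotopy.refl _⟩
  symm h := (stablyEqual_iff _ _).2 ⟨((stablyEqual_iff _ _).1 h).some.symm⟩
  trans h h' := (stablyEqual_iff _ _).2
    ⟨((stablyEqual_iff _ _).1 h).some.trans ((stablyEqual_iff _ _).1 h').some⟩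

/-- Up to a canonical isomorphism, `η_{X[n](n)}` is `η_X[n](n)`. -/
lemma etaC_twistShift (n : ℤ) (K : CochainComplex B ℤ) :
    ∃ a : (twist B 1).obj ((twistShift B n).obj K) ⟶ (twistShift B n).obj ((twist B 1).obj K),
      etaC ((twistShift B n).obj K) = a ≫ (twistShift B n).map (etaC K) := by
  have aux (i j : ℤ) : (shiftFunctorComm B n (1 : ℤ)).hom.app (K.X (i + n)) ≫
      (n.negOnePow • ((K.d (i + n) (j + n))⟦(1 : ℤ)⟧')⟦n⟧') =
      (n.negOnePow • (K.d (i + n) (j + n))⟦n⟧')⟦(1 : ℤ)⟧' ≫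
        (shiftFunctorComm B n (1 : ℤ)).hom.app (K.X (j + n)) := by
    have := (shiftFunctorComm B n (1 : ℤ)).hom.naturality (K.d (i + n) (j + n))
    simp only [Functor.comp_map] at this
    rw [Linear.comp_units_smul, Functor.map_units_smul, Linear.units_smul_comp, this]
  exact ⟨{ f := fun i => (shiftFunctorComm B n (1 : ℤ)).hom.app (K.X (i + n))
           comm' := fun i j _ => aux i j }, by
    ext i
    exact EtaTwist.eta_shift (K.X (i + n)) n⟩

lemma StablyEqual.twistShift {X Y : CochainComplex B ℤ} {f g : X ⟶ Y} (n : ℤ)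
    (h : StablyEqual f g) : StablyEqual ((twistShift B n).map f) ((twistShift B n).map g) := by
  rw [stablyEqual_iff] at h ⊢
  obtain ⟨h⟩ := h
  obtain ⟨a, ha⟩ := etaC_twistShift n X
  have h₁ : Homotopy ((EtaStable.twistShift B n).map (etaC X ≫ f))
      ((EtaStable.twistShift B n).map (etaC X ≫ g)) :=
    ((shiftFunctor B n).mapHomotopy h).shift n
  have h₂ := h₁.compLeft a
  rw [ha, Category.assoc, Category.assoc, ← Functor.map_comp, ← Functor.map_comp]
  exact ⟨h₂⟩

variable (B) in
/-- Two morphisms are related when their difference factors through an injective object. -/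
def stableRel : HomRel (EtaComplex B) :=
  fun (X Y : CochainComplex B ℤ) (f g : X ⟶ Y) => StablyEqual f g

instance : Congruence (stableRel B) where
  equivalence {X Y} := stablyEqual_equivalence (X : CochainComplex B ℤ) Y
  comp_left {X Y Z} f _ _ h :=
    StablyEqual.comp_left (X := (X : CochainComplex B ℤ)) (Y := Y) (Z := Z) f h
  comp_right {X Y Z} _ _ g h :=
    StablyEqual.comp_right (X := (X : CochainComplex B ℤ)) (Y := Y) (Z := Z) g h

instance : (stableRel B).IsCompatibleWithShift ℤ where
  condition n X Y _ _ h := StablyEqual.twistShift (X := (X : CochainComplex B ℤ)) (Y := Y) n h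

variable (B) in
/-- The stable category `K_η(B)` of the category of complexes in `B` with respect to the exact
structure given by the `η`-conflations. -/
abbrev KEta := Quotient (stableRel B)

instance : Preadditive (KEta B) :=
  Quotient.preadditive (stableRel B) (fun X Y _ _ _ _ h h' =>
    StablyEqual.add (X := (X : CochainComplex B ℤ)) (Y := Y) h h')

variable (B) in
/-- The quotient functor `C(B) ⥤ K_η(B)`. -/
abbrev KEta.quotient : EtaComplex B ⥤ KEta B := Quotient.functor (stableRel B)

instance : (KEta.quotient B).Additive := Quotient.functor_additive _ _

instance (n : ℤ) : (shiftFunctor (KEta B) n).Additive := by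
  have : (KEta.quotient B ⋙ shiftFunctor (KEta B) n).Additive :=
    Functor.additive_of_iso ((KEta.quotient B).commShiftIso n)
  exact Functor.additive_of_full_essSurj_comp (KEta.quotient B) _

open ZeroObject in
instance [HasZeroObject B] : HasZeroObject (KEta B) := by
  refine ⟨(KEta.quotient B).obj (0 : CochainComplex B ℤ), ?_⟩
  have h : (𝟙 (0 : CochainComplex B ℤ)) = 0 := (isZero_zero (CochainComplex B ℤ)).eq_of_src _ _
  rw [IsZero.iff_id_eq_zero]
  exact ((KEta.quotient B).map_id _).symm.trans
    ((congrArg (fun f => (KEta.quotient B).map (X := (0 : CochainComplex B ℤ))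
      (Y := (0 : CochainComplex B ℤ)) f) h).trans ((KEta.quotient B).map_zero _ _))

/-- The standard triangle `X ⟶ Y ⟶ cone(f η_X) ⟶ X(1)[1]` in `K_η(B)`. -/
def etaTriangle {X Y : CochainComplex B ℤ} (f : X ⟶ Y) : Pretriangulated.Triangle (KEta B) :=
  Pretriangulated.Triangle.mk (Y := (KEta.quotient B).obj Y)
    (Z := (KEta.quotient B).obj (CochainComplex.mappingCone (etaC X ≫ f)))
    ((KEta.quotient B).map (X := X) (Y := Y) f)
    ((KEta.quotient B).map (CochainComplex.mappingCone.inr (etaC X ≫ f)))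
    ((KEta.quotient B).map (X := CochainComplex.mappingCone (etaC X ≫ f))
      (Y := (shiftFunctor (EtaComplex B) (1 : ℤ)).obj X)
        (CochainComplex.mappingCone.triangle (etaC X ≫ f)).mor₃ ≫
      ((KEta.quotient B).commShiftIso (1 : ℤ)).hom.app X)

variable (B) in
/-- The distinguished triangles of `K_η(B)`: those isomorphic to a standard triangle. -/
def etaDistinguished : Set (Pretriangulated.Triangle (KEta B)) :=
  {T | ∃ (X Y : CochainComplex B ℤ) (f : X ⟶ Y), Nonempty (T ≅ etaTriangle f)}

end General


/-! ### Graded objects -/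

section Graded

variable (A : Type u) [Category.{v} A]

/-- A `ℤ`-graded object of `A`. -/
structure Gr where
  X : ℤ → A

variable {A}
variable [Preadditive A]

/-- A morphism of graded objects: a family `f_n^j : X^j ⟶ Y^{j+n}`, `n ≥ 0`. The component `f_n^j` is
`entry j (j + n)`, and the entries of negative degree are zero. -/
@[ext]
structure Gr.Hom (X Y : Gr A) where
  entry : ∀ j k : ℤ, X.X j ⟶ Y.X k
  entry_eq_zero : ∀ j k : ℤ, k < j → entry j k = 0

namespace Gr

/-- `(g f)_n^j = ∑ g_{n-q}^{j+q} f_q^j`. -/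
def comp {X Y Z : Gr A} (f : Hom X Y) (g : Hom Y Z) : Hom X Z where
  entry j l := ∑ k ∈ Finset.Icc j l, f.entry j k ≫ g.entry k l
  entry_eq_zero j l h := by rw [Finset.Icc_eq_empty (by lia), Finset.sum_empty]

/-- The identity `{Id, 0, 0, …}`. -/
def id (X : Gr A) : Hom X X where
  entry j k := if h : j = k then eqToHom (by rw [h]) else 0
  entry_eq_zero j k h := dif_neg (by lia)

instance : CategoryStruct (Gr A) where
  Hom := Hom
  id := id
  comp := comp

@[ext]
lemma hom_ext {X Y : Gr A} {f g : X ⟶ Y} (h : ∀ j k, f.entry j k = g.entry j k) : f = g :=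
  Hom.ext (funext₂ h)

lemma comp_entry {X Y Z : Gr A} (f : X ⟶ Y) (g : Y ⟶ Z) (j l : ℤ) :
    (f ≫ g).entry j l = ∑ k ∈ Finset.Icc j l, f.entry j k ≫ g.entry k l := rfl

lemma comp_entry_of_subset {X Y Z : Gr A} (f : X ⟶ Y) (g : Y ⟶ Z) (j l : ℤ) (s : Finset ℤ)
    (h : Finset.Icc j l ⊆ s) : (f ≫ g).entry j l = ∑ k ∈ s, f.entry j k ≫ g.entry k l := by
  rw [comp_entry]
  refine Finset.sum_subset h (fun k _ hk => ?_)
  simp only [Finset.mem_Icc, not_and_or, not_le] at hk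
  rcases hk with hk | hk
  · rw [f.entry_eq_zero _ _ hk, zero_comp]
  · rw [g.entry_eq_zero _ _ hk, comp_zero]

lemma id_entry_self (X : Gr A) (j : ℤ) : (𝟙 X : X ⟶ X).entry j j = 𝟙 (X.X j) := dif_pos rfl

lemma id_entry_ne (X : Gr A) {j k : ℤ} (h : j ≠ k) : (𝟙 X : X ⟶ X).entry j k = 0 := dif_neg h

instance : Category (Gr A) where
  id_comp {X Y} f := by
    ext j l
    rw [comp_entry]
    by_cases h : j ≤ l
    · rw [Finset.sum_eq_single_of_mem j (by simpa using h)
        (fun k _ hk => by rw [id_entry_ne _ hk.symm, zero_comp]), id_entry_self, Category.id_comp]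
    · rw [Finset.Icc_eq_empty h, Finset.sum_empty, f.entry_eq_zero _ _ (by lia)]
  comp_id {X Y} f := by
    ext j l
    rw [comp_entry]
    by_cases h : j ≤ l
    · rw [Finset.sum_eq_single_of_mem l (by simpa using h)
        (fun k _ hk => by rw [id_entry_ne _ hk, comp_zero]), id_entry_self, Category.comp_id]
    · rw [Finset.Icc_eq_empty h, Finset.sum_empty, f.entry_eq_zero _ _ (by lia)]
  assoc {W X Y Z} f g h := by
    ext j l
    rw [comp_entry, comp_entry]
    have h₁ : ∀ k ∈ Finset.Icc j l, (f ≫ g).entry j k ≫ h.entry k l =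
        ∑ m ∈ Finset.Icc j l, f.entry j m ≫ g.entry m k ≫ h.entry k l := fun k hk => by
      rw [comp_entry_of_subset f g j k (Finset.Icc j l)
        (Finset.Icc_subset_Icc_right (Finset.mem_Icc.1 hk).2), Preadditive.sum_comp]
      simp only [Category.assoc]
    have h₂ : ∀ m ∈ Finset.Icc j l, f.entry j m ≫ (g ≫ h).entry m l =
        ∑ k ∈ Finset.Icc j l, f.entry j m ≫ g.entry m k ≫ h.entry k l := fun k hk => by
      rw [comp_entry_of_subset g h k l (Finset.Icc j l)
        (Finset.Icc_subset_Icc_left (Finset.mem_Icc.1 hk).1), Preadditive.comp_sum]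
    rw [Finset.sum_congr rfl h₁, Finset.sum_congr rfl h₂, Finset.sum_comm]

instance (X Y : Gr A) : Add (X ⟶ Y) where
  add f g := ⟨fun j k => f.entry j k + g.entry j k, fun j k h => by
    rw [f.entry_eq_zero _ _ h, g.entry_eq_zero _ _ h, add_zero]⟩

instance (X Y : Gr A) : Zero (X ⟶ Y) where
  zero := ⟨fun _ _ => 0, fun _ _ _ => rfl⟩

instance (X Y : Gr A) : Neg (X ⟶ Y) where
  neg f := ⟨fun j k => - f.entry j k, fun j k h => by rw [f.entry_eq_zero _ _ h, neg_zero]⟩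

@[simp] lemma add_entry {X Y : Gr A} (f g : X ⟶ Y) (j k : ℤ) :
    (f + g).entry j k = f.entry j k + g.entry j k := rfl

@[simp] lemma neg_entry {X Y : Gr A} (f : X ⟶ Y) (j k : ℤ) :
    (-f).entry j k = - f.entry j k := rfl

@[simp] lemma zero_entry (X Y : Gr A) (j k : ℤ) : (0 : X ⟶ Y).entry j k = 0 := rfl

instance : Preadditive (Gr A) where
  homGroup X Y :=
    { add_assoc := fun _ _ _ => by ext; simp [add_assoc]
      zero_add := fun _ => by ext; simp
      add_zero := fun _ => by ext; simp
      add_comm := fun _ _ => by ext; simp [add_comm]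
      neg_add_cancel := fun _ => by ext; simp
      nsmul := nsmulRec
      zsmul := zsmulRec }
  add_comp _ _ _ _ _ _ := by
    ext
    simp [comp_entry, Finset.sum_add_distrib]
  comp_add _ _ _ _ _ _ := by
    ext
    simp [comp_entry, Finset.sum_add_distrib]

open ZeroObject in
instance [HasZeroObject A] : HasZeroObject (Gr A) :=
  ⟨⟨fun _ => 0⟩, by
    rw [IsZero.iff_id_eq_zero]
    exact hom_ext fun j k => (isZero_zero A).eq_of_src _ _⟩

/-- The morphism of degree zero given by a family of morphisms. -/
def diag {X Y : Gr A} (φ : ∀ j, X.X j ⟶ Y.X j) : X ⟶ Y where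
  entry j k := if h : j = k then φ j ≫ eqToHom (by rw [h]) else 0
  entry_eq_zero j k h := dif_neg (by lia)

lemma diag_entry_self {X Y : Gr A} (φ : ∀ j, X.X j ⟶ Y.X j) (j : ℤ) :
    (diag φ).entry j j = φ j := by simp [diag]

lemma diag_entry_ne {X Y : Gr A} (φ : ∀ j, X.X j ⟶ Y.X j) {j k : ℤ} (h : j ≠ k) :
    (diag φ).entry j k = 0 := dif_neg h

lemma diag_comp_entry {X Y Z : Gr A} (φ : ∀ j, X.X j ⟶ Y.X j) (f : Y ⟶ Z) (j l : ℤ) :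
    (diag φ ≫ f).entry j l = φ j ≫ f.entry j l := by
  rw [comp_entry]
  by_cases h : j ≤ l
  · rw [Finset.sum_eq_single_of_mem j (by simpa using h)
      (fun k _ hk => by rw [diag_entry_ne _ hk.symm, zero_comp]), diag_entry_self]
  · rw [Finset.Icc_eq_empty h, Finset.sum_empty, f.entry_eq_zero _ _ (by lia), comp_zero]

lemma comp_diag_entry {X Y Z : Gr A} (f : X ⟶ Y) (φ : ∀ j, Y.X j ⟶ Z.X j) (j l : ℤ) :
    (f ≫ diag φ).entry j l = f.entry j l ≫ φ l := by
  rw [comp_entry]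
  by_cases h : j ≤ l
  · rw [Finset.sum_eq_single_of_mem l (by simpa using h)
      (fun k _ hk => by rw [diag_entry_ne _ hk, comp_zero]), diag_entry_self]
  · rw [Finset.Icc_eq_empty h, Finset.sum_empty, f.entry_eq_zero _ _ (by lia), zero_comp]

lemma diag_comp_diag {X Y Z : Gr A} (φ : ∀ j, X.X j ⟶ Y.X j) (ψ : ∀ j, Y.X j ⟶ Z.X j) :
    diag φ ≫ diag ψ = diag (fun j => φ j ≫ ψ j) := by
  ext j k
  rw [diag_comp_entry]
  by_cases h : j = k
  · subst h
    rw [diag_entry_self, diag_entry_self]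
  · rw [diag_entry_ne _ h, diag_entry_ne _ h, comp_zero]

lemma diag_id (X : Gr A) : diag (fun j => 𝟙 (X.X j)) = 𝟙 X := by
  ext j k
  by_cases h : j = k
  · subst h
    rw [diag_entry_self, id_entry_self]
  · rw [diag_entry_ne _ h, id_entry_ne _ h]

lemma diag_add {X Y : Gr A} (φ ψ : ∀ j, X.X j ⟶ Y.X j) :
    diag φ + diag ψ = diag (fun j => φ j + ψ j) := by
  ext j k
  rw [add_entry]
  by_cases h : j = k
  · subst h
    simp only [diag_entry_self]
  · simp only [diag_entry_ne _ h, add_zero]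

lemma diag_zero (X Y : Gr A) : diag (fun j => (0 : X.X j ⟶ Y.X j)) = 0 := by
  ext j k
  simp [diag]

/-- The degreewise direct sum. -/
abbrev sum [HasBinaryBiproducts A] (X Y : Gr A) : Gr A := ⟨fun j => X.X j ⊞ Y.X j⟩

/-- The degreewise direct sum is a direct sum. -/
def binaryBicone [HasBinaryBiproducts A] (X Y : Gr A) : BinaryBicone X Y where
  pt := sum X Y
  fst := diag fun _ => biprod.fst
  snd := diag fun _ => biprod.snd
  inl := diag fun _ => biprod.inl
  inr := diag fun _ => biprod.inr
  inl_fst := by simp [diag_comp_diag, diag_id]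
  inl_snd := by simp [diag_comp_diag, diag_zero]
  inr_fst := by simp [diag_comp_diag, diag_zero]
  inr_snd := by simp [diag_comp_diag, diag_id]

lemma binaryBicone_total [HasBinaryBiproducts A] (X Y : Gr A) :
    (binaryBicone X Y).fst ≫ (binaryBicone X Y).inl +
      (binaryBicone X Y).snd ≫ (binaryBicone X Y).inr = 𝟙 (sum X Y) := by
    have h : diag (X := sum X Y) (Y := X) (fun _ => biprod.fst) ≫
          diag (fun _ => biprod.inl) +
        diag (X := sum X Y) (Y := Y) (fun _ => biprod.snd) ≫
          diag (fun _ => biprod.inr) = 𝟙 (sum X Y) := by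
      rw [diag_comp_diag, diag_comp_diag, diag_add, ← diag_id]
      exact congrArg diag (funext fun j => biprod.total)
    exact h

instance [HasBinaryBiproducts A] : HasBinaryBiproducts (Gr A) where
  has_binary_biproduct X Y :=
    hasBinaryBiproduct_of_total (binaryBicone X Y) (binaryBicone_total X Y)

variable (A) in
/-- The power `(n)` of the automorphism `(1)`: `X(n)^j = X^{j+n}` and `f(n)_m^j = f_m^{j+n}`. -/
def shift (n : ℤ) : Gr A ⥤ Gr A where
  obj X := ⟨fun j => X.X (j + n)⟩
  map f := ⟨fun j k => f.entry (j + n) (k + n), fun j k h => f.entry_eq_zero _ _ (by lia)⟩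
  map_id X := by
    ext j k
    by_cases h : j = k
    · subst h
      exact (id_entry_self X (j + n)).trans
        (id_entry_self (⟨fun j => X.X (j + n)⟩ : Gr A) j).symm
    · rw [id_entry_ne _ h]
      exact id_entry_ne X (by lia)
  map_comp f g := by
    ext j l
    simp only [comp_entry]
    rw [← Finset.image_add_right_Icc j l n, Finset.sum_image (by simp)]

lemma shift_map_entry (n : ℤ) {X Y : Gr A} (f : X ⟶ Y) (j k : ℤ) :
    ((shift A n).map f).entry j k = f.entry (j + n) (k + n) := rfl

instance (n : ℤ) : (shift A n).Additive where

lemma eqToHom_eq_diag {X Y : Gr A} (h : X = Y) :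
    eqToHom h = diag (fun j => eqToHom (by rw [h])) := by
  subst h
  exact (diag_id X).symm

lemma entry_congr {X Y : Gr A} (f : X ⟶ Y) {j j' k k' : ℤ} (hj : j = j') (hk : k = k') :
    f.entry j k ≫ eqToHom (by rw [hk]) = eqToHom (by rw [hj]) ≫ f.entry j' k' := by
  subst hj hk
  simp

lemma shift_zero_obj (X : Gr A) : (shift A 0).obj X = X := by
  simp [shift]

lemma shift_add_obj (n m : ℤ) (X : Gr A) :
    (shift A (n + m)).obj X = (shift A m).obj ((shift A n).obj X) := by
  simp [shift, add_assoc, add_comm n m]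

variable (A) in
/-- The powers of the automorphism `(1)`. -/
def shiftCore : ShiftMkCore (Gr A) ℤ where
  F := shift A
  zero := NatIso.ofComponents (fun X => eqToIso (shift_zero_obj X)) (fun {X Y} f => by
    ext j k
    rw [eqToIso.hom, eqToIso.hom, eqToHom_eq_diag, eqToHom_eq_diag, comp_diag_entry,
      diag_comp_entry]
    exact entry_congr f (add_zero j) (add_zero k))
  add n m := NatIso.ofComponents (fun X => eqToIso (shift_add_obj n m X)) (fun {X Y} f => by
    ext j k
    rw [eqToIso.hom, eqToIso.hom, eqToHom_eq_diag, eqToHom_eq_diag, comp_diag_entry,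
      diag_comp_entry]
    exact entry_congr f (by lia : j + (n + m) = j + m + n) (by lia : k + (n + m) = k + m + n))
  assoc_hom_app a b c X := by
    simp [eqToHom_map]
  zero_add_hom_app n X := by
    simp [eqToHom_map]
  add_zero_hom_app n X := by
    simp

instance : HasShift (Gr A) ℤ := hasShiftMk _ _ (shiftCore A)

instance (n : ℤ) : (shiftFunctor (Gr A) n).Additive := inferInstanceAs (shift A n).Additive

/-- The morphism `η_X = {0, Id, 0, …} : X(1) ⟶ X`. -/
def eta (X : Gr A) : (shift A 1).obj X ⟶ X where
  entry j k := if h : j + 1 = k then eqToHom (congrArg X.X h) else 0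
  entry_eq_zero j k h := dif_neg (by lia)

lemma eta_entry_self (X : Gr A) (j : ℤ) : (eta X).entry j (j + 1) = 𝟙 (X.X (j + 1)) := dif_pos rfl

lemma eta_entry_ne (X : Gr A) {j k : ℤ} (h : j + 1 ≠ k) : (eta X).entry j k = 0 := dif_neg h

lemma eta_naturality {X Y : Gr A} (f : X ⟶ Y) : (shift A 1).map f ≫ eta Y = eta X ≫ f := by
  ext j l
  rw [comp_entry, comp_entry]
  by_cases h : j + 1 ≤ l
  · obtain ⟨l', rfl⟩ : ∃ l', l = l' + 1 := ⟨l - 1, by lia⟩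
    rw [Finset.sum_eq_single_of_mem l' (Finset.mem_Icc.2 (by lia)) (fun k _ hk => by
        rw [eta_entry_ne _ (by lia), comp_zero]),
      Finset.sum_eq_single_of_mem (j + 1) (Finset.mem_Icc.2 (by lia)) (fun k _ hk => by
        rw [eta_entry_ne _ (by lia), zero_comp]), eta_entry_self, eta_entry_self]
    exact (Category.comp_id _).trans (Category.id_comp _).symm
  · rw [Finset.sum_eq_zero (fun k hk => ?_), Finset.sum_eq_zero (fun k hk => ?_)]
    · have := Finset.mem_Icc.1 hk
      rw [eta_entry_ne _ (by lia), zero_comp]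
    · have := Finset.mem_Icc.1 hk
      rw [eta_entry_ne _ (by lia), comp_zero]

lemma shiftFunctorComm_hom_app (X : Gr A) (n m : ℤ)
    (h : (shift A m).obj ((shift A n).obj X) = (shift A n).obj ((shift A m).obj X)) :
    (shiftFunctorComm (Gr A) n m).hom.app X = eqToHom h := by
  have h₁ (a b : ℤ) : (shiftFunctorAdd (Gr A) a b).hom.app X = eqToHom (shift_add_obj a b X) := rfl
  have h₂ (a b : ℤ) : (shiftFunctorAdd (Gr A) a b).inv.app X =
    eqToHom (shift_add_obj a b X).symm := rfl
  rw [shiftFunctorComm_eq _ _ _ _ rfl]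
  simp only [shiftFunctorAdd', Iso.trans_hom, Iso.symm_hom, Iso.trans_inv, NatTrans.comp_app,
    eqToIso.hom, eqToIso.inv, eqToHom_app, h₁, h₂]
  erw [Category.comp_id, eqToHom_trans, eqToHom_trans]
  rfl

instance : EtaTwist (Gr A) where
  eta :=
    { app := eta
      naturality := fun _ _ f => eta_naturality f }
  eta_shift X n := by
    have h : (shift A 1).obj ((shift A n).obj X) = (shift A n).obj ((shift A 1).obj X) := by
      simp only [shift]
      congr 1
      funext j
      congr 1
      lia
    have key : eta ((shift A n).obj X) = eqToHom h ≫ (shift A n).map (eta X) := by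
      ext j k
      rw [eqToHom_eq_diag, diag_comp_entry, shift_map_entry]
      by_cases hk : j + 1 = k
      · simp only [eta, hk, show j + n + 1 = k + n by lia, dite_true]
        exact (eqToHom_trans _ _).symm
      · simp only [eta, hk, show ¬ (j + n + 1 = k + n) by lia, dite_false]
        exact comp_zero.symm
    rw [shiftFunctorComm_hom_app X n 1 h]
    exact key

end Gr

variable (A)

/-- The graded objects with finitely many nonzero components. -/
def isBounded : ObjectProperty (Gr A) := fun X => {j : ℤ | ¬ IsZero (X.X j)}.Finite

instance : (isBounded A).IsStableUnderShift ℤ where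
  isStableUnderShiftBy n :=
    { le_shift := fun X hX => Set.Finite.preimage (f := fun j => j + n) (by simp) hX }

open ZeroObject in
instance [HasZeroObject A] : (isBounded A).ContainsZero where
  exists_zero := ⟨⟨fun _ => 0⟩, by
      rw [IsZero.iff_id_eq_zero]
      exact Gr.hom_ext fun j k => (isZero_zero A).eq_of_src _ _, by
      simp [isBounded, isZero_zero]⟩

/-- The category `gr^b A` of graded objects with finitely many nonzero components. -/
abbrev GrB := (isBounded A).FullSubcategory

variable {A} in
lemma isBounded_sum [HasBinaryBiproducts A] {X Y : Gr A} (hX : isBounded A X)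
    (hY : isBounded A Y) : isBounded A (Gr.sum X Y) := by
  refine (hX.union hY).subset (fun j hj => ?_)
  by_contra h
  simp only [Set.mem_union, Set.mem_ofPred_eq, not_or, not_not] at h
  refine hj ((IsZero.iff_id_eq_zero _).2 (biprod.hom_ext' _ _ ?_ ?_))
  · exact h.1.eq_of_src _ _
  · exact h.2.eq_of_src _ _

instance [HasBinaryBiproducts A] : HasBinaryBiproducts (GrB A) where
  has_binary_biproduct X Y := hasBinaryBiproduct_of_total
    { pt := ⟨Gr.sum X.obj Y.obj, isBounded_sum X.property Y.property⟩
      fst := ObjectProperty.homMk (Gr.binaryBicone X.obj Y.obj).fst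
      snd := ObjectProperty.homMk (Gr.binaryBicone X.obj Y.obj).snd
      inl := ObjectProperty.homMk (Gr.binaryBicone X.obj Y.obj).inl
      inr := ObjectProperty.homMk (Gr.binaryBicone X.obj Y.obj).inr
      inl_fst := InducedCategory.hom_ext (Gr.binaryBicone X.obj Y.obj).inl_fst
      inl_snd := InducedCategory.hom_ext (Gr.binaryBicone X.obj Y.obj).inl_snd
      inr_fst := InducedCategory.hom_ext (Gr.binaryBicone X.obj Y.obj).inr_fst
      inr_snd := InducedCategory.hom_ext (Gr.binaryBicone X.obj Y.obj).inr_snd }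
    (InducedCategory.hom_ext (Gr.binaryBicone_total X.obj Y.obj))


/-! ### The functor `Ξ` -/

section Sum

variable {A} [HasFiniteBiproducts A]

/-- The support of a `ℤ`-indexed family of objects. -/
abbrev Supp (Z : ℤ → A) := {j : ℤ // ¬ IsZero (Z j)}

/-- The direct sum `⨁_j Z_j` of a family with finitely many nonzero members. -/
def finiteSum (Z : ℤ → A) (h : {j : ℤ | ¬ IsZero (Z j)}.Finite) : A :=
  haveI : Finite (Supp Z) := h.to_subtype
  ⨁ fun j : Supp Z => Z j

/-- The morphism `⨁_j Z_j ⟶ ⨁_k W_k` with matrix entries `Z_j ⟶ W_k`. -/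
def matrix {Z W : ℤ → A} (h : {j : ℤ | ¬ IsZero (Z j)}.Finite)
    (h' : {j : ℤ | ¬ IsZero (W j)}.Finite) (m : ∀ j k, Z j ⟶ W k) :
    finiteSum Z h ⟶ finiteSum W h' :=
  haveI : Finite (Supp Z) := h.to_subtype
  haveI : Finite (Supp W) := h'.to_subtype
  biproduct.matrix fun (j : Supp Z) (k : Supp W) => m j k

lemma matrix_congr {Z W : ℤ → A} (h : {j : ℤ | ¬ IsZero (Z j)}.Finite)
    (h' : {j : ℤ | ¬ IsZero (W j)}.Finite) {m m' : ∀ j k, Z j ⟶ W k}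
    (e : ∀ j k, m j k = m' j k) : matrix h h' m = matrix h h' m' := by
  obtain rfl : m = m' := funext₂ e
  rfl

lemma biproduct_matrix_add {J K : Type} [Finite J] [Finite K] {Z : J → A} {W : K → A}
    (m m' : ∀ j k, Z j ⟶ W k) :
    biproduct.matrix (fun j k => m j k + m' j k) = biproduct.matrix m + biproduct.matrix m' := by
  refine biproduct.hom_ext _ _ fun k => biproduct.hom_ext' _ _ fun j => ?_
  simp

lemma biproduct_matrix_id {J : Type} [Finite J] {Z : J → A} (m : ∀ j k, Z j ⟶ Z k)
    (h₁ : ∀ j, m j j = 𝟙 (Z j)) (h₂ : ∀ j k, j ≠ k → m j k = 0) :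
    biproduct.matrix m = 𝟙 (⨁ Z) := by
  refine biproduct.hom_ext _ _ fun k => biproduct.hom_ext' _ _ fun j => ?_
  by_cases hjk : j = k
  · subst hjk
    simp [h₁]
  · simp [h₂ _ _ hjk, biproduct.ι_π_ne _ hjk]

lemma biproduct_matrix_comp {J K L : Type} [Finite J] [Fintype K] [Finite L] {Z : J → A} {W : K → A}
    {V : L → A} (m : ∀ j k, Z j ⟶ W k) (m' : ∀ j k, W j ⟶ V k) :
    biproduct.matrix m ≫ biproduct.matrix m' =
      biproduct.matrix (fun j l => ∑ k, m j k ≫ m' k l) := by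
  refine biproduct.hom_ext _ _ fun k => biproduct.hom_ext' _ _ fun j => ?_
  simp only [Category.assoc, biproduct.matrix_π, biproduct.ι_matrix_assoc, biproduct.lift_desc,
    biproduct.ι_desc]

lemma biproduct_matrix_zero {J K : Type} [Finite J] [Finite K] {Z : J → A} {W : K → A} :
    biproduct.matrix (fun (j : J) (k : K) => (0 : Z j ⟶ W k)) = 0 := by
  refine biproduct.hom_ext _ _ fun k => biproduct.hom_ext' _ _ fun j => ?_
  simp

lemma matrix_zero {Z W : ℤ → A} (h : {j : ℤ | ¬ IsZero (Z j)}.Finite)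
    (h' : {j : ℤ | ¬ IsZero (W j)}.Finite) : matrix h h' (fun _ _ => 0) = 0 :=
  @biproduct_matrix_zero _ _ _ _ _ _ h.to_subtype h'.to_subtype _ _

lemma matrix_add {Z W : ℤ → A} (h : {j : ℤ | ¬ IsZero (Z j)}.Finite)
    (h' : {j : ℤ | ¬ IsZero (W j)}.Finite) (m m' : ∀ j k, Z j ⟶ W k) :
    matrix h h' (fun j k => m j k + m' j k) = matrix h h' m + matrix h h' m' :=
  @biproduct_matrix_add _ _ _ _ _ _ h.to_subtype h'.to_subtype _ _
    (fun j k => m j k) (fun j k => m' j k)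

lemma matrix_id {Z : ℤ → A} (h : {j : ℤ | ¬ IsZero (Z j)}.Finite) (m : ∀ j k, Z j ⟶ Z k)
    (h₁ : ∀ j, m j j = 𝟙 (Z j)) (h₂ : ∀ j k, j ≠ k → m j k = 0) : matrix h h m = 𝟙 _ :=
  @biproduct_matrix_id _ _ _ _ _ h.to_subtype _ (fun j k => m j k) (fun j => h₁ j)
    (fun j k e => h₂ j k (fun e' => e (Subtype.ext e')))

lemma matrix_comp {Z W V : ℤ → A} (h : {j : ℤ | ¬ IsZero (Z j)}.Finite)
    (h' : {j : ℤ | ¬ IsZero (W j)}.Finite) (h'' : {j : ℤ | ¬ IsZero (V j)}.Finite)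
    (m : ∀ j k, Z j ⟶ W k) (m' : ∀ j k, W j ⟶ V k) (m'' : ∀ j k, Z j ⟶ V k)
    (s : ℤ → ℤ → Finset ℤ) (hs : ∀ j l k, k ∉ s j l → m j k ≫ m' k l = 0)
    (hm : ∀ j l, m'' j l = ∑ k ∈ s j l, m j k ≫ m' k l) :
    matrix h h' m ≫ matrix h' h'' m' = matrix h h'' m'' := by
  let fW : Fintype (Supp W) := @Fintype.ofFinite _ h'.to_subtype
  refine (@biproduct_matrix_comp A _ _ _ (Supp Z) (Supp W) (Supp V) h.to_subtype _
    h''.to_subtype (fun j => Z j) (fun j => W j) (fun j => V j) (fun j k => m j k)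
    (fun j k => m' j k)).trans ?_
  have key : ∀ j l, ∑ k : Supp W, m j k ≫ m' k l = m'' j l := fun j l => by
    have e := Finset.sum_subtype (F := fW) (p := fun k => ¬ IsZero (W k)) h'.toFinset (fun k => by simp)
      (fun k => m j k ≫ m' k l)
    refine e.symm.trans ?_
    rw [hm, Finset.sum_subset (Finset.subset_union_left (s₂ := s j l)),
      ← Finset.sum_subset (Finset.subset_union_right (s₁ := h'.toFinset) (s₂ := s j l))]
    · intro k _ hk
      exact hs _ _ _ hk
    · intro k _ hk
      have hk' : IsZero (W k) := by simpa using hk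
      rw [hk'.eq_of_tgt (m j k) 0, zero_comp]
  exact matrix_congr h h'' (m := fun j l => ∑ k : Supp W, m j k ≫ m' k l) key

end Sum

section Xi

variable {A} [HasFiniteBiproducts A]

variable (A) in
/-- The functor `Ξ : gr^b A ⥤ A`, `X ↦ ⨁_j X^j`; it sends `f` to the lower triangular matrix with
entries `f_{k-j}^j : X^j ⟶ Y^k`. -/
def xi : GrB A ⥤ A where
  obj X := finiteSum X.obj.X X.property
  map {X Y} f := matrix X.property Y.property f.hom.entry
  map_id X := matrix_id _ _ (fun j => Gr.id_entry_self X.obj j)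
    (fun j k h => Gr.id_entry_ne X.obj h)
  map_comp {X Y Z} f g := by
    refine (matrix_comp _ _ _ _ _ _ (fun j l => Finset.Icc j l) (fun j l k hk => ?_)
      (fun j l => rfl)).symm
    simp only [Finset.mem_Icc, not_and_or, not_le] at hk
    rcases hk with hk | hk
    · rw [f.hom.entry_eq_zero _ _ hk, zero_comp]
    · rw [g.hom.entry_eq_zero _ _ hk, comp_zero]

instance : (xi A).Additive where
  map_add {X Y f g} := matrix_add X.property Y.property f.hom.entry g.hom.entry

variable (A) in
/-- The functor `Ξ : C(gr^b A) ⥤ C(A)`. -/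
def xiC : CochainComplex (GrB A) ℤ ⥤ CochainComplex A ℤ :=
  (xi A).mapHomologicalComplex (ComplexShape.up ℤ)

end Xi

/-- The inclusion functor `C(gr^b A) ⥤ C(gr A)`. -/
def inclC : CochainComplex (GrB A) ℤ ⥤ CochainComplex (Gr A) ℤ :=
  (isBounded A).ι.mapHomologicalComplex (ComplexShape.up ℤ)

/-! ### Rickard's category `G(A)` and the total complex -/

variable {A}

/-- The differentials of an object of `G(A)` with underlying bigraded object `X`: endomorphisms `d_n`,
`n ≥ 0`, of degree `(1 - n, n)` such that `d_0 d_n + d_1 d_{n-1} + ⋯ + d_n d_0 = 0` for `n ≥ 0`. The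
component `d_n^{pq}` is `d p q (p + 1 - n) (q + n)`, and the other entries are zero. -/
structure GDiff (X : ℤ → ℤ → A) where
  d : ∀ p q p' q' : ℤ, X p q ⟶ X p' q'
  d_eq_zero : ∀ p q p' q' : ℤ, ¬ (p' + q' = p + q + 1 ∧ q ≤ q') → d p q p' q' = 0
  d_comp_d : ∀ p q p'' q'' m : ℤ, m = p + q + 1 →
    ∑ k ∈ Finset.Icc q q'', d p q (m - k) k ≫ d (m - k) k p'' q'' = 0

variable (A) in
/-- An object of `G(A)`. -/
structure GObj where
  X : ℤ → ℤ → A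
  D : GDiff X

/-- A morphism of `G(A)`: a family of maps `α_n`, `n ≥ 0`, of degree `(-n, n)` such that
`α_0 d_n + α_1 d_{n-1} + ⋯ + α_n d_0 = d_0 α_n + d_1 α_{n-1} + ⋯ + d_n α_0` for `n ≥ 0`. The
component `α_n^{pq}` is `f p q (p - n) (q + n)`, and the other entries are zero. -/
structure GHom (X Y : GObj A) where
  f : ∀ p q p' q' : ℤ, X.X p q ⟶ Y.X p' q'
  f_eq_zero : ∀ p q p' q' : ℤ, ¬ (p' + q' = p + q ∧ q ≤ q') → f p q p' q' = 0
  comm : ∀ p q p'' q'' m : ℤ, m = p + q →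
    ∑ k ∈ Finset.Icc q q'', X.D.d p q (m + 1 - k) k ≫ f (m + 1 - k) k p'' q'' =
      ∑ k ∈ Finset.Icc q q'', f p q (m - k) k ≫ Y.D.d (m - k) k p'' q''

namespace GObj

/-- The object `Ψ(X)` of `C(gr A)`, with `Ψ(X)^{ij} = X^{i-j,j}` and `d_n^{ij} = d_n^{i-j,j}`. -/
def psi (X : GObj A) : CochainComplex (Gr A) ℤ where
  X i := ⟨fun j => X.X (i - j) j⟩
  d i i' := ⟨fun j k => X.D.d (i - j) j (i' - k) k, fun j k h => X.D.d_eq_zero _ _ _ _ (by lia)⟩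
  shape i i' h := by
    ext j k
    exact X.D.d_eq_zero _ _ _ _ (fun h' => h (show i + 1 = i' by lia))
  d_comp_d' i i' i'' h _ := by
    ext j l
    obtain rfl : i + 1 = i' := h
    exact X.D.d_comp_d (i - j) j (i'' - l) l (i + 1) (by lia)

/-- There are finitely many nonzero objects in each total degree. -/
def IsLocallyFinite (X : GObj A) : Prop :=
  ∀ i : ℤ, {j : ℤ | ¬ IsZero (X.X (i - j) j)}.Finite

/-- `Ψ(X)` as an object of `C(gr^b A)`. -/
def psiB (X : GObj A) (h : X.IsLocallyFinite) : CochainComplex (GrB A) ℤ where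
  X i := ⟨X.psi.X i, h i⟩
  d i i' := ObjectProperty.homMk (X.psi.d i i')
  shape i i' h := InducedCategory.hom_ext (X.psi.shape i i' h)
  d_comp_d' i i' i'' h h' := InducedCategory.hom_ext (X.psi.d_comp_d' i i' i'' h h')

/-- The total complex, which in degree `m` is `⨁_j X^{m-j,j}`, with differential the sum of all the
`d_n`. -/
def tot [HasFiniteBiproducts A] (X : GObj A) (h : X.IsLocallyFinite) : CochainComplex A ℤ where
  X m := finiteSum (fun j => X.X (m - j) j) (h m)
  d m m' := matrix (h m) (h m') fun j k => X.D.d (m - j) j (m' - k) k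
  shape m m' hm := (matrix_congr _ _ fun j k =>
    X.D.d_eq_zero (m - j) j (m' - k) k (fun h' => hm (show m + 1 = m' by lia))).trans (matrix_zero _ _)
  d_comp_d' m m' m'' hm _ := by
    obtain rfl : m + 1 = m' := hm
    refine (matrix_comp _ _ _ _ _ (fun _ _ => 0) (fun j l => Finset.Icc j l)
      (fun j l k hk => ?_) (fun j l =>
        (X.D.d_comp_d (m - j) j (m'' - l) l (m + 1) (by lia)).symm)).trans (matrix_zero _ _)
    simp only [Finset.mem_Icc, not_and_or, not_le] at hk
    rcases hk with hk | hk
    · rw [X.D.d_eq_zero (m - j) j (m + 1 - k) k (by lia), zero_comp]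
    · rw [X.D.d_eq_zero (m + 1 - k) k (m'' - l) l (by lia), comp_zero]

end GObj

namespace GHom

variable {X Y : GObj A}

/-- The morphism `Ψ(α)`, with `Ψ(α)_n^{ij} = α_n^{i-j,j}`. -/
def psi (α : GHom X Y) : X.psi ⟶ Y.psi where
  f i := ⟨fun j k => α.f (i - j) j (i - k) k, fun j k h => α.f_eq_zero _ _ _ _ (by lia)⟩
  comm' i i' h := by
    ext j l
    obtain rfl : i + 1 = i' := h
    exact (α.comm (i - j) j (i + 1 - l) l i (by lia)).symm

/-- `Ψ(α)` as a morphism of `C(gr^b A)`. -/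
def psiB (α : GHom X Y) (hX : X.IsLocallyFinite) (hY : Y.IsLocallyFinite) :
    X.psiB hX ⟶ Y.psiB hY where
  f i := ObjectProperty.homMk (α.psi.f i)
  comm' i i' h := InducedCategory.hom_ext (α.psi.comm' i i' h)

/-- The morphism of total complexes, the sum of all the `α_n`. -/
def tot [HasFiniteBiproducts A] (α : GHom X Y) (hX : X.IsLocallyFinite)
    (hY : Y.IsLocallyFinite) : X.tot hX ⟶ Y.tot hY where
  f m := matrix (hX m) (hY m) fun j k => α.f (m - j) j (m - k) k
  comm' m m' hm := by
    obtain rfl : m + 1 = m' := hm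
    have h₁ := matrix_comp (hX m) (hX (m + 1)) (hY (m + 1))
      (fun j k => X.D.d (m - j) j (m + 1 - k) k) (fun j k => α.f (m + 1 - j) j (m + 1 - k) k)
      (fun j l => ∑ k ∈ Finset.Icc j l, X.D.d (m - j) j (m + 1 - k) k ≫
        α.f (m + 1 - k) k (m + 1 - l) l)
      (fun j l => Finset.Icc j l) (fun j l k hk => by
        simp only [Finset.mem_Icc, not_and_or, not_le] at hk
        rcases hk with hk | hk
        · rw [X.D.d_eq_zero (m - j) j (m + 1 - k) k (by lia), zero_comp]
        · rw [α.f_eq_zero (m + 1 - k) k (m + 1 - l) l (by lia), comp_zero]) (fun _ _ => rfl)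
    have h₂ := matrix_comp (hX m) (hY m) (hY (m + 1))
      (fun j k => α.f (m - j) j (m - k) k) (fun j k => Y.D.d (m - j) j (m + 1 - k) k)
      (fun j l => ∑ k ∈ Finset.Icc j l, α.f (m - j) j (m - k) k ≫
        Y.D.d (m - k) k (m + 1 - l) l)
      (fun j l => Finset.Icc j l) (fun j l k hk => by
        simp only [Finset.mem_Icc, not_and_or, not_le] at hk
        rcases hk with hk | hk
        · rw [α.f_eq_zero (m - j) j (m - k) k (by lia), zero_comp]
        · rw [Y.D.d_eq_zero (m - k) k (m + 1 - l) l (by lia), comp_zero]) (fun _ _ => rfl)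
    exact h₂.trans ((matrix_congr _ _ fun j l =>
      (α.comm (m - j) j (m + 1 - l) l m (by lia)).symm).trans h₁.symm)

end GHom

end Graded

/-! ### Projective modules and tilting complexes -/

section Modules

variable (Λ : Type u) [Ring Λ]

/-- The category `Proj Λ` of projective modules. -/
abbrev ProjMod := ObjectProperty.FullSubcategory
  (fun M : ModuleCat.{u} Λ => Module.Projective Λ M)

instance : HasZeroObject (ProjMod Λ) :=
  ⟨⟨ModuleCat.of Λ PUnit.{u + 1}, inferInstanceAs (Module.Projective Λ PUnit.{u + 1})⟩, by
    rw [IsZero.iff_id_eq_zero]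
    apply InducedCategory.hom_ext
    exact ModuleCat.hom_ext (LinearMap.ext fun _ => rfl)⟩

variable {Λ} in
/-- The direct product of two modules is their direct sum in `Proj Λ`. -/
def ProjMod.bicone (M N : ProjMod Λ) : BinaryBicone M N :=
  have : Module.Projective Λ M.obj := M.property
  have : Module.Projective Λ N.obj := N.property
  { pt := ⟨ModuleCat.of Λ (M.obj × N.obj), inferInstanceAs (Module.Projective Λ (M.obj × N.obj))⟩
    fst := ObjectProperty.homMk (ModuleCat.ofHom (LinearMap.fst Λ M.obj N.obj))
    snd := ObjectProperty.homMk (ModuleCat.ofHom (LinearMap.snd Λ M.obj N.obj))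
    inl := ObjectProperty.homMk (ModuleCat.ofHom (LinearMap.inl Λ M.obj N.obj))
    inr := ObjectProperty.homMk (ModuleCat.ofHom (LinearMap.inr Λ M.obj N.obj))
    inl_fst := rfl
    inl_snd := rfl
    inr_fst := rfl
    inr_snd := rfl }

instance : HasBinaryBiproducts (ProjMod Λ) where
  has_binary_biproduct M N := hasBinaryBiproduct_of_total (ProjMod.bicone M N)
    (InducedCategory.hom_ext (ModuleCat.hom_ext (LinearMap.ext fun _ =>
      Prod.ext (add_zero _) (zero_add _))))

instance : HasFiniteBiproducts (ProjMod Λ) :=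
  have : HasFiniteProducts (ProjMod Λ) := hasFiniteProducts_of_has_binary_and_terminal
  HasFiniteBiproducts.of_hasFiniteProducts

/-- The homotopy category `K(Proj Λ)`. -/
abbrev KProj := HomotopyCategory (ProjMod Λ) (ComplexShape.up ℤ)

/-- The quotient functor `C(Proj Λ) ⥤ K(Proj Λ)`. -/
abbrev quotProj : CochainComplex (ProjMod Λ) ℤ ⥤ KProj Λ :=
  HomotopyCategory.quotient (ProjMod Λ) (ComplexShape.up ℤ)

/-- The functor `M ↦ M^{(ι)}`, a direct sum of copies of `M` indexed by `ι`. -/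
def copies (ι : Type u) : ProjMod Λ ⥤ ProjMod Λ where
  obj M := ⟨ModuleCat.of Λ (ι →₀ M.obj),
    by
      classical
      have : Module.Projective Λ M.obj := M.property
      exact Module.Projective.of_equiv' (finsuppLequivDFinsupp (M := M.obj) Λ (ι := ι)).symm⟩
  map f := ObjectProperty.homMk (ModuleCat.ofHom (Finsupp.mapRange.linearMap f.hom.hom))
  map_id M := InducedCategory.hom_ext (ModuleCat.hom_ext (LinearMap.ext fun _ =>
    Finsupp.ext fun _ => rfl))
  map_comp f g := InducedCategory.hom_ext (ModuleCat.hom_ext (LinearMap.ext fun _ =>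
    Finsupp.ext fun _ => rfl))

instance (ι : Type u) : (copies Λ ι).Additive where
  map_add := InducedCategory.hom_ext (ModuleCat.hom_ext (LinearMap.ext fun _ =>
    Finsupp.ext fun _ => rfl))

/-- The natural morphism `M^{(ι)} ⟶ M^{(κ)}` which forgets the summands whose index is not in the
image of the injective map `j`, and sends the summand with index `j k` to the one with index `k`. -/
def copiesComap {ι κ : Type u} (j : κ → ι) (hj : Function.Injective j) :
    copies Λ ι ⟶ copies Λ κ where
  app _ := ObjectProperty.homMk (ModuleCat.ofHom (Finsupp.lcomapDomain j hj))
  naturality _ _ _ := InducedCategory.hom_ext (ModuleCat.hom_ext (LinearMap.ext fun _ =>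
    Finsupp.ext fun _ => rfl))

/-- The natural morphism `M^{(κ)} ⟶ M^{(ι)}` which sends the summand with index `k` to the one with
index `j k`. -/
def copiesMap {ι κ : Type u} (j : κ → ι) : copies Λ κ ⟶ copies Λ ι where
  app M := ObjectProperty.homMk (ModuleCat.ofHom (Finsupp.lmapDomain M.obj Λ j))
  naturality _ _ f := InducedCategory.hom_ext (ModuleCat.hom_ext (LinearMap.ext fun x =>
    (Finsupp.mapDomain_mapRange j x f.hom.hom (map_zero _) (map_add _))))

lemma copiesMap_comp_copiesComap {ι κ : Type u} (j : κ → ι) (hj : Function.Injective j) :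
    copiesMap Λ j ≫ copiesComap Λ j hj = 𝟙 (copies Λ κ) := by
  ext1
  funext M
  exact InducedCategory.hom_ext (ModuleCat.hom_ext (LinearMap.ext fun x =>
    Finsupp.comapDomain_mapDomain j hj x))

lemma copiesMap_comp_copiesComap_of_ne {ι κ κ' : Type u} (j : κ → ι) (j' : κ' → ι)
    (hj : Function.Injective j) (h : ∀ k k', j k ≠ j' k') :
    copiesMap Λ j' ≫ copiesComap Λ j hj = 0 := by
  ext1
  funext M
  refine InducedCategory.hom_ext (ModuleCat.hom_ext (LinearMap.ext fun x => ?_))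
  refine Finsupp.ext fun k => ?_
  exact Finsupp.mapDomain_of_notMem_range (f := j') x (j k) (fun ⟨k', hk'⟩ => h k k' hk'.symm)

lemma copies_total (ι κ : Type u) :
    copiesComap Λ (Sum.inl : ι → ι ⊕ κ) Sum.inl_injective ≫ copiesMap Λ (Sum.inl : ι → ι ⊕ κ) +
      copiesComap Λ (Sum.inr : κ → ι ⊕ κ) Sum.inr_injective ≫ copiesMap Λ (Sum.inr : κ → ι ⊕ κ) =
        𝟙 (copies Λ (ι ⊕ κ)) := by
  ext1
  funext M
  have key (x : ι ⊕ κ →₀ M.obj) :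
      Finsupp.mapDomain Sum.inl (Finsupp.comapDomain Sum.inl x Sum.inl_injective.injOn) +
        Finsupp.mapDomain Sum.inr (Finsupp.comapDomain Sum.inr x Sum.inr_injective.injOn) = x := by
    refine Finsupp.ext fun k => ?_
    rw [Finsupp.add_apply]
    rcases k with k | k
    · rw [Finsupp.mapDomain_apply Sum.inl_injective,
        Finsupp.mapDomain_of_notMem_range _ _ (by simp), add_zero, Finsupp.comapDomain_apply]
    · rw [Finsupp.mapDomain_apply Sum.inr_injective,
        Finsupp.mapDomain_of_notMem_range _ _ (by simp), zero_add, Finsupp.comapDomain_apply]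
  exact InducedCategory.hom_ext (ModuleCat.hom_ext (LinearMap.ext key))

variable {Λ}

/-- The complex `T^{(ι)}`, a direct sum of copies of `T` indexed by `ι`. -/
abbrev sumCopies (T : CochainComplex (ProjMod Λ) ℤ) (ι : Type u) : CochainComplex (ProjMod Λ) ℤ :=
  ((copies Λ ι).mapHomologicalComplex (ComplexShape.up ℤ)).obj T

/-- An object `T^{(ι)}` of the category `Sum T`, given by its index set. -/
structure SumT (T : CochainComplex (ProjMod Λ) ℤ) where
  ι : Type u

/-- The object of `K(Proj Λ)` attached to an object of `Sum T`. -/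
def SumT.toKProj {T : CochainComplex (ProjMod Λ) ℤ} (X : SumT T) : KProj Λ :=
  (quotProj Λ).obj (sumCopies T X.ι)

/-- `Sum T` is the full subcategory of `K(Proj Λ)` consisting of the direct sums of copies of `T`. -/
instance (T : CochainComplex (ProjMod Λ) ℤ) : Category (SumT T) :=
  inferInstanceAs (Category (InducedCategory (KProj Λ) (SumT.toKProj (T := T))))

instance (T : CochainComplex (ProjMod Λ) ℤ) : Preadditive (SumT T) :=
  inferInstanceAs (Preadditive (InducedCategory (KProj Λ) (SumT.toKProj (T := T))))

/-- The morphism `T^{(ι)} ⟶ T^{(κ)}` given by a natural transformation. -/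
def sumTMap (T : CochainComplex (ProjMod Λ) ℤ) {ι κ : Type u} (φ : copies Λ ι ⟶ copies Λ κ) :
    (⟨ι⟩ : SumT T) ⟶ ⟨κ⟩ :=
  InducedCategory.homMk ((quotProj Λ).map
    ((NatTrans.mapHomologicalComplex φ (ComplexShape.up ℤ)).app T))

lemma sumTMap_comp (T : CochainComplex (ProjMod Λ) ℤ) {ι κ μ : Type u}
    (φ : copies Λ ι ⟶ copies Λ κ) (ψ : copies Λ κ ⟶ copies Λ μ) :
    sumTMap T φ ≫ sumTMap T ψ = sumTMap T (φ ≫ ψ) :=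
  InducedCategory.hom_ext ((quotProj Λ).map_comp
    ((NatTrans.mapHomologicalComplex φ (ComplexShape.up ℤ)).app T)
    ((NatTrans.mapHomologicalComplex ψ (ComplexShape.up ℤ)).app T)).symm

lemma sumTMap_add (T : CochainComplex (ProjMod Λ) ℤ) {ι κ : Type u}
    (φ ψ : copies Λ ι ⟶ copies Λ κ) : sumTMap T φ + sumTMap T ψ = sumTMap T (φ + ψ) :=
  InducedCategory.hom_ext ((quotProj Λ).map_add
    (f := (NatTrans.mapHomologicalComplex φ (ComplexShape.up ℤ)).app T)
    (g := (NatTrans.mapHomologicalComplex ψ (ComplexShape.up ℤ)).app T)).symm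

lemma sumTMap_id (T : CochainComplex (ProjMod Λ) ℤ) (ι : Type u) :
    sumTMap T (𝟙 (copies Λ ι)) = 𝟙 (⟨ι⟩ : SumT T) :=
  InducedCategory.hom_ext ((quotProj Λ).map_id (sumCopies T ι))

lemma sumTMap_zero (T : CochainComplex (ProjMod Λ) ℤ) (ι κ : Type u) :
    sumTMap T (0 : copies Λ ι ⟶ copies Λ κ) = 0 :=
  InducedCategory.hom_ext ((quotProj Λ).map_zero (sumCopies T ι) (sumCopies T κ))

instance (T : CochainComplex (ProjMod Λ) ℤ) : HasZeroObject (SumT T) :=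
  ⟨⟨PEmpty.{u + 1}⟩, by
    rw [IsZero.iff_id_eq_zero]
    have h : (𝟙 (copies Λ PEmpty.{u + 1})) = 0 := by
      ext1
      funext M
      exact InducedCategory.hom_ext (ModuleCat.hom_ext (LinearMap.ext fun _ =>
        Finsupp.ext fun k => k.elim))
    exact (sumTMap_id T PEmpty.{u + 1}).symm.trans ((congrArg (sumTMap T) h).trans
      (sumTMap_zero T _ _))⟩

/-- `T^{(ι ⊕ κ)}` is the direct sum of `T^{(ι)}` and `T^{(κ)}`. -/
def SumT.bicone (T : CochainComplex (ProjMod Λ) ℤ) (ι κ : Type u) :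
    BinaryBicone (⟨ι⟩ : SumT T) ⟨κ⟩ where
  pt := ⟨ι ⊕ κ⟩
  fst := sumTMap T (copiesComap Λ Sum.inl Sum.inl_injective)
  snd := sumTMap T (copiesComap Λ Sum.inr Sum.inr_injective)
  inl := sumTMap T (copiesMap Λ Sum.inl)
  inr := sumTMap T (copiesMap Λ Sum.inr)
  inl_fst := by rw [sumTMap_comp, copiesMap_comp_copiesComap, sumTMap_id]
  inl_snd := by rw [sumTMap_comp, copiesMap_comp_copiesComap_of_ne _ _ _ _ (by simp), sumTMap_zero]
  inr_fst := by rw [sumTMap_comp, copiesMap_comp_copiesComap_of_ne _ _ _ _ (by simp), sumTMap_zero]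
  inr_snd := by rw [sumTMap_comp, copiesMap_comp_copiesComap, sumTMap_id]

lemma SumT.bicone_total (T : CochainComplex (ProjMod Λ) ℤ) (ι κ : Type u) :
    (SumT.bicone T ι κ).fst ≫ (SumT.bicone T ι κ).inl +
      (SumT.bicone T ι κ).snd ≫ (SumT.bicone T ι κ).inr = 𝟙 (⟨ι ⊕ κ⟩ : SumT T) := by
  have h : sumTMap T (copiesComap Λ (Sum.inl : ι → ι ⊕ κ) Sum.inl_injective) ≫
        sumTMap T (copiesMap Λ (Sum.inl : ι → ι ⊕ κ)) +
      sumTMap T (copiesComap Λ (Sum.inr : κ → ι ⊕ κ) Sum.inr_injective) ≫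
        sumTMap T (copiesMap Λ (Sum.inr : κ → ι ⊕ κ)) = 𝟙 (⟨ι ⊕ κ⟩ : SumT T) := by
    rw [sumTMap_comp, sumTMap_comp, sumTMap_add, copies_total, sumTMap_id]
  exact h

instance (T : CochainComplex (ProjMod Λ) ℤ) : HasBinaryBiproducts (SumT T) where
  has_binary_biproduct X Y :=
    hasBinaryBiproduct_of_total (SumT.bicone T X.ι Y.ι) (SumT.bicone_total T X.ι Y.ι)

/-- The property of being an object of `K^b(proj Λ)`, that is, of being isomorphic in `K(Proj Λ)` to a
bounded complex of finitely generated projective modules. -/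
def isPerfect (Λ : Type u) [Ring Λ] : ObjectProperty (KProj Λ) := fun Y =>
  ∃ K : CochainComplex (ProjMod Λ) ℤ, {i : ℤ | ¬ IsZero (K.X i)}.Finite ∧
    (∀ i, Module.Finite Λ (K.X i).obj) ∧ Nonempty (Y ≅ (quotProj Λ).obj K)

/-- The property of being an object of `add T`: a direct summand in `K^b(proj Λ)` of a finite direct
sum of copies of `T`. -/
def isAdd (T : CochainComplex (ProjMod Λ) ℤ) : ObjectProperty (KProj Λ) := fun Y =>
  isPerfect Λ Y ∧ ∃ ι : Type u, Finite ι ∧ Nonempty (Retract Y ((quotProj Λ).obj (sumCopies T ι)))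

/-- A tilting complex over `Λ`: a bounded complex `T` of finitely generated projective modules with
`Hom(T, T[n]) = 0` for `n ≠ 0` in the homotopy category, and such that `add T` generates
`K^b(proj Λ)` as a triangulated category, i.e. every triangulated subcategory which is closed under
isomorphisms and contains `add T` contains `K^b(proj Λ)`. -/
structure TiltingComplex (Λ : Type u) [Ring Λ] where
  T : CochainComplex (ProjMod Λ) ℤ
  bounded : {i : ℤ | ¬ IsZero (T.X i)}.Finite
  finite : ∀ i, Module.Finite Λ (T.X i).obj
  hom_eq_zero : ∀ n : ℤ, n ≠ 0 →
    ∀ f : (quotProj Λ).obj T ⟶ ((quotProj Λ).obj T)⟦n⟧, f = 0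
  generates : ∀ P : ObjectProperty (KProj Λ), P.IsTriangulated → P.IsClosedUnderIsomorphisms →
    isAdd T ≤ P → isPerfect Λ ≤ P

end Modules

/-! ### The operation `(-)**` and the functors `Φ`, `Θ`, `Ξ` -/

section Star

variable {Λ : Type u} [Ring Λ] {T : TiltingComplex Λ}

/-- The bigraded object `X^{pq}` underlying a complex `X` in `Sum T`: the complex `X^{∗,q}` is the
object of `Sum T` in degree `q`. -/
def bigraded (X : CochainComplex (SumT T.T) ℤ) (p q : ℤ) : ProjMod Λ :=
  (sumCopies T.T (X.X q).ι).X p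

/-- A choice of the object `X**` of `G(Λ)` for a complex `X` in `Sum T`, such that `d_0 = δ_0` is the
differential of the objects of `Sum T` and `d_1^{pq} = (-1)^{p+q} δ_1^{pq}`, where the chain map
`δ_1^{∗,q}` represents the differential of `X` in degree `q`. -/
structure StarObj (X : CochainComplex (SumT T.T) ℤ) where
  D : GDiff (bigraded X)
  δ₁ : ∀ q : ℤ, sumCopies T.T (X.X q).ι ⟶ sumCopies T.T (X.X (q + 1)).ι
  quot_δ₁ : ∀ q : ℤ, (quotProj Λ).map (δ₁ q) = (X.d q (q + 1)).hom
  d_zero : ∀ p q : ℤ, D.d p q (p + 1) q = (sumCopies T.T (X.X q).ι).d p (p + 1)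
  d_one : ∀ p q : ℤ, D.d p q p (q + 1) = (p + q).negOnePow • (δ₁ q).f p

/-- The object `X**` of `G(Λ)`. -/
def StarObj.toGObj {X : CochainComplex (SumT T.T) ℤ} (S : StarObj X) : GObj (ProjMod Λ) :=
  ⟨bigraded X, S.D⟩

lemma StarObj.isLocallyFinite {X : CochainComplex (SumT T.T) ℤ} (S : StarObj X) :
    S.toGObj.IsLocallyFinite := fun i => by
  refine (T.bounded.preimage (f := fun j => i - j) (fun a _ b _ h => by
    dsimp only at h; lia)).subset (fun j hj hz => hj ?_)
  exact (copies Λ (X.X j).ι).map_isZero hz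

/-- A choice of the morphism `α** : X** ⟶ Y**` of `G(Λ)` for a morphism `α : X ⟶ Y` of complexes in
`Sum T`, such that the chain maps `α_0^{∗,q}` represent the components of `α`. -/
structure StarHom {X Y : CochainComplex (SumT T.T) ℤ} (SX : StarObj X) (SY : StarObj Y)
    (α : X ⟶ Y) where
  hom : GHom SX.toGObj SY.toGObj
  α₀ : ∀ q : ℤ, sumCopies T.T (X.X q).ι ⟶ sumCopies T.T (Y.X q).ι
  quot_α₀ : ∀ q : ℤ, (quotProj Λ).map (α₀ q) = (α.f q).hom
  hom_zero : ∀ p q : ℤ, hom.f p q p q = (α₀ q).f p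

variable (T) in
/-- The operation `(-)**`: a choice of `X**` for every complex `X` in `Sum T` and of `α**` for every
morphism `α` of such complexes. -/
structure StarOperation where
  obj : ∀ X : CochainComplex (SumT T.T) ℤ, StarObj X
  map : ∀ {X Y : CochainComplex (SumT T.T) ℤ} (α : X ⟶ Y), StarHom (obj X) (obj Y) α

namespace StarOperation

variable (S : StarOperation T)

/-- The operation `X ↦ Tot(X**)` from `C(Sum T)` to `K(Proj Λ)`. -/
def phi : CochainComplex (SumT T.T) ℤ ⥤q KProj Λ where
  obj X := (quotProj Λ).obj ((S.obj X).toGObj.tot (S.obj X).isLocallyFinite)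
  map {X Y} α := (quotProj Λ).map ((S.map α).hom.tot (S.obj X).isLocallyFinite
    (S.obj Y).isLocallyFinite)

/-- The operation `Θ`, `X ↦ Ψ(X**)`, from `C(Sum T)` to `K_η(gr Proj Λ)`. -/
def theta : CochainComplex (SumT T.T) ℤ ⥤q KEta (Gr (ProjMod Λ)) where
  obj X := (KEta.quotient (Gr (ProjMod Λ))).obj (S.obj X).toGObj.psi
  map {X Y} α := (KEta.quotient (Gr (ProjMod Λ))).map (X := (S.obj X).toGObj.psi)
    (Y := (S.obj Y).toGObj.psi) (S.map α).hom.psi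

/-- The operation `Θ`, `X ↦ Ψ(X**)`, from `C(Sum T)` to `K_η(gr^b Proj Λ)`. -/
def thetaB : CochainComplex (SumT T.T) ℤ ⥤q KEta (GrB (ProjMod Λ)) where
  obj X := (KEta.quotient (GrB (ProjMod Λ))).obj
    ((S.obj X).toGObj.psiB (S.obj X).isLocallyFinite)
  map {X Y} α := (KEta.quotient (GrB (ProjMod Λ))).map
    (X := (S.obj X).toGObj.psiB (S.obj X).isLocallyFinite)
    (Y := (S.obj Y).toGObj.psiB (S.obj Y).isLocallyFinite)
    ((S.map α).hom.psiB (S.obj X).isLocallyFinite (S.obj Y).isLocallyFinite)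

end StarOperation

end Star

/-- A triangle functor: a functor which admits an isomorphism of commutation with the shifts, making it
send distinguished triangles to distinguished triangles. -/
def IsTriangleFunctor {C : Type*} {D : Type*} [Category* C] [Category* D] [HasZeroObject C]
    [HasZeroObject D] [Preadditive C] [Preadditive D] [HasShift C ℤ] [HasShift D ℤ]
    [∀ n : ℤ, (shiftFunctor C n).Additive] [∀ n : ℤ, (shiftFunctor D n).Additive]
    [Pretriangulated C] [Pretriangulated D] (F : C ⥤ D) : Prop :=
  ∃ _ : F.CommShift ℤ, F.IsTriangulated

end EtaStable
end

open EtaStable CategoryTheory CategoryTheory.Limits CategoryTheory.Pretriangulated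

universe u

/-!
The stable category `K_η(B)` behaves like a homotopy category: two chain maps `X ⟶ Y` are
identified if and only if they become homotopic after composition with `η_X : X(1) ⟶ X`. Hence
`cone(f η_X)` plays the role of the mapping cone of `f`, the cones of the maps `η_X` are zero in
`K_η(B)`, and the axioms of a pretriangulated category (`etaDistinguished_cocone`,
`etaDistinguished_complete`, `etaDistinguished_rotate`) follow from the usual ones for mapping
cones. Invariance under the inverse rotation is formal (`mem_of_rotate_mem`).

A functor compatible with `(1)` and `η` induces a triangle functor between stable categories,
which is fully faithful if the given functor is (`ketaMap`); this gives `J` (`ketaIncl`). The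
functor `X ↦ ⨁_j X^j` is invariant under `(1)`, and it sends `η_X` to the identification of
`⨁_j X^{j+1}` with `⨁_j X^j` (`xiInvariance`). A functor with this property turns the homotopies
after `η` into homotopies and the triangles above into those of mapping cones, and this gives `Ξ`
(`ShiftInvariance.ketaFunctor`).

For the functor `Θ`, the idea is to recover `X` from `Ψ(X**)`. A complex `M` of graded objects has
columns: the column of index `q` consists of the components of degree `q`, with the part of the
differential which preserves the degree. The part of the differential which raises the degree by
one gives chain maps between successive columns, whose compositions are null-homotopic by the part
which raises it by two. So the columns form a complex in `K(A)`. This defines a triangle functor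
from `K_η(gr A)` to the homotopy category of complexes in `K(A)` (`pageK`), because the columns of
`cone(f η_X)` are direct sums of columns of `X` and `Y`, on which `f` enters through the
differential of the complex of columns only.

For complexes whose columns are direct sums of copies of `T`, this functor is fully faithful
(`IsNegVanishing.pageK_map_bijective`). The entries of a chain map which preserve the degree are
given, and those which raise it by `w` are constructed by induction on `w`; the obstructions are
cocycles of negative degree between columns, and they are coboundaries because
`Hom(T^{(I)}, T^{(J)}[m]) = 0` for `m < 0`. The induction stops, as `T` is bounded. The same
argument shows that `X**` exists: a differential with prescribed parts of weight zero and one is a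
solution of the Maurer–Cartan equation, and, by the Bianchi identity, the obstructions to solving
it weight by weight are again cocycles of negative degree (`exists_curvature_eq_zero`).

The complex of columns of `Ψ(X**)` is `X` (`StarObj.pagePsi`), and that of `Ψ(α**)` is `α`.
Therefore `Ψ(α**)` is determined by `α` in `K_η(gr Proj Λ)`, `Θ` is a functor which is well
defined on `K(Sum T)`, and its composite with the fully faithful triangle functor of columns is
the inclusion of `K(Sum T)` in `K(K(Proj Λ))` (`StarOperation.thetaKCompSumPage`). Hence `Θ` is a
triangle functor, and it takes values in `K_η(gr^b Proj Λ)`. Finally `Φ` is the composite of `Θ`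
and `Ξ`, since the total complex of `X**` is `Ξ(Ψ(X**))`. -/

noncomputable section
namespace EtaStable

/-! ### Uniqueness of cones and the inverse rotation -/

/-- A morphism which differs from the identity by a morphism `x` with `x² = 0` is invertible, with
inverse `1 - x`. -/
lemma isIso_of_sub_comp_sub_eq_zero {C : Type*} [Category* C] [Preadditive C] {X : C} (k : X ⟶ X)
    (h : (k - 𝟙 X) ≫ (k - 𝟙 X) = 0) :
    IsIso k := by
  simp only [Preadditive.sub_comp, Preadditive.comp_sub, Category.comp_id, Category.id_comp] at h
  have h' : k ≫ k = k + k - 𝟙 X := by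
    rw [← sub_eq_zero, ← h]
    abel
  refine ⟨⟨𝟙 X + 𝟙 X - k, ?_, ?_⟩⟩ <;>
  · simp only [Preadditive.sub_comp, Preadditive.comp_sub, Preadditive.comp_add,
      Preadditive.add_comp, Category.comp_id, Category.id_comp, h']
    abel

/-- Two triangles with the same first morphism are isomorphic if their last two morphisms correspond
under an isomorphism of their third objects. -/
def triangleIsoOfIso₃ {C : Type*} [Category* C] [HasShift C ℤ] {X Y Z Z' : C} (f : X ⟶ Y)
    {g : Y ⟶ Z} {h : Z ⟶ X⟦(1 : ℤ)⟧} {g' : Y ⟶ Z'} {h' : Z' ⟶ X⟦(1 : ℤ)⟧} (e : Z ≅ Z')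
    (h₁ : g ≫ e.hom = g') (h₂ : e.hom ≫ h' = h) : Triangle.mk f g h ≅ Triangle.mk f g' h' :=
  Triangle.isoMk _ _ (Iso.refl X) (Iso.refl Y) e
    ((Category.comp_id f).trans (Category.id_comp f).symm)
    (h₁.trans (Category.id_comp g').symm)
    (((congrArg (h ≫ ·) (CategoryTheory.Functor.map_id _ _)).trans (Category.comp_id h)).trans
      h₂.symm)

section Rotation

set_option linter.unusedSectionVars false

variable {C : Type*} [Category* C] [Preadditive C] [HasShift C ℤ]
  [∀ n : ℤ, (shiftFunctor C n).Additive] {D : Set (Triangle C)}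

variable (rot : ∀ T ∈ D, T.rotate ∈ D)
  (ext : ∀ T ∈ D, ∀ (W : C) (g : T.obj₂ ⟶ W), T.mor₁ ≫ g = 0 → ∃ u, g = T.mor₂ ≫ u)
  (compl : ∀ T₁ ∈ D, ∀ T₂ ∈ D, ∀ (a : T₁.obj₁ ⟶ T₂.obj₁) (b : T₁.obj₂ ⟶ T₂.obj₂),
    T₁.mor₁ ≫ b = a ≫ T₂.mor₁ → ∃ c : T₁.obj₃ ⟶ T₂.obj₃, T₁.mor₂ ≫ c = b ≫ T₂.mor₂ ∧
      T₁.mor₃ ≫ a⟦(1 : ℤ)⟧' = c ≫ T₂.mor₃)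

include rot ext in
/-- A morphism of distinguished triangles which is the identity on the first two objects is an
isomorphism: it differs from the identity by a morphism of square zero. -/
lemma isIso_of_endomorphism {X Y Z : C} {f : X ⟶ Y} {g : Y ⟶ Z} {h : Z ⟶ X⟦(1 : ℤ)⟧}
    (hT : Triangle.mk f g h ∈ D) (k : Z ⟶ Z) (h₂ : g ≫ k = g) (h₃ : k ≫ h = h) : IsIso k := by
  obtain ⟨u, hu⟩ : ∃ u, k - 𝟙 Z = h ≫ u := ext _ (rot _ hT) Z (k - 𝟙 Z)
    (show g ≫ (k - 𝟙 Z) = 0 by rw [Preadditive.comp_sub, h₂, Category.comp_id, sub_self])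
  apply isIso_of_sub_comp_sub_eq_zero
  have h₄ : (k - 𝟙 Z) ≫ h = 0 := by rw [Preadditive.sub_comp, h₃, Category.id_comp, sub_self]
  calc (k - 𝟙 Z) ≫ (k - 𝟙 Z) = (k - 𝟙 Z) ≫ h ≫ u := by rw [← hu]
    _ = 0 := by rw [← Category.assoc, h₄, zero_comp]

include rot ext compl in
/-- A distinguished triangle is determined by its first morphism, up to an isomorphism. -/
lemma exists_iso_of_distinguished {X Y Z Z' : C} (f : X ⟶ Y) (g : Y ⟶ Z) (h : Z ⟶ X⟦(1 : ℤ)⟧)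
    (g' : Y ⟶ Z') (h' : Z' ⟶ X⟦(1 : ℤ)⟧) (hT : Triangle.mk f g h ∈ D)
    (hT' : Triangle.mk f g' h' ∈ D) : ∃ e : Z ≅ Z', g ≫ e.hom = g' ∧ e.hom ≫ h' = h := by
  have e₀ : f ≫ 𝟙 Y = 𝟙 X ≫ f := by rw [Category.comp_id, Category.id_comp]
  obtain ⟨c, hc₂, hc₃⟩ : ∃ c : Z ⟶ Z', g ≫ c = 𝟙 Y ≫ g' ∧ h ≫ (𝟙 X)⟦(1 : ℤ)⟧' = c ≫ h' :=
    compl _ hT _ hT' (𝟙 X) (𝟙 Y) e₀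
  obtain ⟨c', hc₂', hc₃'⟩ : ∃ c' : Z' ⟶ Z, g' ≫ c' = 𝟙 Y ≫ g ∧
      h' ≫ (𝟙 X)⟦(1 : ℤ)⟧' = c' ≫ h := compl _ hT' _ hT (𝟙 X) (𝟙 Y) e₀
  rw [Category.id_comp] at hc₂ hc₂'
  rw [CategoryTheory.Functor.map_id, Category.comp_id] at hc₃ hc₃'
  have h₁ : IsIso (c ≫ c') := isIso_of_endomorphism rot ext hT (c ≫ c')
    (by rw [reassoc_of% hc₂, hc₂']) (by rw [Category.assoc, ← hc₃', hc₃])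
  have h₂ : IsIso (c' ≫ c) := isIso_of_endomorphism rot ext hT' (c' ≫ c)
    (by rw [reassoc_of% hc₂', hc₂]) (by rw [Category.assoc, ← hc₃, hc₃'])
  have : IsSplitMono c := ⟨⟨⟨c' ≫ inv (c ≫ c'), by rw [← Category.assoc, IsIso.hom_inv_id]⟩⟩⟩
  have : Epi c := epi_of_epi c' c
  have : IsIso c := isIso_of_epi_of_isSplitMono c
  exact ⟨asIso c, hc₂, hc₃.symm⟩

include rot ext compl in
/-- Invariance of a class of triangles under the inverse rotation follows from the other axioms:
rotating three times is the suspension of triangles up to isomorphism, and a distinguished triangle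
is determined by its first morphism. -/
lemma mem_of_rotate_mem (iso : ∀ T₁ ∈ D, ∀ T₂ : Triangle C, (T₂ ≅ T₁) → T₂ ∈ D)
    (cocone : ∀ {X Y : C} (f : X ⟶ Y), ∃ (Z : C) (g : Y ⟶ Z) (h : Z ⟶ X⟦(1 : ℤ)⟧),
      Triangle.mk f g h ∈ D)
    (T : Triangle C) (hT : T.rotate ∈ D) : T ∈ D := by
  obtain ⟨Z, g, h, hT'⟩ := cocone T.mor₁
  obtain ⟨e, he₂, he₃⟩ : ∃ e : T.obj₃⟦(1 : ℤ)⟧ ≅ Z⟦(1 : ℤ)⟧,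
      (-T.mor₂⟦(1 : ℤ)⟧') ≫ e.hom = -g⟦(1 : ℤ)⟧' ∧ e.hom ≫ (-h⟦(1 : ℤ)⟧') = -T.mor₃⟦(1 : ℤ)⟧' :=
    exists_iso_of_distinguished rot ext compl (-T.mor₁⟦(1 : ℤ)⟧') (-T.mor₂⟦(1 : ℤ)⟧')
      (-T.mor₃⟦(1 : ℤ)⟧') (-g⟦(1 : ℤ)⟧') (-h⟦(1 : ℤ)⟧')
      (rot _ (rot _ hT)) (rot _ (rot _ (rot (Triangle.mk T.mor₁ g h) hT')))
  have h₁ : T.mor₂ ≫ ((shiftFunctor C (1 : ℤ)).preimageIso e).hom = g := by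
    apply (shiftFunctor C (1 : ℤ)).map_injective
    simpa using he₂
  have h₂ : T.mor₃ = ((shiftFunctor C (1 : ℤ)).preimageIso e).hom ≫ h := by
    apply (shiftFunctor C (1 : ℤ)).map_injective
    simpa using he₃.symm
  exact iso _ hT' _ (triangleIsoOfIso₃ T.mor₁ ((shiftFunctor C (1 : ℤ)).preimageIso e) h₁ h₂.symm)

end Rotation

end EtaStable
end

noncomputable section
namespace EtaStable

/-! ### The cone of `Z ⟶ cone(f)` when `f` factors through `Z ⟶ Y` -/

section FactoredCone

open CochainComplex CochainComplex.HomComplex CochainComplex.mappingCone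

variable {C : Type*} [Category* C] [Preadditive C] [HasBinaryBiproducts C]
  {X Y Z : CochainComplex C ℤ}

/-- The projection `cone(f) ⟶ X[1]`. -/
def coneδ (f : X ⟶ Y) : mappingCone f ⟶ X⟦(1 : ℤ)⟧ := (triangle f).mor₃

@[simp]
lemma inr_coneδ (f : X ⟶ Y) : inr f ≫ coneδ f = 0 := inr_triangleδ f

@[simp]
lemma inr_f_coneδ_f (f : X ⟶ Y) (p : ℤ) : (inr f).f p ≫ (coneδ f).f p = 0 :=
  inr_f_triangle_mor₃_f f p

@[simp]
lemma inl_v_coneδ_f (f : X ⟶ Y) (p q : ℤ) (hpq : p + (-1) = q) :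
    (inl f).v p q hpq ≫ (coneδ f).f q =
      -(X.shiftFunctorObjXIso 1 q p (by rw [← hpq, neg_add_cancel_right])).inv :=
  inl_v_triangle_mor₃_f f p q hpq

lemma inr_f_coneδ_f_assoc (f : X ⟶ Y) (p : ℤ) {W : C} (h : (X⟦(1 : ℤ)⟧).X p ⟶ W) :
    (inr f).f p ≫ (coneδ f).f p ≫ h = 0 := by
  rw [← Category.assoc, inr_f_coneδ_f, zero_comp]

lemma inl_v_coneδ_f_assoc (f : X ⟶ Y) (p q : ℤ) (hpq : p + (-1) = q) {W : C}
    (h : (X⟦(1 : ℤ)⟧).X q ⟶ W) : (inl f).v p q hpq ≫ (coneδ f).f q ≫ h =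
      (-(X.shiftFunctorObjXIso 1 q p (by rw [← hpq, neg_add_cancel_right])).inv) ≫ h := by
  rw [← Category.assoc, inl_v_coneδ_f]

variable (a : X ⟶ Z) (g : Z ⟶ Y)

/-- For `f = a ≫ g`, the morphism from the cone of `g ≫ inr f` onto `X[1]` induced by the projection
of `cone(f)`. -/
def coneRetraction : mappingCone (g ≫ inr (a ≫ g)) ⟶ X⟦(1 : ℤ)⟧ :=
  desc (g ≫ inr (a ≫ g)) 0 (coneδ (a ≫ g)) (by simp)

@[simp]
lemma inr_coneRetraction :
    inr (g ≫ inr (a ≫ g)) ≫ coneRetraction a g = coneδ (a ≫ g) := by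
  simp [coneRetraction]

/-- The section of `coneRetraction a g` given by the null-homotopy of `a ≫ g ≫ inr f`. -/
def coneSection : X⟦(1 : ℤ)⟧ ⟶ mappingCone (g ≫ inr (a ≫ g)) :=
  lift (g ≫ inr (a ≫ g)) (-(Cocycle.ofHom a).leftShift 1 1 (zero_add 1))
    (-(inl (a ≫ g)).leftShift 1 0 (neg_add_cancel 1)) (by
      simp only [Int.reduceNeg, δ_neg,
        Cochain.δ_leftShift _ 1 0 1 (neg_add_cancel 1) 0 (zero_add 1),
        Int.negOnePow_one, δ_inl, Cochain.ofHom_comp, Cochain.leftShift_comp_zero_cochain,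
        Units.neg_smul, one_smul, neg_neg, Cocycle.coe_neg, Cocycle.leftShift_coe,
        Cocycle.ofHom_coe, Cochain.neg_comp, add_neg_cancel,
        Cochain.comp_assoc_of_third_is_zero_cochain])

@[simp]
lemma coneSection_coneδ :
    coneSection a g ≫ coneδ (g ≫ inr (a ≫ g)) = -a⟦1⟧' := by
  ext p
  simp only [coneSection, Int.reduceNeg, lift_f _ _ _ _ _ (p + 1) rfl, Cocycle.coe_neg,
    Cocycle.leftShift_coe, Cocycle.ofHom_coe, Cochain.neg_v,
    (Cochain.ofHom a).leftShift_v 1 1 (zero_add 1) p (p + 1) rfl (p + 1) (by lia), mul_one,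
      sub_self, mul_zero, Int.zero_ediv, add_zero, Int.negOnePow_one,
    shiftFunctorObjXIso, HomologicalComplex.XIsoOfEq_rfl, Iso.refl_hom, Cochain.ofHom_v,
    Units.neg_smul, one_smul, neg_neg, Preadditive.neg_comp, Preadditive.add_comp, Category.assoc,
    inl_v_coneδ_f, Iso.refl_inv, inr_f_coneδ_f,
    comp_zero, neg_zero, HomologicalComplex.comp_f, HomologicalComplex.neg_f_apply]
  have h {U V : C} (φ : U ⟶ V) : (𝟙 U ≫ φ) ≫ (-𝟙 V) = -φ := by simp
  exact h (a.f (p + 1))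

@[simp]
lemma coneSection_coneRetraction : coneSection a g ≫ coneRetraction a g = 𝟙 _ := by
  ext n
  simp only [coneSection, coneRetraction, Int.reduceNeg, HomologicalComplex.comp_f,
      lift_desc_f _ _ _ _ _ _ _ _ _ rfl, Cocycle.coe_neg, Cocycle.leftShift_coe,
      Cocycle.ofHom_coe, Cochain.neg_v, Cochain.zero_v,
      comp_zero, (inl (a ≫ g)).leftShift_v 1 0 _ _ n _ (n + 1)
        (by simp only [add_neg_cancel_right]),
      mul_zero, sub_self, Int.zero_ediv, add_zero, Int.negOnePow_zero,
      one_smul, Category.assoc, inl_v_coneδ_f,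
      Preadditive.neg_comp, neg_neg, zero_add, Preadditive.comp_neg,
      HomologicalComplex.id_f, Iso.hom_inv_id]

/-- The morphism of cones `cone(Z ⟶ cone(f)) ⟶ cone(Z ⟶ Y)`; on the summand `X[1]` it is given by
the summand `a`. -/
def coneProjection : mappingCone (g ≫ inr (a ≫ g)) ⟶ mappingCone g :=
  desc (g ≫ inr (a ≫ g)) (inl g) (desc (a ≫ g) ((Cochain.ofHom a).comp (inl g) (zero_add _)) (inr g)
    (by simp)) (by simp)

/-- The morphism of cones `cone(Z ⟶ Y) ⟶ cone(Z ⟶ cone(f))` induced by the inclusion of `Y`. -/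
def coneInclusion : mappingCone g ⟶ mappingCone (g ≫ inr (a ≫ g)) :=
  desc g (inl _) (inr (a ≫ g) ≫ inr _) (by simp)

/-- The cone of `g ≫ inr (a ≫ g)` is the direct sum of the cone of `g` and of `X[1]`. -/
lemma cone_decomposition : coneProjection a g ≫ coneInclusion a g +
    coneRetraction a g ≫ coneSection a g = 𝟙 _ := by
  ext n
  simp only [coneProjection, coneInclusion, coneRetraction, coneSection, Int.reduceNeg,
    HomologicalComplex.add_f_apply, HomologicalComplex.comp_f, HomologicalComplex.id_f]
  simp only [Int.reduceNeg, ext_from_iff _ (n + 1) n rfl, Preadditive.comp_add,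
    inl_v_desc_f_assoc, inr_f_desc_f_assoc, inl_v_desc_f, inr_f_desc_f, Cochain.zero_v, zero_comp,
    add_zero, Category.comp_id, Cochain.zero_cochain_comp_v, Cochain.ofHom_v, Category.assoc,
    inl_v_coneδ_f_assoc, inr_f_coneδ_f_assoc, HomologicalComplex.comp_f, true_and, and_true]
  simp only [Int.reduceNeg, ext_to_iff _ n (n + 1) rfl, Category.assoc, Preadditive.add_comp,
    lift_f _ _ _ _ _ (n + 1) rfl]
  simp only [Int.reduceNeg, Cocycle.coe_neg, Cocycle.leftShift_coe, Cocycle.ofHom_coe,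
    Cochain.neg_v, (Cochain.ofHom a).leftShift_v 1 1 (zero_add 1) n (n + 1) rfl (n + 1) (by lia),
    (inl (a ≫ g)).leftShift_v 1 0 (neg_add_cancel 1) n n (add_zero n) (n + 1) (by lia),
    mul_one, mul_zero, sub_self, Int.zero_ediv, add_zero, Int.negOnePow_one, Int.negOnePow_zero,
    Units.neg_smul, one_smul, Cochain.ofHom_v, neg_neg, Preadditive.neg_comp,
    Preadditive.comp_neg, Category.assoc, Iso.inv_hom_id_assoc, inl_v_fst_v,
    inr_f_fst_v, inl_v_snd_v, comp_zero, zero_comp, neg_zero, zero_add,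
    inl_v_snd_v_assoc, inr_f_snd_v_assoc, Category.comp_id, add_neg_cancel, and_true,
    true_and]
  exact Iso.inv_hom_id _

end FactoredCone
end EtaStable
end

noncomputable section
namespace EtaStable

/-! ### The triangulated structure of `K_η(B)` -/

section Triangles

universe v w

open CochainComplex (mappingCone)
open CochainComplex.HomComplex CochainComplex.mappingCone

variable {B : Type w} [Category.{v} B] [Preadditive B] [HasShift B ℤ]
  [∀ n : ℤ, (shiftFunctor B n).Additive] [HasBinaryBiproducts B] [EtaTwist B]

/-- A chain complex as an object of `K_η(B)`. -/
abbrev qObj (X : CochainComplex B ℤ) : KEta B := (KEta.quotient B).obj X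

/-- The class of a chain map in `K_η(B)`. -/
abbrev qMap {X Y : CochainComplex B ℤ} (f : X ⟶ Y) : qObj X ⟶ qObj Y :=
  (KEta.quotient B).map (X := X) (Y := Y) f

lemma qMap_comp {X Y Z : CochainComplex B ℤ} (f : X ⟶ Y) (g : Y ⟶ Z) :
    qMap (f ≫ g) = qMap f ≫ qMap g :=
  (KEta.quotient B).map_comp (X := X) (Y := Y) (Z := Z) f g

lemma qMap_id (X : CochainComplex B ℤ) : qMap (𝟙 X) = 𝟙 (qObj X) :=
  (KEta.quotient B).map_id X

lemma qMap_add {X Y : CochainComplex B ℤ} (f g : X ⟶ Y) : qMap (f + g) = qMap f + qMap g :=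
  (KEta.quotient B).map_add (X := X) (Y := Y) (f := f) (g := g)

lemma qMap_neg {X Y : CochainComplex B ℤ} (f : X ⟶ Y) : qMap (-f) = -qMap f :=
  (KEta.quotient B).map_neg (X := X) (Y := Y) (f := f)

lemma qMap_sub {X Y : CochainComplex B ℤ} (f g : X ⟶ Y) : qMap (f - g) = qMap f - qMap g :=
  (KEta.quotient B).map_sub (X := X) (Y := Y) (f := f) (g := g)

lemma qMap_zero (X Y : CochainComplex B ℤ) : qMap (0 : X ⟶ Y) = 0 :=
  (KEta.quotient B).map_zero X Y

lemma qMap_surjective {X Y : CochainComplex B ℤ} (f : qObj X ⟶ qObj Y) :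
    ∃ φ : X ⟶ Y, qMap φ = f :=
  (Quotient.full_functor (stableRel B)).map_surjective (X := X) (Y := Y) f

lemma qObj_surjective (X : KEta B) : ∃ K : CochainComplex B ℤ, qObj K = X := ⟨X.as, rfl⟩

lemma qMap_eq_iff {X Y : CochainComplex B ℤ} (f g : X ⟶ Y) :
    qMap f = qMap g ↔ StablyEqual f g :=
  Quotient.functor_map_eq_iff (stableRel B) (X := X) (Y := Y) f g

lemma qMap_eq_iff_homotopy {X Y : CochainComplex B ℤ} (f g : X ⟶ Y) :
    qMap f = qMap g ↔ Nonempty (Homotopy (etaC X ≫ f) (etaC X ≫ g)) :=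
  (qMap_eq_iff f g).trans (stablyEqual_iff f g)

/-- A chain map which factors through an injective complex is zero in `K_η(B)`. -/
lemma qMap_comp_eq_zero {X I Y : CochainComplex B ℤ} (hI : IsEtaInjective I) (a : X ⟶ I)
    (b : I ⟶ Y) : qMap (a ≫ b) = 0 := by
  rw [← qMap_zero, qMap_eq_iff]
  exact ⟨I, a, b, hI, sub_zero _⟩

/-- The commutation of the quotient functor with `[1](1)`. -/
def qShift (X : CochainComplex B ℤ) : qObj ((twistShift B 1).obj X) ≅ (qObj X)⟦(1 : ℤ)⟧ :=
  ((KEta.quotient B).commShiftIso (1 : ℤ)).app X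

lemma qShift_hom_naturality {X Y : CochainComplex B ℤ} (f : X ⟶ Y) :
    qMap ((twistShift B 1).map f) ≫ (qShift Y).hom = (qShift X).hom ≫ (qMap f)⟦(1 : ℤ)⟧' :=
  ((KEta.quotient B).commShiftIso (1 : ℤ)).hom.naturality (X := X) (Y := Y) f

/-- The projection `cone(f η_X) ⟶ X(1)[1]`. -/
def etaδ {X Y : CochainComplex B ℤ} (f : X ⟶ Y) :
    mappingCone (etaC X ≫ f) ⟶ (twistShift B 1).obj X := coneδ (etaC X ≫ f)

lemma etaTriangle_eq {X Y : CochainComplex B ℤ} (f : X ⟶ Y) : etaTriangle f =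
    Triangle.mk (qMap f) (qMap (inr (etaC X ≫ f))) (qMap (etaδ f) ≫ (qShift X).hom) := rfl

lemma etaTriangle_mem {X Y : CochainComplex B ℤ} (f : X ⟶ Y) :
    Triangle.mk (qMap f) (qMap (inr (etaC X ≫ f))) (qMap (etaδ f) ≫ (qShift X).hom) ∈
      etaDistinguished B := ⟨X, Y, f, ⟨Iso.refl _⟩⟩

lemma etaDistinguished_isomorphic (T₁ : Triangle (KEta B)) (hT₁ : T₁ ∈ etaDistinguished B)
    (T₂ : Triangle (KEta B)) (e : T₂ ≅ T₁) : T₂ ∈ etaDistinguished B := by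
  obtain ⟨X, Y, f, ⟨e'⟩⟩ := hT₁
  exact ⟨X, Y, f, ⟨e ≪≫ e'⟩⟩

lemma etaDistinguished_cocone {X Y : KEta B} (f : X ⟶ Y) :
    ∃ (Z : KEta B) (g : Y ⟶ Z) (h : Z ⟶ X⟦(1 : ℤ)⟧), Triangle.mk f g h ∈ etaDistinguished B := by
  obtain ⟨X, rfl⟩ := qObj_surjective X
  obtain ⟨Y, rfl⟩ := qObj_surjective Y
  obtain ⟨φ, rfl⟩ := qMap_surjective f
  exact ⟨_, _, _, etaTriangle_mem φ⟩

lemma isZero_qObj {I : CochainComplex B ℤ} (hI : IsEtaInjective I) : IsZero (qObj I) := by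
  rw [IsZero.iff_id_eq_zero, ← qMap_id, ← Category.comp_id (𝟙 I)]
  exact qMap_comp_eq_zero hI _ _

open ZeroObject in
lemma etaDistinguished_contractible [HasZeroObject B] (X : KEta B) :
    contractibleTriangle X ∈ etaDistinguished B := by
  obtain ⟨X, rfl⟩ := qObj_surjective X
  have h : IsZero (qObj (mappingCone (etaC X ≫ 𝟙 X))) := by
    rw [Category.comp_id]
    exact isZero_qObj (isEtaInjective_cone X)
  have h₁ : Triangle.mk (qMap (𝟙 X)) (0 : qObj X ⟶ 0) 0 ∈ etaDistinguished B :=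
    etaDistinguished_isomorphic _ (etaTriangle_mem (𝟙 X)) _
      (triangleIsoOfIso₃ _ h.isoZero.symm (h.eq_of_tgt _ _) ((isZero_zero (KEta B)).eq_of_src _ _))
  rw [qMap_id] at h₁
  exact h₁

lemma exists_isos_of_triangle_iso {C : Type*} [Category* C] [HasShift C ℤ] (T : Triangle C)
    {X Y Z : C} {f : X ⟶ Y} {g : Y ⟶ Z} {h : Z ⟶ X⟦(1 : ℤ)⟧} (e : T ≅ Triangle.mk f g h) :
    ∃ (e₁ : T.obj₁ ≅ X) (e₂ : T.obj₂ ≅ Y) (e₃ : T.obj₃ ≅ Z), T.mor₁ ≫ e₂.hom = e₁.hom ≫ f ∧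
      T.mor₂ ≫ e₃.hom = e₂.hom ≫ g ∧ T.mor₃ ≫ e₁.hom⟦(1 : ℤ)⟧' = e₃.hom ≫ h :=
  ⟨Triangle.π₁.mapIso e, Triangle.π₂.mapIso e, Triangle.π₃.mapIso e, e.hom.comm₁, e.hom.comm₂,
    e.hom.comm₃⟩

/-- A morphism whose restriction along the first morphism of a distinguished triangle is zero
factors through the second one: after composition with `η` it is null-homotopic on `X`, so that it
extends to the cone of `f η_X`. -/
lemma etaDistinguished_ext (T : Triangle (KEta B)) (hT : T ∈ etaDistinguished B) (W : KEta B)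
    (g : T.obj₂ ⟶ W) (hg : T.mor₁ ≫ g = 0) : ∃ u, g = T.mor₂ ≫ u := by
  obtain ⟨X, Y, f, ⟨e⟩⟩ := hT
  rw [etaTriangle_eq] at e
  obtain ⟨e₁, e₂, e₃, h₁, h₂, -⟩ := exists_isos_of_triangle_iso T e
  obtain ⟨W, rfl⟩ := qObj_surjective W
  obtain ⟨φ, hφ⟩ : ∃ φ : Y ⟶ W, qMap φ = e₂.inv ≫ g := qMap_surjective _
  have h : qMap (f ≫ φ) = qMap 0 := by
    rw [qMap_comp, hφ, qMap_zero, ← cancel_epi e₁.hom, ← reassoc_of% h₁, e₂.hom_inv_id_assoc, hg,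
      comp_zero]
  rw [qMap_eq_iff_homotopy] at h
  obtain ⟨b, hb⟩ := exists_extension (etaC X ≫ f) φ (by
    have := h.some
    rwa [comp_zero, ← Category.assoc] at this)
  refine ⟨e₃.hom ≫ qMap b, ?_⟩
  rw [reassoc_of% h₂, ← qMap_comp, hb, hφ, e₂.hom_inv_id_assoc]

/-- A commutative square in `K_η(B)` is a square of chain maps which commutes up to homotopy after
composition with `η`; the homotopy gives a map between the cones. -/
lemma etaDistinguished_complete (T₁ : Triangle (KEta B)) (hT₁ : T₁ ∈ etaDistinguished B)
    (T₂ : Triangle (KEta B)) (hT₂ : T₂ ∈ etaDistinguished B) (a : T₁.obj₁ ⟶ T₂.obj₁)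
    (b : T₁.obj₂ ⟶ T₂.obj₂) (fac : T₁.mor₁ ≫ b = a ≫ T₂.mor₁) :
    ∃ c : T₁.obj₃ ⟶ T₂.obj₃, T₁.mor₂ ≫ c = b ≫ T₂.mor₂ ∧
      T₁.mor₃ ≫ a⟦(1 : ℤ)⟧' = c ≫ T₂.mor₃ := by
  obtain ⟨X₁, Y₁, f₁, ⟨e₁⟩⟩ := hT₁
  obtain ⟨X₂, Y₂, f₂, ⟨e₂⟩⟩ := hT₂
  rw [etaTriangle_eq] at e₁ e₂
  obtain ⟨u₁, u₂, u₃, p₁, p₂, p₃⟩ := exists_isos_of_triangle_iso T₁ e₁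
  obtain ⟨v₁, v₂, v₃, q₁, q₂, q₃⟩ := exists_isos_of_triangle_iso T₂ e₂
  obtain ⟨α, hα⟩ : ∃ α : X₁ ⟶ X₂, qMap α = u₁.inv ≫ a ≫ v₁.hom := qMap_surjective _
  obtain ⟨β, hβ⟩ : ∃ β : Y₁ ⟶ Y₂, qMap β = u₂.inv ≫ b ≫ v₂.hom := qMap_surjective _
  have hα' : u₁.hom ≫ qMap α = a ≫ v₁.hom := by rw [hα, Iso.hom_inv_id_assoc]
  have hβ' : u₂.hom ≫ qMap β = b ≫ v₂.hom := by rw [hβ, Iso.hom_inv_id_assoc]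
  have h : qMap (f₁ ≫ β) = qMap (α ≫ f₂) := by
    rw [qMap_comp, qMap_comp, ← cancel_epi u₁.hom, ← reassoc_of% p₁, hβ', reassoc_of% fac, q₁,
      reassoc_of% hα']
  rw [qMap_eq_iff_homotopy] at h
  have H : Homotopy ((etaC X₁ ≫ f₁) ≫ β) ((twist B 1).map α ≫ (etaC X₂ ≫ f₂)) :=
    (Homotopy.ofEq (Category.assoc _ _ _)).trans (h.some.trans (Homotopy.ofEq (by
      rw [← Category.assoc, ← Category.assoc, etaC_naturality])))
  have r₂ : qMap (inr (etaC X₁ ≫ f₁)) ≫ qMap (mapOfHomotopy H) =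
      qMap β ≫ qMap (inr (etaC X₂ ≫ f₂)) := by
    rw [← qMap_comp, ← qMap_comp]
    exact congrArg qMap (triangleMapOfHomotopy_comm₂ H)
  have r₃ : qMap (mapOfHomotopy H) ≫ qMap (etaδ f₂) =
      qMap (etaδ f₁) ≫ qMap ((twistShift B 1).map α) := by
    rw [← qMap_comp, ← qMap_comp]
    exact congrArg qMap (triangleMapOfHomotopy_comm₃ H)
  refine ⟨u₃.hom ≫ qMap (mapOfHomotopy H) ≫ v₃.inv, ?_, ?_⟩
  · rw [← cancel_mono v₃.hom]
    simp only [Category.assoc, Iso.inv_hom_id, Category.comp_id]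
    rw [reassoc_of% p₂, r₂, reassoc_of% hβ', q₂]
  · have q₃' : v₃.inv ≫ T₂.mor₃ ≫ v₁.hom⟦(1 : ℤ)⟧' = qMap (etaδ f₂) ≫ (qShift X₂).hom := by
      rw [q₃, Iso.inv_hom_id_assoc]
    rw [← cancel_mono (v₁.hom⟦(1 : ℤ)⟧')]
    simp only [Category.assoc]
    rw [q₃', reassoc_of% r₃, qShift_hom_naturality, ← Functor.map_comp, ← hα', Functor.map_comp,
      reassoc_of% p₃]

/-- The rotation of a standard triangle is isomorphic to the standard triangle of the inclusion
`Y ⟶ cone(f η_X)`, whose third object is the cone of `η_Y` followed by this inclusion. Indeed the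
map `f η_X = η_Y f(1)` factors through `η_Y`, so that this third object is the direct sum of
`X(1)[1]` and of `cone(η_Y)`, which is zero in `K_η(B)`. -/
lemma etaDistinguished_rotate_standard {X Y : CochainComplex B ℤ} (f : X ⟶ Y) :
    (Triangle.mk (qMap f) (qMap (inr (etaC X ≫ f))) (qMap (etaδ f) ≫ (qShift X).hom)).rotate ∈
      etaDistinguished B := by
  have key : ∀ (c : (twist B 1).obj X ⟶ Y), c = (twist B 1).map f ≫ etaC Y →
      Triangle.mk (qMap (inr c)) (qMap (coneδ c) ≫ (qShift X).hom)
        (-(qMap f)⟦(1 : ℤ)⟧') ∈ etaDistinguished B := by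
    rintro _ rfl
    -- with these notations `a ≫ g` is the map whose cone is taken, and `g ≫ inr (a ≫ g)` is the
    -- composite of `η_Y` with the inclusion of `Y` in that cone
    set a := (twist B 1).map f
    set g := etaC Y
    have hz : IsZero (qObj (mappingCone g)) := isZero_qObj (isEtaInjective_cone Y)
    let r : mappingCone (g ≫ inr (a ≫ g)) ⟶ (twistShift B 1).obj X := coneRetraction a g
    let s : (twistShift B 1).obj X ⟶ mappingCone (g ≫ inr (a ≫ g)) := coneSection a g
    have hsr : s ≫ r = 𝟙 _ := coneSection_coneRetraction a g
    have hir : inr (g ≫ inr (a ≫ g)) ≫ r = coneδ (a ≫ g) := inr_coneRetraction a g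
    have hd : coneProjection a g ≫ coneInclusion a g + r ≫ s = 𝟙 _ := cone_decomposition a g
    have hsδ : s ≫ etaδ (inr (a ≫ g)) = -(twistShift B 1).map f := coneSection_coneδ a g
    let e : qObj (mappingCone (g ≫ inr (a ≫ g))) ≅ qObj ((twistShift B 1).obj X) :=
      { hom := qMap r
        inv := qMap s
        hom_inv_id := by
          have := congrArg qMap hd
          rwa [qMap_add, qMap_comp, qMap_comp, hz.eq_of_tgt (qMap (coneProjection a g)) 0,
            zero_comp, zero_add, qMap_id] at this
        inv_hom_id := by rw [← qMap_comp, hsr, qMap_id] }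
    refine etaDistinguished_isomorphic _ (etaTriangle_mem (inr (a ≫ g))) _
      (triangleIsoOfIso₃ _ (e ≪≫ qShift X).symm ?_ ?_)
    · rw [Iso.symm_hom, Iso.comp_inv_eq, Iso.trans_hom]
      change _ = qMap _ ≫ qMap r ≫ _
      rw [← Category.assoc, ← qMap_comp]
      exact congrArg (fun t => qMap t ≫ (qShift X).hom) hir.symm
    · have h : qMap s ≫ qMap (etaδ (inr (a ≫ g))) ≫ (qShift Y).hom =
          (qShift X).hom ≫ (-(qMap f)⟦(1 : ℤ)⟧') := by
        rw [← Category.assoc, ← qMap_comp, hsδ, qMap_neg, Preadditive.neg_comp,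
          qShift_hom_naturality, Preadditive.comp_neg]
      change ((qShift X).inv ≫ qMap s) ≫ qMap (etaδ (inr (a ≫ g))) ≫ (qShift Y).hom = _
      rw [Category.assoc, h, Iso.inv_hom_id_assoc]
  exact key _ (etaC_naturality f).symm

lemma etaDistinguished_rotate (T : Triangle (KEta B)) (hT : T ∈ etaDistinguished B) :
    T.rotate ∈ etaDistinguished B := by
  obtain ⟨X, Y, f, ⟨e⟩⟩ := hT
  exact etaDistinguished_isomorphic _ (etaDistinguished_rotate_standard f) _
    ((Pretriangulated.rotate _).mapIso e)

/-- The stable category `K_η(B)` with the triangles isomorphic to a standard triangle. -/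
instance [HasZeroObject B] : Pretriangulated (KEta B) where
  distinguishedTriangles := etaDistinguished B
  isomorphic_distinguished := etaDistinguished_isomorphic
  contractible_distinguished := etaDistinguished_contractible
  distinguished_cocone_triangle := etaDistinguished_cocone
  rotate_distinguished_triangle T := ⟨etaDistinguished_rotate T,
    mem_of_rotate_mem etaDistinguished_rotate etaDistinguished_ext etaDistinguished_complete
      etaDistinguished_isomorphic etaDistinguished_cocone T⟩
  complete_distinguished_triangle_morphism T₁ T₂ h₁ h₂ a b fac :=
    etaDistinguished_complete T₁ h₁ T₂ h₂ a b fac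

lemma mem_distTriang_iff [HasZeroObject B] (T : Triangle (KEta B)) :
    (T ∈ distTriang (KEta B)) ↔ T ∈ etaDistinguished B := Iff.rfl

end Triangles
end EtaStable
end

noncomputable section
namespace EtaStable

/-! ### Functors on `K_η(B)` induced by functors on complexes -/

section Lift

universe v w

open CochainComplex (mappingCone)
open CochainComplex.HomComplex CochainComplex.mappingCone

variable {B : Type w} [Category.{v} B] [Preadditive B] [HasShift B ℤ]
  [∀ n : ℤ, (shiftFunctor B n).Additive] [HasBinaryBiproducts B] [EtaTwist B]
  {D : Type*} [Category* D] [HasShift D ℤ]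

/-- The functor on `K_η(B)` induced by a functor on complexes which identifies the maps whose
difference factors through an injective complex. -/
def ketaLift (G : EtaComplex B ⥤ D) (hG : ∀ (X Y : CochainComplex B ℤ) (f g : X ⟶ Y),
    StablyEqual f g → G.map (X := X) (Y := Y) f = G.map (X := X) (Y := Y) g) : KEta B ⥤ D :=
  CategoryTheory.Quotient.lift (stableRel B) G hG

variable (G : EtaComplex B ⥤ D) (hG : ∀ (X Y : CochainComplex B ℤ) (f g : X ⟶ Y),
    StablyEqual f g → G.map (X := X) (Y := Y) f = G.map (X := X) (Y := Y) g)

omit [HasShift D ℤ] in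
lemma quotient_comp_ketaLift : KEta.quotient B ⋙ ketaLift G hG = G :=
  CategoryTheory.Quotient.lift_spec _ _ _

instance ketaLiftCommShift [G.CommShift ℤ] : (ketaLift G hG).CommShift ℤ :=
  CategoryTheory.Quotient.liftCommShift _ _ _ _

/-- The commutation of the induced functor with the shifts is the one of `G`, on the image of the
quotient functor. -/
lemma ketaLift_qShift [G.CommShift ℤ] (X : CochainComplex B ℤ) :
    (ketaLift G hG).map (qShift X).hom ≫ ((ketaLift G hG).commShiftIso (1 : ℤ)).hom.app (qObj X) =
      (G.commShiftIso (1 : ℤ)).hom.app X := by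
  have h : ((ketaLift G hG).commShiftIso (1 : ℤ)).hom.app (qObj X) =
      (ketaLift G hG).map (qShift X).inv ≫ (G.commShiftIso (1 : ℤ)).hom.app X :=
    Quotient.LiftCommShift.iso_hom_app G (stableRel B) hG (1 : ℤ) X
  rw [h]
  exact (Category.assoc _ _ _).symm.trans ((congrArg (· ≫ (G.commShiftIso (1 : ℤ)).hom.app X)
    (((ketaLift G hG).mapIso (qShift X)).hom_inv_id)).trans (Category.id_comp _))

/-- A functor on `K_η(B)` is a triangle functor as soon as it sends the standard triangles to
distinguished triangles. -/
lemma ketaLift_isTriangulated [G.CommShift ℤ] [HasZeroObject B] [HasZeroObject D] [Preadditive D]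
    [∀ n : ℤ, (shiftFunctor D n).Additive] [Pretriangulated D]
    (h : ∀ (X Y : CochainComplex B ℤ) (f : X ⟶ Y),
      Triangle.mk (G.map (X := X) (Y := Y) f) (G.map (X := Y) (inr (etaC X ≫ f)))
        (G.map (X := mappingCone (etaC X ≫ f)) (Y := (twistShift B 1).obj X) (etaδ f) ≫
          (G.commShiftIso (1 : ℤ)).hom.app X) ∈ distTriang D) :
    (ketaLift G hG).IsTriangulated where
  map_distinguished := by
    rintro T ⟨X, Y, f, ⟨e⟩⟩
    have e₁ : (ketaLift G hG).map (qMap (etaδ f) ≫ (qShift X).hom) ≫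
        ((ketaLift G hG).commShiftIso (1 : ℤ)).hom.app (qObj X) =
          G.map (X := mappingCone (etaC X ≫ f)) (Y := (twistShift B 1).obj X) (etaδ f) ≫
            (G.commShiftIso (1 : ℤ)).hom.app X :=
      (congrArg (· ≫ _) (Functor.map_comp _ _ _)).trans ((Category.assoc _ _ _).trans
        (congrArg (_ ≫ ·) (ketaLift_qShift G hG X)))
    exact isomorphic_distinguished _ (h X Y f) _
      ((ketaLift G hG).mapTriangle.mapIso e ≪≫ eqToIso (congrArg (Triangle.mk _ _) e₁))

end Lift
end EtaStable
end

noncomputable section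
namespace EtaStable

/-! ### Functors between stable categories -/

section ConeIso

open CochainComplex (mappingCone)
open CochainComplex.HomComplex CochainComplex.mappingCone

variable {C : Type*} [Category* C] [Preadditive C] [HasBinaryBiproducts C]
  {X X' Y : CochainComplex C ℤ}

/-- The cones of `f` and `f'` are isomorphic if `f` and `f'` differ by an isomorphism of their
sources. -/
def coneIso (c : X ≅ X') (f : X ⟶ Y) (f' : X' ⟶ Y) (h : f ≫ 𝟙 Y = c.hom ≫ f') :
    mappingCone f ≅ mappingCone f' where
  hom := CochainComplex.mappingCone.map f f' c.hom (𝟙 Y) h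
  inv := CochainComplex.mappingCone.map f' f c.inv (𝟙 Y) (by
    rw [Iso.eq_inv_comp, ← Category.assoc, ← h]; simp)
  hom_inv_id := by
    rw [← CochainComplex.mappingCone.map_comp]
    simp [CochainComplex.mappingCone.map_id]
  inv_hom_id := by
    rw [← CochainComplex.mappingCone.map_comp]
    simp [CochainComplex.mappingCone.map_id]

lemma inr_coneIso_hom (c : X ≅ X') (f : X ⟶ Y) (f' : X' ⟶ Y) (h : f ≫ 𝟙 Y = c.hom ≫ f') :
    inr f ≫ (coneIso c f f' h).hom = inr f' :=
  (triangleMap f f' c.hom (𝟙 Y) h).comm₂.trans (Category.id_comp _)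

lemma coneIso_hom_coneδ (c : X ≅ X') (f : X ⟶ Y) (f' : X' ⟶ Y) (h : f ≫ 𝟙 Y = c.hom ≫ f') :
    (coneIso c f f' h).hom ≫ coneδ f' = coneδ f ≫ c.hom⟦(1 : ℤ)⟧' :=
  (triangleMap f f' c.hom (𝟙 Y) h).comm₃.symm

end ConeIso

section CommShiftMk

variable {C D : Type*} [Category* C] [Category* D] [HasShift C ℤ] [HasShift D ℤ]

/-- A constructor for the commutation of a functor with shifts, in which the two coherence
conditions are stated with the structural isomorphisms of the target on the left hand side. -/
@[reducible]
def commShiftMk (G : C ⥤ D) (e : ∀ (n : ℤ) (X : C), G.obj (X⟦n⟧) ≅ (G.obj X)⟦n⟧)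
    (nat : ∀ (n : ℤ) {X Y : C} (f : X ⟶ Y), G.map (f⟦n⟧') ≫ (e n Y).hom =
      (e n X).hom ≫ (G.map f)⟦n⟧')
    (zero : ∀ X : C, (e 0 X).hom ≫ (shiftFunctorZero D ℤ).hom.app (G.obj X) =
      G.map ((shiftFunctorZero C ℤ).hom.app X))
    (add : ∀ (n m : ℤ) (X : C), (e (n + m) X).hom ≫ (shiftFunctorAdd D n m).hom.app (G.obj X) =
      G.map ((shiftFunctorAdd C n m).hom.app X) ≫ (e m (X⟦n⟧)).hom ≫ (e n X).hom⟦m⟧') :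
    G.CommShift ℤ where
  commShiftIso n := NatIso.ofComponents (e n) (fun f => nat n f)
  commShiftIso_zero := by
    ext X
    rw [Functor.CommShift.isoZero_hom_app, ← zero X, Category.assoc, Iso.hom_inv_id_app]
    exact (Category.comp_id _).symm
  commShiftIso_add n m := by
    ext X
    rw [Functor.CommShift.isoAdd_hom_app, ← cancel_mono ((shiftFunctorAdd D n m).hom.app (G.obj X))]
    simp only [Category.assoc, Iso.inv_hom_id_app]
    exact (add n m X).trans (by simp)

end CommShiftMk

lemma map_XIsoOfEq_hom {B B' : Type*} [Category* B] [Category* B'] [Preadditive B] [Preadditive B']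
    (F : B ⥤ B') [F.Additive] (K : CochainComplex B ℤ) {p q : ℤ} (h : p = q) :
    (((F.mapHomologicalComplex (ComplexShape.up ℤ)).obj K).XIsoOfEq h).hom =
      F.map (K.XIsoOfEq h).hom := by
  subst h
  exact (F.map_id (K.X p)).symm

section Induced

set_option linter.unusedSectionVars false

universe v w v' w'

open CochainComplex (mappingCone)
open CochainComplex.HomComplex CochainComplex.mappingCone

variable {B : Type w} [Category.{v} B] [Preadditive B] [HasShift B ℤ]
  [∀ n : ℤ, (shiftFunctor B n).Additive]
  {B' : Type w'} [Category.{v'} B'] [Preadditive B'] [HasShift B' ℤ]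
  [∀ n : ℤ, (shiftFunctor B' n).Additive]
  (F : B ⥤ B') [F.Additive] [F.CommShift ℤ]

/-- The functor between categories of complexes given by a functor between the categories of
coefficients. -/
def etaFunctor : EtaComplex B ⥤ EtaComplex B' := F.mapHomologicalComplex (ComplexShape.up ℤ)

/-- The commutation of `F` with `(n)`, applied degreewise. -/
def twistComm (n : ℤ) (K : CochainComplex B ℤ) :
    (F.mapHomologicalComplex (ComplexShape.up ℤ)).obj ((twist B n).obj K) ≅
      (twist B' n).obj ((F.mapHomologicalComplex (ComplexShape.up ℤ)).obj K) :=
  HomologicalComplex.Hom.isoOfComponents (fun i => (F.commShiftIso n).app (K.X i))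
    (fun i j _ => ((F.commShiftIso n).hom.naturality (K.d i j)).symm)

lemma commShiftIso_comp_d (n : ℤ) (K : CochainComplex B ℤ) (p q : ℤ) :
    (F.commShiftIso n).hom.app (K.X p) ≫ (n.negOnePow • (F.map (K.d p q))⟦n⟧') =
      F.map (n.negOnePow • (K.d p q)⟦n⟧') ≫ (F.commShiftIso n).hom.app (K.X q) := by
  rw [Functor.map_units_smul, Linear.comp_units_smul, Linear.units_smul_comp,
    F.commShiftIso_hom_naturality]

/-- The commutation of the functor induced by `F` with `[n](n)`. -/
def twistShiftComm (n : ℤ) (K : CochainComplex B ℤ) :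
    (F.mapHomologicalComplex (ComplexShape.up ℤ)).obj ((twistShift B n).obj K) ≅
      (twistShift B' n).obj ((F.mapHomologicalComplex (ComplexShape.up ℤ)).obj K) :=
  HomologicalComplex.Hom.isoOfComponents (fun i => (F.commShiftIso n).app (K.X (i + n)))
    (fun i j _ => commShiftIso_comp_d F n K (i + n) (j + n))

lemma commShiftIso_zero_aux (K : CochainComplex B ℤ) (p q : ℤ) (h : p = q) :
    (F.commShiftIso (0 : ℤ)).hom.app (K.X p) ≫
      (shiftFunctorZero B' ℤ).hom.app (F.obj (K.X p)) ≫
        F.map (K.XIsoOfEq h).hom =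
    F.map ((shiftFunctorZero B ℤ).hom.app (K.X p) ≫ (K.XIsoOfEq h).hom) := by
  subst h
  rw [F.commShiftIso_zero, Functor.CommShift.isoZero_hom_app]
  simp

lemma commShiftIso_add_aux (n m : ℤ) (K : CochainComplex B ℤ) (p q : ℤ) (h : p = q) :
    (F.commShiftIso (n + m)).hom.app (K.X p) ≫
      (shiftFunctorAdd B' n m).hom.app (F.obj (K.X p)) ≫
        ((F.map (K.XIsoOfEq h).hom)⟦n⟧')⟦m⟧' =
    F.map ((shiftFunctorAdd B n m).hom.app (K.X p) ≫ ((K.XIsoOfEq h).hom⟦n⟧')⟦m⟧') ≫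
      (F.commShiftIso m).hom.app ((K.X q)⟦n⟧) ≫ ((F.commShiftIso n).hom.app (K.X q))⟦m⟧' := by
  subst h
  rw [F.commShiftIso_add, Functor.CommShift.isoAdd_hom_app]
  simp

instance : (etaFunctor F).CommShift ℤ :=
  commShiftMk (etaFunctor F) (fun n K => twistShiftComm F n K)
    (fun n {X Y} f => HomologicalComplex.hom_ext _ _ fun i =>
      (F.commShiftIso n).hom.naturality (HomologicalComplex.Hom.f f (i + n)))
    (fun X => HomologicalComplex.hom_ext _ _ fun i =>
      (congrArg (_ ≫ _ ≫ ·) (map_XIsoOfEq_hom F X (add_zero i))).trans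
        (commShiftIso_zero_aux F X _ _ (add_zero i)))
    (fun n m X => HomologicalComplex.hom_ext _ _ fun i =>
      (congrArg (fun t => _ ≫ _ ≫ (t⟦n⟧')⟦m⟧')
        (map_XIsoOfEq_hom F X (show i + (n + m) = i + m + n by lia))).trans
          (commShiftIso_add_aux F n m X _ _ _))

variable [HasBinaryBiproducts B] [HasBinaryBiproducts B'] [EtaTwist B] [EtaTwist B']
  (hF : ∀ X : B, F.map (etaApp X) = (F.commShiftIso (1 : ℤ)).hom.app X ≫ etaApp (F.obj X))

include hF

lemma map_etaC (K : CochainComplex B ℤ) :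
    (F.mapHomologicalComplex (ComplexShape.up ℤ)).map (etaC K) = (twistComm F 1 K).hom ≫
      etaC ((F.mapHomologicalComplex (ComplexShape.up ℤ)).obj K) := by
  ext i
  exact hF (K.X i)

/-- As `F` sends `η` to `η`, it sends homotopies after composition with `η` to such homotopies. -/
lemma stablyEqual_map {X Y : CochainComplex B ℤ} {f g : X ⟶ Y} (h : StablyEqual f g) :
    StablyEqual ((F.mapHomologicalComplex (ComplexShape.up ℤ)).map f)
      ((F.mapHomologicalComplex (ComplexShape.up ℤ)).map g) := by
  rw [stablyEqual_iff] at h ⊢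
  obtain ⟨h⟩ := h
  have h' := (F.mapHomotopy h).compLeft (twistComm F 1 X).inv
  rw [Functor.map_comp, Functor.map_comp, map_etaC F hF, Category.assoc, Category.assoc,
    Iso.inv_hom_id_assoc, Iso.inv_hom_id_assoc] at h'
  exact ⟨h'⟩

/-- The functor `K_η(B) ⥤ K_η(B')` induced by a functor `F : B ⥤ B'` compatible with `(1)` and
`η`. -/
def ketaMap : KEta B ⥤ KEta B' :=
  ketaLift (etaFunctor F ⋙ KEta.quotient B') (fun _ _ f g h =>
    (qMap_eq_iff ((F.mapHomologicalComplex (ComplexShape.up ℤ)).map f)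
      ((F.mapHomologicalComplex (ComplexShape.up ℤ)).map g)).2 (stablyEqual_map F hF h))

instance ketaMapCommShift : (ketaMap F hF).CommShift ℤ :=
  ketaLiftCommShift (etaFunctor F ⋙ KEta.quotient B') _

instance ketaMap_isTriangulated [HasZeroObject B] [HasZeroObject B'] :
    (ketaMap F hF).IsTriangulated := by
  apply ketaLift_isTriangulated
  intro X Y f
  let G := F.mapHomologicalComplex (ComplexShape.up ℤ)
  let e : G.obj (mappingCone (etaC X ≫ f)) ≅ mappingCone (etaC (G.obj X) ≫ G.map f) :=
    mapHomologicalComplexIso (etaC X ≫ f) F ≪≫ coneIso (twistComm F 1 X) _ _ (by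
      rw [Functor.map_comp, map_etaC F hF, Category.comp_id, Category.assoc])
  have h₂ : G.map (inr (etaC X ≫ f)) ≫ e.hom = inr (etaC (G.obj X) ≫ G.map f) := by
    simp only [e, G, Iso.trans_hom]
    rw [← Category.assoc, map_inr, inr_coneIso_hom]
  have h₃ : e.hom ≫ etaδ (G.map f) = G.map (etaδ f) ≫ (twistShiftComm F 1 X).hom := by
    -- the commutation with `[1](1)` is the one with `[1]` followed by the one with `(1)`
    have h₄ : (twistShiftComm F 1 X).hom =
        ((F.mapHomologicalComplex (ComplexShape.up ℤ)).commShiftIso (1 : ℤ)).hom.app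
          ((twist B 1).obj X) ≫ (twistComm F 1 X).hom⟦(1 : ℤ)⟧' := by
      ext i
      exact (Category.id_comp ((F.commShiftIso (1 : ℤ)).hom.app (X.X (i + 1)))).symm
    rw [h₄]
    have h₅ : G.map (etaδ f) ≫ ((F.mapHomologicalComplex (ComplexShape.up ℤ)).commShiftIso
        (1 : ℤ)).hom.app ((twist B 1).obj X) = (mapHomologicalComplexIso (etaC X ≫ f) F).hom ≫
          coneδ (G.map (etaC X ≫ f)) := map_δ (etaC X ≫ f) F
    refine Eq.trans ?_ ((congrArg (· ≫ (twistComm F 1 X).hom⟦(1 : ℤ)⟧') h₅).symm.trans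
      (Category.assoc _ _ _))
    refine (Category.assoc _ _ _).trans (Eq.trans ?_ (Category.assoc _ _ _).symm)
    exact congrArg (_ ≫ ·) (coneIso_hom_coneδ _ _ _ _)
  refine isomorphic_distinguished _ (etaTriangle_mem (G.map f)) _
    (triangleIsoOfIso₃ _ ((KEta.quotient B').mapIso e) ?_ ?_)
  · exact ((KEta.quotient B').map_comp _ _).symm.trans (congrArg qMap h₂)
  · have h₆ : qMap e.hom ≫ qMap (etaδ (G.map f)) ≫ (qShift (G.obj X)).hom =
        qMap (G.map (etaδ f)) ≫ qMap (twistShiftComm F 1 X).hom ≫ (qShift (G.obj X)).hom := by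
      rw [← Category.assoc, ← qMap_comp, h₃, qMap_comp, Category.assoc]
    exact h₆.trans (congrArg (qMap (G.map (etaδ f)) ≫ ·) (Functor.commShiftIso_comp_hom_app
      (etaFunctor F) (KEta.quotient B') (1 : ℤ) X).symm)

end Induced

end EtaStable
end

noncomputable section
namespace EtaStable

/-! ### Full faithfulness and the functor `J` -/

section FullyFaithful

universe v w v' w'

variable {B : Type w} [Category.{v} B] [Preadditive B] [HasShift B ℤ]
  [∀ n : ℤ, (shiftFunctor B n).Additive]
  {B' : Type w'} [Category.{v'} B'] [Preadditive B'] [HasShift B' ℤ]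
  [∀ n : ℤ, (shiftFunctor B' n).Additive]
  (F : B ⥤ B') [F.Additive] [F.CommShift ℤ]
  [HasBinaryBiproducts B] [HasBinaryBiproducts B'] [EtaTwist B] [EtaTwist B']
  (hF : ∀ X : B, F.map (etaApp X) = (F.commShiftIso (1 : ℤ)).hom.app X ≫ etaApp (F.obj X))

include hF in
lemma stablyEqual_of_map [F.Full] [F.Faithful] {X Y : CochainComplex B ℤ} {f g : X ⟶ Y}
    (h : StablyEqual ((F.mapHomologicalComplex (ComplexShape.up ℤ)).map f)
      ((F.mapHomologicalComplex (ComplexShape.up ℤ)).map g)) : StablyEqual f g := by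
  rw [stablyEqual_iff] at h ⊢
  obtain ⟨h⟩ := h
  have h' := h.compLeft (twistComm F 1 X).hom
  rw [← Category.assoc, ← Category.assoc, ← map_etaC F hF, ← Functor.map_comp,
    ← Functor.map_comp] at h'
  exact ⟨F.preimageHomotopy h'⟩

lemma quotient_comp_ketaMap : KEta.quotient B ⋙ ketaMap F hF = etaFunctor F ⋙ KEta.quotient B' :=
  quotient_comp_ketaLift _ _

instance ketaMap_faithful [F.Full] [F.Faithful] : (ketaMap F hF).Faithful where
  map_injective {X Y} f g h := by
    obtain ⟨X, rfl⟩ := qObj_surjective X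
    obtain ⟨Y, rfl⟩ := qObj_surjective Y
    obtain ⟨f, rfl⟩ := qMap_surjective f
    obtain ⟨g, rfl⟩ := qMap_surjective g
    rw [qMap_eq_iff]
    exact stablyEqual_of_map F hF ((qMap_eq_iff _ _).1 h)

instance ketaMap_full [F.Full] [F.Faithful] : (ketaMap F hF).Full where
  map_surjective {X Y} f := by
    obtain ⟨X, rfl⟩ := qObj_surjective X
    obtain ⟨Y, rfl⟩ := qObj_surjective Y
    obtain ⟨f, rfl⟩ := qMap_surjective (X := (F.mapHomologicalComplex (ComplexShape.up ℤ)).obj X)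
      (Y := (F.mapHomologicalComplex (ComplexShape.up ℤ)).obj Y) f
    obtain ⟨f, rfl⟩ := (F.mapHomologicalComplex (ComplexShape.up ℤ)).map_surjective f
    exact ⟨qMap f, rfl⟩

end FullyFaithful

section Inclusion

universe v w

variable (A : Type w) [Category.{v} A] [Preadditive A] [HasBinaryBiproducts A]

omit [HasBinaryBiproducts A] in
variable {A} in
lemma ι_map_etaApp (X : GrB A) : (isBounded A).ι.map (etaApp X) =
    ((isBounded A).ι.commShiftIso (1 : ℤ)).hom.app X ≫ etaApp ((isBounded A).ι.obj X) := rfl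

/-- The functor `J : K_η(gr^b A) ⥤ K_η(gr A)` induced by the inclusion. -/
def ketaIncl : KEta (GrB A) ⥤ KEta (Gr A) := ketaMap (isBounded A).ι ι_map_etaApp

instance : (ketaIncl A).CommShift ℤ := ketaMapCommShift _ _

instance [HasZeroObject A] : (ketaIncl A).IsTriangulated := ketaMap_isTriangulated _ _

instance : (ketaIncl A).Full := ketaMap_full _ _

instance : (ketaIncl A).Faithful := ketaMap_faithful _ _

lemma quotient_comp_ketaIncl :
    (KEta.quotient (GrB A) ⋙ ketaIncl A : CochainComplex (GrB A) ℤ ⥤ _) =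
      inclC A ⋙ KEta.quotient (Gr A) :=
  quotient_comp_ketaMap _ _

end Inclusion

end EtaStable
end

noncomputable section
namespace EtaStable

/-! ### Functors from `K_η(B)` to a homotopy category -/

section Invariance

set_option linter.unusedSectionVars false

universe v w v' w'

open CochainComplex (mappingCone)
open CochainComplex.HomComplex CochainComplex.mappingCone

/-- Natural isomorphisms `F(X(n)) ≅ F(X)`, compatible with the composition of shifts, such that the
one for `n = 1` is `F(η_X)`. -/
structure ShiftInvariance {B : Type w} [Category.{v} B] [HasShift B ℤ] [EtaTwist B]
    {A : Type w'} [Category.{v'} A] (F : B ⥤ A) where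
  iso : ∀ n : ℤ, shiftFunctor B n ⋙ F ≅ F
  zero : ∀ X : B, (iso 0).hom.app X = F.map ((shiftFunctorZero B ℤ).hom.app X)
  add : ∀ (n m : ℤ) (X : B), (iso (n + m)).hom.app X =
    F.map ((shiftFunctorAdd B n m).hom.app X) ≫ (iso m).hom.app (X⟦n⟧) ≫ (iso n).hom.app X
  eta : ∀ X : B, F.map (etaApp X) = (iso 1).hom.app X

variable {B : Type w} [Category.{v} B] [Preadditive B] [HasShift B ℤ]
  [∀ n : ℤ, (shiftFunctor B n).Additive] [EtaTwist B]
  {A : Type w'} [Category.{v'} A] [Preadditive A] (F : B ⥤ A) [F.Additive]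

/-- The functor from `C(B)`, with the shift `[1](1)`, to `C(A)` given by `F`. -/
def untwistFunctor : EtaComplex B ⥤ CochainComplex A ℤ :=
  F.mapHomologicalComplex (ComplexShape.up ℤ)

namespace ShiftInvariance

variable {F} (τ : ShiftInvariance F)

lemma naturality (n : ℤ) {X Y : B} (f : X ⟶ Y) :
    F.map (f⟦n⟧') ≫ (τ.iso n).hom.app Y = (τ.iso n).hom.app X ≫ F.map f :=
  (τ.iso n).hom.naturality f

/-- The isomorphisms `F(K(n)) ≅ F(K)` for a complex `K`. -/
def twistIso (n : ℤ) (K : CochainComplex B ℤ) :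
    (F.mapHomologicalComplex (ComplexShape.up ℤ)).obj ((twist B n).obj K) ≅
      (F.mapHomologicalComplex (ComplexShape.up ℤ)).obj K :=
  HomologicalComplex.Hom.isoOfComponents (fun i => (τ.iso n).app (K.X i))
    (fun i j _ => (τ.naturality n (K.d i j)).symm)

lemma comp_d (n : ℤ) (K : CochainComplex B ℤ) (p q : ℤ) :
    (τ.iso n).hom.app (K.X p) ≫ (n.negOnePow • F.map (K.d p q)) =
      F.map (n.negOnePow • (K.d p q)⟦n⟧') ≫ (τ.iso n).hom.app (K.X q) := by
  rw [Functor.map_units_smul, Linear.comp_units_smul, Linear.units_smul_comp, τ.naturality]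

/-- The isomorphisms `F(K[n](n)) ≅ F(K)[n]` for a complex `K`. -/
def twistShiftIso (n : ℤ) (K : CochainComplex B ℤ) :
    (F.mapHomologicalComplex (ComplexShape.up ℤ)).obj ((twistShift B n).obj K) ≅
      ((F.mapHomologicalComplex (ComplexShape.up ℤ)).obj K)⟦n⟧ :=
  HomologicalComplex.Hom.isoOfComponents (fun i => (τ.iso n).app (K.X (i + n)))
    (fun i j _ => τ.comp_d n K (i + n) (j + n))

lemma zero_aux (K : CochainComplex B ℤ) (p q : ℤ) (h : p = q) :
    (τ.iso 0).hom.app (K.X p) ≫ F.map (K.XIsoOfEq h).hom =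
    F.map ((shiftFunctorZero B ℤ).hom.app (K.X p) ≫ (K.XIsoOfEq h).hom) := by
  rw [τ.zero, F.map_comp]

lemma add_aux (n m : ℤ) (K : CochainComplex B ℤ) (p q : ℤ) (h : p = q) :
    (τ.iso (n + m)).hom.app (K.X p) ≫ F.map (K.XIsoOfEq h).hom =
    F.map ((shiftFunctorAdd B n m).hom.app (K.X p) ≫ ((K.XIsoOfEq h).hom⟦n⟧')⟦m⟧') ≫
      (τ.iso m).hom.app ((K.X q)⟦n⟧) ≫ (τ.iso n).hom.app (K.X q) := by
  subst h
  simp [τ.add]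

/-- The commutation of the functor given by `F` with the shifts. -/
@[reducible]
def commShift : (untwistFunctor F).CommShift ℤ :=
  commShiftMk (untwistFunctor F) (fun n K => τ.twistShiftIso n K)
    (fun n {X Y} f => HomologicalComplex.hom_ext _ _ fun i =>
      (τ.iso n).hom.naturality (HomologicalComplex.Hom.f f (i + n)))
    (fun X => HomologicalComplex.hom_ext _ _ fun i => by
      refine (HomologicalComplex.comp_f _ _ i).trans ?_
      rw [CochainComplex.shiftFunctorZero_hom_app_f]
      exact (congrArg (_ ≫ ·) (map_XIsoOfEq_hom F X (add_zero i))).trans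
        (τ.zero_aux X _ _ (add_zero i)))
    (fun n m X => HomologicalComplex.hom_ext _ _ fun i => by
      refine (HomologicalComplex.comp_f _ _ i).trans ?_
      rw [CochainComplex.shiftFunctorAdd_hom_app_f]
      exact (congrArg (_ ≫ ·)
        (map_XIsoOfEq_hom F X (show i + (n + m) = i + m + n by lia))).trans
          (τ.add_aux n m X _ _ _))

variable [HasBinaryBiproducts B] [HasBinaryBiproducts A]

lemma map_etaC (K : CochainComplex B ℤ) :
    (F.mapHomologicalComplex (ComplexShape.up ℤ)).map (etaC K) = (τ.twistIso 1 K).hom := by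
  ext i
  exact τ.eta (K.X i)

include τ in
/-- As `F(η)` is an isomorphism, a homotopy after composition with `η` gives a homotopy after
application of `F`. -/
lemma homotopy_of_stablyEqual {X Y : CochainComplex B ℤ} {f g : X ⟶ Y} (h : StablyEqual f g) :
    Nonempty (Homotopy ((F.mapHomologicalComplex (ComplexShape.up ℤ)).map f)
      ((F.mapHomologicalComplex (ComplexShape.up ℤ)).map g)) := by
  rw [stablyEqual_iff] at h
  obtain ⟨h⟩ := h
  have h' := (F.mapHomotopy h).compLeft (τ.twistIso 1 X).inv
  rw [Functor.map_comp, Functor.map_comp, τ.map_etaC, Iso.inv_hom_id_assoc,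
    Iso.inv_hom_id_assoc] at h'
  exact ⟨h'⟩

variable [HasZeroObject A]

/-- The functor `K_η(B) ⥤ K(A)` induced by `F`. -/
def ketaFunctor : KEta B ⥤ HomotopyCategory A (ComplexShape.up ℤ) :=
  ketaLift (untwistFunctor F ⋙ HomotopyCategory.quotient A (ComplexShape.up ℤ)) (fun _ _ _ _ h =>
    HomotopyCategory.eq_of_homotopy _ _ (τ.homotopy_of_stablyEqual h).some)

lemma quotient_comp_ketaFunctor : (KEta.quotient B ⋙ τ.ketaFunctor : CochainComplex B ℤ ⥤ _) =
    F.mapHomologicalComplex (ComplexShape.up ℤ) ⋙ HomotopyCategory.quotient A _ :=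
  quotient_comp_ketaLift _ _

instance ketaFunctorCommShift : τ.ketaFunctor.CommShift ℤ :=
  letI := τ.commShift
  ketaLiftCommShift (untwistFunctor F ⋙ HomotopyCategory.quotient A (ComplexShape.up ℤ)) _

instance ketaFunctor_isTriangulated [HasZeroObject B] : τ.ketaFunctor.IsTriangulated := by
  let := τ.commShift
  apply ketaLift_isTriangulated
  intro X Y f
  let G := F.mapHomologicalComplex (ComplexShape.up ℤ)
  let Q := HomotopyCategory.quotient A (ComplexShape.up ℤ)
  let e : G.obj (mappingCone (etaC X ≫ f)) ≅ mappingCone (G.map f) :=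
    mapHomologicalComplexIso (etaC X ≫ f) F ≪≫ coneIso (τ.twistIso 1 X) _ _ (by
      rw [Functor.map_comp, τ.map_etaC, Category.comp_id])
  have h₂ : G.map (inr (etaC X ≫ f)) ≫ e.hom = inr (G.map f) := by
    simp only [e, G, Iso.trans_hom]
    rw [← Category.assoc, map_inr, inr_coneIso_hom]
  have h₃ : e.hom ≫ coneδ (G.map f) = G.map (etaδ f) ≫ (τ.twistShiftIso 1 X).hom := by
    -- `F(X[1](1)) ≅ F(X)[1]` is the commutation with `[1]` followed by the invariance under `(1)`
    have h₄ : (τ.twistShiftIso 1 X).hom =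
        ((F.mapHomologicalComplex (ComplexShape.up ℤ)).commShiftIso (1 : ℤ)).hom.app
          ((twist B 1).obj X) ≫ (τ.twistIso 1 X).hom⟦(1 : ℤ)⟧' := by
      ext i
      exact (Category.id_comp ((τ.iso (1 : ℤ)).hom.app (X.X (i + 1)))).symm
    rw [h₄]
    have h₅ : G.map (etaδ f) ≫ ((F.mapHomologicalComplex (ComplexShape.up ℤ)).commShiftIso
        (1 : ℤ)).hom.app ((twist B 1).obj X) = (mapHomologicalComplexIso (etaC X ≫ f) F).hom ≫
          coneδ (G.map (etaC X ≫ f)) := map_δ (etaC X ≫ f) F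
    refine Eq.trans ?_ ((congrArg (· ≫ (τ.twistIso 1 X).hom⟦(1 : ℤ)⟧') h₅).symm.trans
      (Category.assoc _ _ _))
    refine (Category.assoc _ _ _).trans (Eq.trans ?_ (Category.assoc _ _ _).symm)
    exact congrArg (_ ≫ ·) (coneIso_hom_coneδ _ _ _ _)
  refine isomorphic_distinguished _
    (HomotopyCategory.mappingCone_triangleh_distinguished (G.map f)) _
    (triangleIsoOfIso₃ _ (Q.mapIso e) ?_ ?_)
  · exact (Q.map_comp _ _).symm.trans (congrArg Q.map h₂)
  · have h₆ : Q.map e.hom ≫ Q.map (coneδ (G.map f)) ≫ (Q.commShiftIso (1 : ℤ)).hom.app (G.obj X) =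
        Q.map (G.map (etaδ f)) ≫ Q.map (τ.twistShiftIso 1 X).hom ≫
          (Q.commShiftIso (1 : ℤ)).hom.app (G.obj X) :=
      (Category.assoc _ _ _).symm.trans ((congrArg (· ≫ (Q.commShiftIso (1 : ℤ)).hom.app (G.obj X))
        ((Q.map_comp _ _).symm.trans ((congrArg Q.map h₃).trans (Q.map_comp _ _)))).trans
          (Category.assoc _ _ _))
    exact h₆.trans (congrArg (Q.map (G.map (etaδ f)) ≫ ·) (Functor.commShiftIso_comp_hom_app
      (untwistFunctor F) Q (1 : ℤ) X).symm)

end ShiftInvariance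

end Invariance

end EtaStable
end

noncomputable section
namespace EtaStable

/-! ### Invariance of `X ↦ ⨁_j X^j` under `(1)` -/

section XiInvariance

universe v w

variable {A : Type w} [Category.{v} A] [Preadditive A]

namespace GrB

variable (A) in
/-- The functor `(n)` on `gr^b A` with `X(n)^j = X^{j+n}` by definition. -/
def strictShift (n : ℤ) : GrB A ⥤ GrB A :=
  (isBounded A).lift ((isBounded A).ι ⋙ Gr.shift A n)
    (fun X => (isBounded A).le_shift n _ X.property)

/-- The comparison of the two constructions of `(n)` on `gr^b A`. -/
def shiftIso (n : ℤ) (X : GrB A) : X⟦n⟧ ≅ (strictShift A n).obj X where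
  hom := ObjectProperty.homMk (((isBounded A).ι.commShiftIso n).hom.app X)
  inv := ObjectProperty.homMk (((isBounded A).ι.commShiftIso n).inv.app X)
  hom_inv_id := InducedCategory.hom_ext (((isBounded A).ι.commShiftIso n).hom_inv_id_app X)
  inv_hom_id := InducedCategory.hom_ext (((isBounded A).ι.commShiftIso n).inv_hom_id_app X)

lemma shiftIso_naturality (n : ℤ) {X Y : GrB A} (f : X ⟶ Y) :
    f⟦n⟧' ≫ (shiftIso n Y).hom = (shiftIso n X).hom ≫ (strictShift A n).map f :=
  InducedCategory.hom_ext ((isBounded A).ι.commShiftIso_hom_naturality f n)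

/-- `X(0) = X`. -/
def strictZero (X : GrB A) : (strictShift A 0).obj X ⟶ X :=
  ObjectProperty.homMk (eqToHom (Gr.shift_zero_obj X.obj))

/-- `X(n + m) = X(n)(m)`. -/
def strictAdd (n m : ℤ) (X : GrB A) :
    (strictShift A (n + m)).obj X ⟶ (strictShift A m).obj ((strictShift A n).obj X) :=
  ObjectProperty.homMk (eqToHom (Gr.shift_add_obj n m X.obj))

lemma shiftIso_zero (X : GrB A) :
    (shiftIso 0 X).hom ≫ strictZero X = (shiftFunctorZero (GrB A) ℤ).hom.app X := by
  apply InducedCategory.hom_ext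
  have h : ((isBounded A).ι.commShiftIso (0 : ℤ)).hom.app X ≫
      (shiftFunctorZero (Gr A) ℤ).hom.app X.obj =
        (isBounded A).ι.map ((shiftFunctorZero (GrB A) ℤ).hom.app X) := by
    rw [(isBounded A).ι.commShiftIso_zero, Functor.CommShift.isoZero_hom_app, Category.assoc]
    exact (congrArg (_ ≫ ·) ((shiftFunctorZero (Gr A) ℤ).inv_hom_id_app X.obj)).trans
      (Category.comp_id _)
  exact h

lemma shiftIso_add (n m : ℤ) (X : GrB A) :
    (shiftIso (n + m) X).hom ≫ strictAdd n m X = (shiftFunctorAdd (GrB A) n m).hom.app X ≫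
      (shiftIso m (X⟦n⟧)).hom ≫ (strictShift A m).map (shiftIso n X).hom := by
  apply InducedCategory.hom_ext
  have h : ((isBounded A).ι.commShiftIso (n + m)).hom.app X ≫
      (shiftFunctorAdd (Gr A) n m).hom.app X.obj =
        (isBounded A).ι.map ((shiftFunctorAdd (GrB A) n m).hom.app X) ≫
          ((isBounded A).ι.commShiftIso m).hom.app (X⟦n⟧) ≫
            (((isBounded A).ι.commShiftIso n).hom.app X)⟦m⟧' := by
    rw [(isBounded A).ι.commShiftIso_add, Functor.CommShift.isoAdd_hom_app, Category.assoc,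
      Category.assoc, Category.assoc]
    refine congrArg (_ ≫ _ ≫ ·) ?_
    exact (congrArg (_ ≫ ·) ((shiftFunctorAdd (Gr A) n m).inv_hom_id_app X.obj)).trans
      (Category.comp_id _)
  exact h

end GrB

/-- The entries of the matrix of the identification `⨁_j Z_{j+n} ⟶ ⨁_k Z_k`. For `n = 1` they are
the entries of `η`. -/
def reindexEntry (Z : ℤ → A) (n j k : ℤ) : Z (j + n) ⟶ Z k :=
  if h : j + n = k then eqToHom (congrArg Z h) else 0

lemma reindexEntry_of_eq (Z : ℤ → A) {n j k : ℤ} (h : j + n = k) :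
    reindexEntry Z n j k = eqToHom (congrArg Z h) := dif_pos h

lemma reindexEntry_of_ne (Z : ℤ → A) {n j k : ℤ} (h : j + n ≠ k) :
    reindexEntry Z n j k = 0 := dif_neg h

lemma reindexEntry_comp_of_ne (Z : ℤ → A) {n j k : ℤ} (h : j + n ≠ k) {W : A} (f : Z k ⟶ W) :
    reindexEntry Z n j k ≫ f = 0 := by
  rw [reindexEntry_of_ne Z h, zero_comp]

lemma comp_reindexEntry_of_ne (Z : ℤ → A) {n j k : ℤ} (h : j + n ≠ k) {W : A}
    (f : W ⟶ Z (j + n)) : f ≫ reindexEntry Z n j k = 0 := by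
  rw [reindexEntry_of_ne Z h, comp_zero]

lemma reindexEntry_comp (Z : ℤ → A) (n j : ℤ) {W : A} (f : Z (j + n) ⟶ W) :
    reindexEntry Z n j (j + n) ≫ f = f := by
  rw [reindexEntry_of_eq Z rfl, eqToHom_refl, Category.id_comp]

/-- The matrix of the inverse of the identification `⨁_j Z_{j+n} ⟶ ⨁_k Z_k`. -/
def unreindexEntry (Z : ℤ → A) (n k j : ℤ) : Z k ⟶ Z (j + n) :=
  if h : k = j + n then eqToHom (congrArg Z h) else 0

lemma unreindexEntry_of_eq (Z : ℤ → A) {n j k : ℤ} (h : k = j + n) :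
    unreindexEntry Z n k j = eqToHom (congrArg Z h) := dif_pos h

lemma unreindexEntry_of_ne (Z : ℤ → A) {n j k : ℤ} (h : k ≠ j + n) :
    unreindexEntry Z n k j = 0 := dif_neg h

lemma unreindexEntry_self (Z : ℤ → A) (n j : ℤ) :
    unreindexEntry Z n (j + n) j = 𝟙 (Z (j + n)) := dif_pos rfl

lemma unreindexEntry_comp_of_ne (Z : ℤ → A) {n j k : ℤ} (h : k ≠ j + n) {W : A}
    (f : Z (j + n) ⟶ W) : unreindexEntry Z n k j ≫ f = 0 := by
  rw [unreindexEntry_of_ne Z h, zero_comp]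

/-- The matrix of the identity. -/
def idEntry (Z : ℤ → A) (j k : ℤ) : Z j ⟶ Z k := if h : j = k then eqToHom (congrArg Z h) else 0

lemma unreindexEntry_comp_reindexEntry (Z : ℤ → A) (n j l : ℤ) :
    idEntry Z j l = unreindexEntry Z n j (j - n) ≫ reindexEntry Z n (j - n) l := by
  rw [unreindexEntry_of_eq Z (by lia), idEntry]
  split_ifs with h
  · rw [reindexEntry_of_eq Z (by lia), eqToHom_trans]
  · rw [reindexEntry_of_ne Z (by lia), comp_zero]

lemma comp_reindexEntry_comp_reindexEntry (Z : ℤ → A) (n m j l : ℤ) {W : A}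
    (f : W ⟶ Z (j + m + n)) (h : j + m + n = j + (n + m)) :
    f ≫ reindexEntry Z n (j + m) l = (f ≫ eqToHom (congrArg Z h)) ≫ reindexEntry Z (n + m) j l := by
  by_cases hl : j + m + n = l
  · rw [reindexEntry_of_eq Z hl, reindexEntry_of_eq Z (by lia), Category.assoc, eqToHom_trans]
  · rw [reindexEntry_of_ne Z hl, reindexEntry_of_ne Z (by lia), comp_zero, comp_zero]

variable [HasFiniteBiproducts A]

/-- The identification of `⨁_j X^{j+n}` with `⨁_k X^k`. -/
def reindex (n : ℤ) (X : GrB A) : (xi A).obj ((GrB.strictShift A n).obj X) ≅ (xi A).obj X where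
  hom := matrix ((GrB.strictShift A n).obj X).property X.property (reindexEntry X.obj.X n)
  inv := matrix X.property ((GrB.strictShift A n).obj X).property (unreindexEntry X.obj.X n)
  hom_inv_id :=
    (matrix_comp _ _ _ _ _ (fun j l => unreindexEntry X.obj.X n (j + n) l)
      (fun j _ => {j + n}) (fun j l k hk => reindexEntry_comp_of_ne X.obj.X
        (fun h => hk (Finset.mem_singleton.2 h.symm)) (unreindexEntry X.obj.X n k l))
      (fun j l => ((Finset.sum_singleton _ _).trans
        (reindexEntry_comp X.obj.X n j (unreindexEntry X.obj.X n (j + n) l))).symm)).trans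
      (matrix_id _ _ (fun j => unreindexEntry_self X.obj.X n j)
        (fun j k h => unreindexEntry_of_ne X.obj.X (by lia)))
  inv_hom_id :=
    (matrix_comp _ _ _ _ _ (idEntry X.obj.X)
      (fun j _ => {j - n}) (fun j l k hk => unreindexEntry_comp_of_ne X.obj.X
        (fun h => hk (Finset.mem_singleton.2 (by lia))) (reindexEntry X.obj.X n k l))
      (fun j l => (unreindexEntry_comp_reindexEntry X.obj.X n j l).trans
        (Finset.sum_singleton _ _).symm)).trans
      (matrix_id _ _ (fun j => dif_pos rfl) (fun j k h => dif_neg h))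

omit [HasFiniteBiproducts A] in
lemma entry_comp_reindexEntry {X Y : Gr A} (f : X ⟶ Y) (n j l : ℤ) :
    f.entry j l = f.entry j (l - n + n) ≫ reindexEntry Y.X n (l - n) l := by
  have h := Gr.entry_congr f (rfl : j = j) (show l - n + n = l by lia)
  rw [eqToHom_refl, Category.id_comp] at h
  rw [reindexEntry_of_eq _ (by lia), h]

lemma reindex_naturality (n : ℤ) {X Y : GrB A} (f : X ⟶ Y) :
    (xi A).map ((GrB.strictShift A n).map f) ≫ (reindex n Y).hom =
      (reindex n X).hom ≫ (xi A).map f :=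
  (matrix_comp ((GrB.strictShift A n).obj X).property ((GrB.strictShift A n).obj Y).property
      Y.property _ _ (fun j l => f.hom.entry (j + n) l)
      (fun _ l => {l - n}) (fun j l k hk => comp_reindexEntry_of_ne Y.obj.X
        (fun h => hk (Finset.mem_singleton.2 (by lia))) (f.hom.entry (j + n) (k + n)))
      (fun j l => (entry_comp_reindexEntry f.hom n (j + n) l).trans
        (Finset.sum_singleton _ _).symm)).trans
    (matrix_comp ((GrB.strictShift A n).obj X).property X.property Y.property _ _
      (fun j l => f.hom.entry (j + n) l)
      (fun j _ => {j + n}) (fun j l k hk => reindexEntry_comp_of_ne X.obj.X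
        (fun h => hk (Finset.mem_singleton.2 h.symm)) (f.hom.entry k l))
      (fun j l => ((Finset.sum_singleton _ _).trans
        (reindexEntry_comp X.obj.X n j (f.hom.entry (j + n) l))).symm)).symm

lemma reindex_zero (X : GrB A) : (reindex 0 X).hom = (xi A).map (GrB.strictZero X) := by
  refine matrix_congr ((GrB.strictShift A 0).obj X).property X.property fun j k => ?_
  have h : (eqToHom (Gr.shift_zero_obj X.obj)).entry j k = reindexEntry X.obj.X 0 j k := by
    rw [Gr.eqToHom_eq_diag]
    by_cases hjk : j = k
    · subst hjk
      rw [reindexEntry_of_eq _ (add_zero j)]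
      exact Gr.diag_entry_self _ j
    · rw [reindexEntry_of_ne _ (by lia)]
      exact Gr.diag_entry_ne _ hjk
  exact h.symm

omit [HasFiniteBiproducts A] in
lemma strictAdd_entry (n m : ℤ) (X : Gr A) (j k : ℤ) (h : j = k) :
    (eqToHom (Gr.shift_add_obj n m X)).entry j k =
      eqToHom (congrArg X.X (show j + (n + m) = k + m + n by lia)) := by
  subst h
  rw [Gr.eqToHom_eq_diag]
  exact Gr.diag_entry_self _ j

omit [HasFiniteBiproducts A] in
lemma strictAdd_entry_of_ne (n m : ℤ) (X : Gr A) (j k : ℤ) (h : j ≠ k) :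
    (eqToHom (Gr.shift_add_obj n m X)).entry j k = 0 := by
  rw [Gr.eqToHom_eq_diag, Gr.diag_entry_ne _ h]

lemma reindex_add (n m : ℤ) (X : GrB A) :
    (xi A).map (GrB.strictAdd n m X) ≫ (reindex m ((GrB.strictShift A n).obj X)).hom ≫
      (reindex n X).hom = (reindex (n + m) X).hom := by
  have h₁ : (reindex m ((GrB.strictShift A n).obj X)).hom ≫ (reindex n X).hom =
      matrix ((GrB.strictShift A m).obj ((GrB.strictShift A n).obj X)).property X.property
        (fun j l => reindexEntry X.obj.X n (j + m) l) :=
    matrix_comp _ ((GrB.strictShift A n).obj X).property _ _ _ _ (fun j _ => {j + m})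
      (fun j l k hk => reindexEntry_comp_of_ne (fun j => X.obj.X (j + n))
        (fun h => hk (Finset.mem_singleton.2 h.symm)) (reindexEntry X.obj.X n k l))
      (fun j l => ((Finset.sum_singleton _ _).trans
        (reindexEntry_comp (fun j => X.obj.X (j + n)) m j
          (reindexEntry X.obj.X n (j + m) l))).symm)
  rw [h₁]
  refine matrix_comp ((GrB.strictShift A (n + m)).obj X).property
    ((GrB.strictShift A m).obj ((GrB.strictShift A n).obj X)).property X.property _ _ _
    (fun j _ => {j}) (fun j l k hk => ?_) (fun j l => ?_)
  · exact (congrArg (· ≫ reindexEntry X.obj.X n (k + m) l) (strictAdd_entry_of_ne n m X.obj j k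
      (fun h => hk (Finset.mem_singleton.2 h.symm)))).trans zero_comp
  · refine Eq.trans ?_ (Finset.sum_singleton _ _).symm
    refine Eq.trans ?_ (congrArg (· ≫ reindexEntry X.obj.X n (j + m) l)
      (strictAdd_entry n m X.obj j j rfl)).symm
    refine Eq.trans ?_ (comp_reindexEntry_comp_reindexEntry X.obj.X n m j l
      (eqToHom (congrArg X.obj.X (show j + (n + m) = j + m + n by lia))) (by lia)).symm
    rw [eqToHom_trans, eqToHom_refl, Category.id_comp]

variable (A) in
/-- The functor `X ↦ ⨁_j X^j` is invariant under the shifts `(n)`, by renumbering the summands. For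
`n = 1` this is its value on `η_X`, whose matrix consists of the identities `X^{j+1} ⟶ X^{j+1}`. -/
def xiInvariance : ShiftInvariance (xi A) where
  iso n := NatIso.ofComponents
    (fun X => (xi A).mapIso (GrB.shiftIso n X) ≪≫ reindex n X) (fun {X Y} f => by
      change (xi A).map (f⟦n⟧') ≫ (xi A).map _ ≫ _ = ((xi A).map _ ≫ _) ≫ (xi A).map f
      rw [← Category.assoc, ← Functor.map_comp, GrB.shiftIso_naturality, Functor.map_comp,
        Category.assoc, Category.assoc, reindex_naturality])
  zero X := by
    change (xi A).map _ ≫ _ = _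
    rw [reindex_zero, ← Functor.map_comp, GrB.shiftIso_zero]
  add n m X := by
    change (xi A).map _ ≫ _ = _ ≫ ((xi A).map _ ≫ _) ≫ (xi A).map _ ≫ _
    rw [← reindex_add, ← Category.assoc, ← Functor.map_comp, GrB.shiftIso_add, Functor.map_comp,
      Functor.map_comp, Category.assoc, Category.assoc, Category.assoc]
    refine congrArg (_ ≫ _ ≫ ·) ?_
    rw [← Category.assoc, reindex_naturality, Category.assoc]
  eta X := by
    have h : (reindex 1 X).hom = (xi A).map (X := (GrB.strictShift A 1).obj X) (Y := X)
        (ObjectProperty.homMk (Gr.eta X.obj)) := rfl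
    change _ = (xi A).map _ ≫ _
    rw [h, ← Functor.map_comp]
    rfl

end XiInvariance

end EtaStable
end

noncomputable section
namespace EtaStable

/-! ### Columns of complexes of graded objects -/

section Columns

set_option linter.unusedSectionVars false

universe v w

open CochainComplex.HomComplex

variable {A : Type w} [Category.{v} A] [Preadditive A]

lemma Gr.comp_entry_self {X Y Z : Gr A} (f : X ⟶ Y) (g : Y ⟶ Z) (j : ℤ) :
    (f ≫ g).entry j j = f.entry j j ≫ g.entry j j := by
  rw [Gr.comp_entry, Finset.Icc_self, Finset.sum_singleton]

lemma Gr.comp_entry_succ {X Y Z : Gr A} (f : X ⟶ Y) (g : Y ⟶ Z) (j l : ℤ) (h : j + 1 = l) :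
    (f ≫ g).entry j l = f.entry j j ≫ g.entry j l + f.entry j l ≫ g.entry l l := by
  subst h
  rw [Gr.comp_entry, show Finset.Icc j (j + 1) = {j, j + 1} by ext k; simp; lia,
    Finset.sum_pair (by lia)]

lemma Gr.comp_entry_succ_succ {X Y Z : Gr A} (f : X ⟶ Y) (g : Y ⟶ Z) (j k l : ℤ) (h : j + 1 = k)
    (h' : k + 1 = l) :
    (f ≫ g).entry j l = f.entry j j ≫ g.entry j l + f.entry j k ≫ g.entry k l +
      f.entry j l ≫ g.entry l l := by
  subst h h'
  rw [Gr.comp_entry, show Finset.Icc j (j + 1 + 1) = {j, j + 1, j + 1 + 1} by ext k; simp; lia,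
    Finset.sum_insert (by simp; lia), Finset.sum_pair (by lia)]
  abel

lemma Gr.units_smul_entry {X Y : Gr A} (ε : ℤˣ) (f : X ⟶ Y) (j k : ℤ) :
    (ε • f).entry j k = ε • f.entry j k := by
  rcases Int.units_eq_one_or ε with rfl | rfl
  · simp
  · simp only [Units.neg_smul, one_smul]
    rfl

variable (A) in
/-- The column of index `q` of a complex of graded objects: the complex formed by the components
of degree `q`, with the diagonal entries of the differential. It is placed so that its term in
degree `p` has total degree `p + q`. -/
def col (q : ℤ) : CochainComplex (Gr A) ℤ ⥤ CochainComplex A ℤ where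
  obj M :=
    { X p := (M.X (p + q)).X q
      d p p' := (M.d (p + q) (p' + q)).entry q q
      shape p p' h := by
        rw [M.shape _ _ (fun h' => h (show p + 1 = p' by
          have : p + q + 1 = p' + q := h'
          lia))]
        rfl
      d_comp_d' p p' p'' _ _ := by
        rw [← Gr.comp_entry_self, M.d_comp_d]
        rfl }
  map f :=
    { f p := (f.f (p + q)).entry q q
      comm' p p' _ := by
        dsimp only
        rw [← Gr.comp_entry_self, f.comm, Gr.comp_entry_self] }
  map_id M := by
    ext p
    exact Gr.id_entry_self _ _
  map_comp f g := by
    ext p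
    exact Gr.comp_entry_self _ _ _

instance (q : ℤ) : (col A q).Additive where
  map_add := rfl

lemma col_obj_X (q : ℤ) (M : CochainComplex (Gr A) ℤ) (p : ℤ) :
    ((col A q).obj M).X p = (M.X (p + q)).X q := rfl

lemma col_map_f (q : ℤ) {M N : CochainComplex (Gr A) ℤ} (f : M ⟶ N) (p : ℤ) :
    ((col A q).map f).f p = (f.f (p + q)).entry q q := rfl

variable {P N K : CochainComplex (Gr A) ℤ}

/-- A cochain has weight at least `w` if its components raise the degree of graded objects by at
least `w`. -/
def HasWeight {n : ℤ} (z : Cochain P N n) (w : ℤ) : Prop :=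
  ∀ (i i' : ℤ) (h : i + n = i') (j k : ℤ), k < j + w → (z.v i i' h).entry j k = 0

lemma hasWeight_zero {n : ℤ} (z : Cochain P N n) : HasWeight z 0 :=
  fun _ _ _ j k h => (z.v _ _ _).entry_eq_zero j k (by lia)

namespace HasWeight

variable {n : ℤ} {z z' : Cochain P N n} {w : ℤ}

lemma mono (hz : HasWeight z w) {w' : ℤ} (h : w' ≤ w) : HasWeight z w' :=
  fun i i' hi j k hjk => hz i i' hi j k (by lia)

lemma add (hz : HasWeight z w) (hz' : HasWeight z' w) : HasWeight (z + z') w :=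
  fun i i' h j k hjk => by
    have h₁ := hz i i' h j k hjk
    have h₂ := hz' i i' h j k hjk
    exact (congrArg₂ (· + ·) h₁ h₂).trans (add_zero 0)

lemma neg (hz : HasWeight z w) : HasWeight (-z) w := fun i i' h j k hjk =>
  (congrArg (- ·) (hz i i' h j k hjk)).trans neg_zero

lemma sub (hz : HasWeight z w) (hz' : HasWeight z' w) : HasWeight (z - z') w := by
  rw [sub_eq_add_neg]
  exact hz.add hz'.neg

lemma comp (hz : HasWeight z w) {n' n'' w' : ℤ} {y : Cochain N K n'} (hy : HasWeight y w')
    (h : n + n' = n'') : HasWeight (z.comp y h) (w + w') := fun i i' hi j k hjk => by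
  rw [Cochain.comp_v z y h i (i + n) i' rfl (by lia), Gr.comp_entry]
  refine Finset.sum_eq_zero fun l _ => ?_
  by_cases hl : l < j + w
  · rw [hz _ _ _ _ _ hl, zero_comp]
  · rw [hy _ _ _ _ _ (show k < l + w' by lia), comp_zero]

lemma δ (hz : HasWeight z w) {n' : ℤ} (h : n + 1 = n') : HasWeight (δ n n' z) w :=
  fun i i' hi j k hjk => by
    rw [δ_v n n' h z i i' hi (i' - 1) (i + 1) rfl rfl]
    refine (congrArg₂ (· + ·) (?_ : (z.v i (i' - 1) _ ≫ N.d (i' - 1) i').entry j k = 0)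
      (?_ : (n'.negOnePow • P.d i (i + 1) ≫ z.v (i + 1) i' _).entry j k = 0)).trans (add_zero 0)
    · rw [Gr.comp_entry]
      refine Finset.sum_eq_zero fun l hl => ?_
      rw [hz _ _ _ _ _ (show l < j + w by have := (Finset.mem_Icc.1 hl).2; lia), zero_comp]
    · rw [Gr.units_smul_entry, Gr.comp_entry, Finset.sum_eq_zero fun l hl => ?_, smul_zero]
      rw [hz _ _ _ _ _ (show k < l + w by have := (Finset.mem_Icc.1 hl).1; lia), comp_zero]

end HasWeight

/-- The entries of a cochain from the component of degree `q` to the component of degree `q'`, as a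
cochain between columns. With the signs, this commutes with the differentials on the lowest
entries. -/
def entries {n : ℤ} (z : Cochain P N n) (q q' m : ℤ) (hm : m + q' = n + q) :
    Cochain ((col A q).obj P) ((col A q').obj N) m :=
  Cochain.mk fun p p' h =>
    ((q' - q) * (p + q)).negOnePow • (z.v (p + q) (p' + q') (by lia)).entry q q'

lemma entries_v {n : ℤ} (z : Cochain P N n) (q q' m : ℤ) (hm : m + q' = n + q) (p p' : ℤ)
    (h : p + m = p') : (entries z q q' m hm).v p p' h =
      ((q' - q) * (p + q)).negOnePow • (z.v (p + q) (p' + q') (by lia)).entry q q' := rfl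

lemma entries_add {n : ℤ} (z z' : Cochain P N n) (q q' m : ℤ) (hm : m + q' = n + q) :
    entries (z + z') q q' m hm = entries z q q' m hm + entries z' q q' m hm := by
  ext p p' h
  exact smul_add _ _ _

lemma entries_neg {n : ℤ} (z : Cochain P N n) (q q' m : ℤ) (hm : m + q' = n + q) :
    entries (-z) q q' m hm = -entries z q q' m hm := by
  ext p p' h
  exact smul_neg _ _

lemma entries_sub {n : ℤ} (z z' : Cochain P N n) (q q' m : ℤ) (hm : m + q' = n + q) :
    entries (z - z') q q' m hm = entries z q q' m hm - entries z' q q' m hm := by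
  rw [sub_eq_add_neg, entries_add, entries_neg, sub_eq_add_neg]

lemma entries_self_v {n : ℤ} (z : Cochain P N n) (q : ℤ) (p p' : ℤ) (h : p + n = p') :
    (entries z q q n rfl).v p p' h = (z.v (p + q) (p' + q) (by lia)).entry q q := by
  rw [entries_v, sub_self, zero_mul, Int.negOnePow_zero, one_smul]

lemma entries_ofHom (f : P ⟶ N) (q : ℤ) :
    entries (Cochain.ofHom f) q q 0 rfl = Cochain.ofHom ((col A q).map f) := by
  ext p
  rw [entries_self_v, Cochain.ofHom_v, Cochain.ofHom_v, col_map_f]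

lemma entries_of_lt {n : ℤ} (z : Cochain P N n) (q q' m : ℤ) (hm : m + q' = n + q) (h : q' < q) :
    entries z q q' m hm = 0 := by
  ext p p' _
  exact (congrArg (_ • ·) ((z.v _ _ _).entry_eq_zero _ _ h)).trans
    (smul_zero (A := (P.X (p + q)).X q ⟶ (N.X (p' + q')).X q') _)

lemma units_smul_add_comp {X Y Z W : A} (a : X ⟶ Y) (b : Y ⟶ W) (c : X ⟶ Z) (d : Z ⟶ W)
    (s s' u u' : ℤˣ) (h : s * u = u' * s') :
    s • (a ≫ b + u • c ≫ d) = (s • a) ≫ b + u' • c ≫ (s' • d) := by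
  rw [Linear.units_smul_comp, Linear.comp_units_smul, smul_smul, ← h, smul_add, smul_smul]

/-- Only the diagonal entries of the differentials contribute to the lowest entries of a
coboundary. -/
lemma entries_δ {n n' : ℤ} (hn : n + 1 = n') (z : Cochain P N n) (q q' m m' : ℤ)
    (hm : m + q' = n + q) (hm' : m' + q' = n' + q) (hz : HasWeight z (q' - q)) :
    entries (δ n n' z) q q' m' hm' = δ m m' (entries z q q' m hm) := by
  by_cases hqq : q ≤ q'
  swap
  · rw [entries_of_lt _ _ _ _ _ (by lia), entries_of_lt _ _ _ _ _ (by lia), δ_zero]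
  ext p p' h
  have e₁ : (z.v (p + q) (p' - 1 + q') (by lia) ≫ N.d (p' - 1 + q') (p' + q')).entry q q' =
      (z.v (p + q) (p' - 1 + q') (by lia)).entry q q' ≫
        (N.d (p' - 1 + q') (p' + q')).entry q' q' := by
    rw [Gr.comp_entry]
    refine Finset.sum_eq_single_of_mem q' (by simpa using hqq) fun l hl hl' => ?_
    rw [hz _ _ _ _ _ (by have := (Finset.mem_Icc.1 hl).2; lia), zero_comp]
  have e₂ : (P.d (p + q) (p + 1 + q) ≫ z.v (p + 1 + q) (p' + q') (by lia)).entry q q' =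
      (P.d (p + q) (p + 1 + q)).entry q q ≫
        (z.v (p + 1 + q) (p' + q') (by lia)).entry q q' := by
    rw [Gr.comp_entry]
    refine Finset.sum_eq_single_of_mem q (by simpa using hqq) fun l hl hl' => ?_
    rw [hz _ _ _ _ _ (by have := (Finset.mem_Icc.1 hl).1; lia), comp_zero]
  -- the sign `(-1)^{(q' - q)(p + q)}` in `entries` accounts for the change of degree from `n` to
  -- `m`
  have e₃ : ((q' - q) * (p + q)).negOnePow * n'.negOnePow =
      m'.negOnePow * ((q' - q) * (p + 1 + q)).negOnePow := by
    rw [← Int.negOnePow_add, ← Int.negOnePow_add, Int.negOnePow_eq_iff]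
    refine ⟨0, ?_⟩
    have : n' = m' + q' - q := by lia
    subst this
    ring
  rw [entries_v, δ_v m m' (by lia) _ p p' h (p' - 1) (p + 1) rfl rfl, entries_v, entries_v,
    δ_v n n' hn z (p + q) (p' + q') (by lia) (p' - 1 + q') (p + 1 + q) (by lia) (by lia)]
  refine Eq.trans (congrArg (_ • ·) ?_) (units_smul_add_comp _ _ _ _ _ _ _ _ e₃)
  exact congrArg₂ (· + ·) e₁ ((Gr.units_smul_entry _ _ _ _).trans (congrArg (_ • ·) e₂))

/-- The weight of a cochain increases if its lowest entries vanish. -/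
lemma HasWeight.succ {n w : ℤ} {z : Cochain P N n} (hz : HasWeight z w)
    (h : ∀ q, entries z q (q + w) (n - w) (by lia) = 0) : HasWeight z (w + 1) := by
  intro i i' hi j k hjk
  by_cases hk : k < j + w
  · exact hz i i' hi j k hk
  obtain rfl : k = j + w := by lia
  obtain ⟨p, rfl⟩ : ∃ p, i = p + j := ⟨i - j, by lia⟩
  obtain ⟨p', rfl⟩ : ∃ p', i' = p' + (j + w) := ⟨i' - (j + w), by lia⟩
  have h₁ := Cochain.congr_v (h j) p p' (by lia)
  rw [entries_v, Cochain.zero_v] at h₁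
  exact (smul_eq_zero_iff_eq _).1 h₁

end Columns

end EtaStable
end

noncomputable section
namespace EtaStable

/-! ### Coboundaries and the filtration by the weight -/

section Lifting

set_option linter.unusedSectionVars false

universe v w

open CochainComplex.HomComplex

variable {A : Type w} [Category.{v} A] [Preadditive A] {P N : CochainComplex (Gr A) ℤ}

/-- The cochain whose entries raise the degree of graded objects by `w`, and are given by cochains
between columns. -/
def ofEntries {n m w : ℤ} (hw : 0 ≤ w) (hm : m + w = n)
    (c : ∀ q q' : ℤ, q + w = q' → Cochain ((col A q).obj P) ((col A q').obj N) m) : Cochain P N n :=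
  Cochain.mk fun i i' h =>
    { entry := fun j k => if hk : j + w = k then (w * i).negOnePow •
          eqToHom (show (P.X i).X j = ((col A j).obj P).X (i - j) by
            rw [col_obj_X, sub_add_cancel]) ≫
          (c j k hk).v (i - j) (i' - k) (by lia) ≫
          eqToHom (show ((col A k).obj N).X (i' - k) = (N.X i').X k by
            rw [col_obj_X, sub_add_cancel])
        else 0
      entry_eq_zero := fun j k h => dif_neg (by lia) }

section OfEntries

variable {n m w : ℤ} (hw : 0 ≤ w) (hm : m + w = n)
  (c : ∀ q q' : ℤ, q + w = q' → Cochain ((col A q).obj P) ((col A q').obj N) m)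

lemma ofEntries_v_entry (i i' : ℤ) (h : i + n = i') (j k : ℤ) (hk : j + w = k) :
    ((ofEntries hw hm c).v i i' h).entry j k = (w * i).negOnePow •
        eqToHom (show (P.X i).X j = ((col A j).obj P).X (i - j) by
          rw [col_obj_X, sub_add_cancel]) ≫
        (c j k hk).v (i - j) (i' - k) (by lia) ≫
        eqToHom (show ((col A k).obj N).X (i' - k) = (N.X i').X k by
          rw [col_obj_X, sub_add_cancel]) := dif_pos hk

lemma ofEntries_v_entry_of_ne (i i' : ℤ) (h : i + n = i') (j k : ℤ) (hk : j + w ≠ k) :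
    ((ofEntries hw hm c).v i i' h).entry j k = 0 := dif_neg hk

lemma hasWeight_ofEntries : HasWeight (ofEntries hw hm c) w :=
  fun i i' h j k hk => ofEntries_v_entry_of_ne hw hm c i i' h j k (by lia)

end OfEntries

lemma eqToHom_comp_v_comp_eqToHom {E F : CochainComplex A ℤ} {n : ℤ} (z : Cochain E F n)
    {p p' r r' : ℤ} (h : p + n = p') (hr : r = p) (hr' : r' = p') :
    eqToHom (show E.X p = E.X r by rw [hr]) ≫ z.v r r' (by lia) ≫
      eqToHom (show F.X r' = F.X p' by rw [hr']) = z.v p p' h := by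
  subst hr hr'
  simp

lemma entries_ofEntries {n m w : ℤ} (hw : 0 ≤ w) (hm : m + w = n)
    (c : ∀ q q' : ℤ, q + w = q' → Cochain ((col A q).obj P) ((col A q').obj N) m) (q q' : ℤ)
    (hq : q + w = q') : entries (ofEntries hw hm c) q q' m (by lia) = c q q' hq := by
  ext p p' h
  rw [entries_v]
  refine (congrArg (_ • ·) (ofEntries_v_entry hw hm c (p + q) (p' + q') (by lia) q q' hq)).trans ?_
  have e : ((q' - q) * (p + q)).negOnePow * (w * (p + q)).negOnePow = 1 := by
    rw [show q' - q = w by lia, ← Int.negOnePow_add, Int.negOnePow_even _ ⟨_, rfl⟩]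
  exact ((smul_smul _ _ _).trans ((congrArg (· • _) e).trans (one_smul _ _))).trans
    (eqToHom_comp_v_comp_eqToHom (c q q' hq) h (by lia) (by lia))

/-- A diagonal cochain with prescribed restrictions to the columns. -/
lemma exists_entries_eq {n : ℤ} (c : ∀ q, Cochain ((col A q).obj P) ((col A q).obj N) n) :
    ∃ z : Cochain P N n, ∀ q, entries z q q n rfl = c q := by
  have e : ∀ q q' : ℤ, q + 0 = q' → q = q' := fun q q' h => by lia
  exact ⟨ofEntries (le_refl 0) (add_zero n) fun q q' h => e q q' h ▸ c q,
    fun q => entries_ofEntries (le_refl 0) (add_zero n) _ q q (add_zero q)⟩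

/-- A complex of graded objects is banded if the difference between the total degree and the
degree of graded objects is bounded on the nonzero components. -/
def IsBanded (M : CochainComplex (Gr A) ℤ) : Prop :=
  ∃ a b : ℤ, ∀ i q : ℤ, ¬ (a ≤ i - q ∧ i - q ≤ b) → IsZero ((M.X i).X q)

/-- Between banded complexes there are no nonzero cochains of a given degree and of large weight. -/
lemma IsBanded.exists_weight (hP : IsBanded P) (hN : IsBanded N) (n : ℤ) :
    ∃ w : ℤ, ∀ z : Cochain P N n, HasWeight z w → z = 0 := by
  obtain ⟨a, b, hP⟩ := hP
  obtain ⟨a', b', hN⟩ := hN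
  refine ⟨b - a' + n + 1, fun z hz => ?_⟩
  ext i i' h j k
  by_cases h₁ : k < j + (b - a' + n + 1)
  · exact hz i i' h j k h₁
  · by_cases h₂ : a ≤ i - j ∧ i - j ≤ b
    · exact (hN i' k (by lia)).eq_of_tgt _ _
    · exact (hP i j h₂).eq_of_src _ _

/-- The vanishing of the morphisms `E ⟶ F⟦m⟧` in the homotopy category for `m < 0`, in terms of
cochains. -/
def NegVanishing (E F : CochainComplex A ℤ) : Prop :=
  ∀ m : ℤ, m < 0 → ∀ z : Cochain E F m, δ m (m + 1) z = 0 →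
    ∃ y : Cochain E F (m - 1), δ (m - 1) m y = z

/-- If the lowest entries of a cochain are coboundaries, they can be removed. -/
lemma exists_sub_δ_hasWeight {n w : ℤ} (hw : 0 ≤ w) (z : Cochain P N n) (hz : HasWeight z w)
    (m m' : ℤ) (hm : m = n - 1 - w) (hm' : m' = n - w)
    (h : ∀ q q' : ℤ, ∀ hq : q + w = q', ∃ y : Cochain ((col A q).obj P) ((col A q').obj N) m,
      δ m m' y = entries z q q' m' (by lia)) :
    ∃ y : Cochain P N (n - 1), HasWeight y w ∧ HasWeight (z - δ (n - 1) n y) (w + 1) := by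
  subst hm hm'
  choose c hc using h
  have hc' := hasWeight_ofEntries hw (sub_add_cancel (n - 1) w) c
  refine ⟨_, hc', HasWeight.succ (hz.sub (hc'.δ (by lia))) fun q => ?_⟩
  rw [entries_sub, entries_δ (by lia) _ q (q + w) (n - 1 - w) (n - w) (by lia) (by lia)
    (hc'.mono (by lia)), entries_ofEntries _ _ _ _ _ rfl, hc, sub_self]

/-- The lowest entries of a cochain of weight `w` are cocycles if its coboundary has larger
weight. -/
lemma δ_entries_eq_zero {n w : ℤ} (z : Cochain P N n) (hz : HasWeight z w)
    (hδ : HasWeight (δ n (n + 1) z) (w + 1)) (q q' m : ℤ) (hq : q + w = q') (hm : m = n - w) :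
    δ m (m + 1) (entries z q q' m (by lia)) = 0 := by
  rw [← entries_δ rfl z q q' m (m + 1) (by lia) (by lia) (hz.mono (by lia))]
  ext p p' h
  rw [entries_v, Cochain.zero_v, hδ _ _ _ _ _ (by lia)]
  exact smul_zero (A := (P.X (p + q)).X q ⟶ (N.X (p' + q')).X q') _

/-- A cocycle of weight larger than its degree is a coboundary: its lowest entries are cocycles of
negative degree, which are coboundaries, so that the weight can be increased up to a bound above
which cochains vanish. -/
lemma exists_δ_eq (hP : IsBanded P) (hN : IsBanded N)
    (hV : ∀ q q', NegVanishing ((col A q).obj P) ((col A q').obj N)) {n w : ℤ} (hw : 0 ≤ w)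
    (hnw : n < w) (z : Cochain P N n) (hz : HasWeight z w) (hδ : δ n (n + 1) z = 0) :
    ∃ y : Cochain P N (n - 1), HasWeight y w ∧ δ (n - 1) n y = z := by
  obtain ⟨W, hW⟩ := hP.exists_weight hN n
  obtain ⟨k, hk⟩ : ∃ k : ℕ, W ≤ w + k := ⟨(W - w).toNat, by lia⟩
  induction k generalizing w z with
  | zero => exact ⟨0, fun _ _ _ _ _ _ => rfl, by rw [δ_zero, hW z (hz.mono (by lia))]⟩
  | succ k ih =>
    obtain ⟨y, hy, hzy⟩ := exists_sub_δ_hasWeight hw z hz (n - w - 1) (n - w) (by lia) rfl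
      fun q q' hq => hV q q' (n - w) (by lia) (entries z q q' (n - w) (by lia))
        (δ_entries_eq_zero z hz (by rw [hδ]; exact fun _ _ _ _ _ _ => rfl) q q' _ hq rfl)
    obtain ⟨y', hy', hzy'⟩ := ih (w := w + 1) (by lia) (by lia) _ hzy
      (by rw [δ_sub, hδ, δ_δ, sub_zero]) (by push_cast at hk; lia)
    exact ⟨y + y', hy.add (hy'.mono (by lia)), by rw [δ_add, hzy', add_sub_cancel]⟩

/-- The same conclusion holds for a cocycle whose degree equals its weight, if its lowest entries
are coboundaries. -/
lemma exists_δ_eq_of_entries (hP : IsBanded P) (hN : IsBanded N)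
    (hV : ∀ q q', NegVanishing ((col A q).obj P) ((col A q').obj N)) {n : ℤ} (hn : 0 ≤ n)
    (z : Cochain P N n) (hz : HasWeight z n) (hδ : δ n (n + 1) z = 0)
    (h : ∀ q q' : ℤ, ∀ hq : q + n = q', ∃ y : Cochain ((col A q).obj P) ((col A q').obj N) (-1),
      δ (-1) 0 y = entries z q q' 0 (by lia)) :
    ∃ y : Cochain P N (n - 1), HasWeight y n ∧ δ (n - 1) n y = z := by
  obtain ⟨y, hy, hzy⟩ := exists_sub_δ_hasWeight hn z hz (-1) 0 (by lia) (by lia) h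
  obtain ⟨y', hy', hzy'⟩ := exists_δ_eq hP hN hV (by lia) (by lia) _ hzy
    (by rw [δ_sub, hδ, δ_δ, sub_zero])
  exact ⟨y + y', hy.add (hy'.mono (by lia)), by rw [δ_add, hzy', add_sub_cancel]⟩

end Lifting

end EtaStable
end

noncomputable section
namespace EtaStable

/-! ### The complex of columns -/

section Page

set_option linter.unusedSectionVars false

universe v w

open CochainComplex.HomComplex

variable {A : Type w} [Category.{v} A] [Preadditive A] {M N : CochainComplex (Gr A) ℤ}

lemma col_comm_aux {X Y Y' Z : A} {a : X ⟶ Y} {b : Y ⟶ Z} {c : X ⟶ Y'} {d : Y' ⟶ Z}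
    (h : a ≫ b + c ≫ d = 0) (n n' : ℤ) (hn : n' = n + 1) :
    n.negOnePow • c ≫ d = n'.negOnePow • a ≫ b := by
  rw [hn, Int.negOnePow_succ, Units.neg_smul, ← smul_neg, ← eq_neg_of_add_eq_zero_right h]

variable (M) in
/-- The entries of the differential which raise the degree of graded objects by one, as a chain map
between columns. -/
def colD (q q' : ℤ) : (col A q).obj M ⟶ (col A q').obj M where
  f p := (p + q).negOnePow • (M.d (p + q) (p + q')).entry q q'
  comm' p p' hp := by
    obtain rfl : p + 1 = p' := hp
    by_cases hq : q + 1 = q'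
    · have h := congrArg (fun f => Gr.Hom.entry f q q')
        (M.d_comp_d (p + q) (p + 1 + q) (p + 1 + q'))
      have h₁ : p + 1 + q = p + q' := by lia
      have h' : (M.d (p + q) (p + 1 + q)).entry q q ≫ (M.d (p + 1 + q) (p + 1 + q')).entry q q' +
          (M.d (p + q) (p + q')).entry q q' ≫ (M.d (p + q') (p + 1 + q')).entry q' q' = 0 := by
        rw [← h₁]
        exact (Gr.comp_entry_succ _ _ _ _ hq).symm.trans h
      exact (Linear.units_smul_comp _ _ _).trans
        ((col_comm_aux h' _ _ (by lia)).trans (Linear.comp_units_smul _ _ _).symm)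
    · rw [M.shape (p + q) (p + q') (fun h => hq (by
        have : p + q + 1 = p + q' := h
        lia)), M.shape (p + 1 + q) (p + 1 + q') (fun h => hq (by
        have : p + 1 + q + 1 = p + 1 + q' := h
        lia))]
      exact ((congrArg (· ≫ _) (smul_zero _)).trans zero_comp).trans
        ((congrArg (_ ≫ ·) (smul_zero _)).trans comp_zero).symm

lemma colD_f (q q' p : ℤ) : (colD M q q').f p =
    (p + q).negOnePow • (M.d (p + q) (p + q')).entry q q' := rfl

lemma colD_of_ne (q q' : ℤ) (h : q + 1 ≠ q') : colD M q q' = 0 := by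
  ext p
  rw [colD_f, M.shape (p + q) (p + q') (fun h' => h (by
        have : p + q + 1 = p + q' := h'
        lia))]
  exact smul_zero (A := (M.X (p + q)).X q ⟶ (M.X (p + q')).X q') _

/-- The component of degree two of the equation `d² = 0`, with signs. The indices `i₁` and `i₂`
are equal to `i'`; keeping them distinct avoids casts when the columns are reindexed. -/
lemma colD_comp_aux (q q' q'' : ℤ) (h : q + 1 = q') (h' : q' + 1 = q'') (i i' i'' i₁ i₂ : ℤ)
    (hi : i + 1 = i') (hi' : i' + 1 = i'') (hi₁ : i₁ = i') (hi₂ : i₂ = i') (s s' : ℤˣ)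
    (hs : s * s' = -1) :
    (s • (M.d i i').entry q q') ≫ (s' • (M.d i' i'').entry q' q'') =
      ((1 : ℤˣ) • (M.d i i₁).entry q q'') ≫ (M.d i₁ i'').entry q'' q'' +
        (0 : ℤ).negOnePow • (M.d i i₂).entry q q ≫ ((1 : ℤˣ) • (M.d i₂ i'').entry q q'') := by
  subst hi₁ hi₂
  have e := congrArg (fun f => Gr.Hom.entry f q q'') (M.d_comp_d i i₂ i'')
  have e' := (Gr.comp_entry_succ_succ (M.d i i₂) (M.d i₂ i'') q q' q'' h h').symm.trans e
  rw [one_smul, one_smul, Int.negOnePow_zero, one_smul, Linear.units_smul_comp,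
    Linear.comp_units_smul, smul_smul, hs, Units.neg_smul, one_smul, neg_eq_iff_add_eq_zero,
    ← add_assoc, add_comm _ (_ ≫ _), add_comm _ (_ ≫ _)]
  refine Eq.trans ?_ e'
  abel

/-- The composition of two successive maps between columns is null-homotopic, by the entries of the
differential which raise the degree of graded objects by two. -/
lemma colD_comp_colD (q q' q'' : ℤ) (h : q + 1 = q') (h' : q' + 1 = q'') :
    Cochain.ofHom (colD M q q' ≫ colD M q' q'') =
      δ (-1) 0 (entries (Cochain.diff M) q q'' (-1) (by lia)) := by
  ext p
  have hs : ((q'' - q) * (p + q)).negOnePow = 1 := by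
    rw [show q'' - q = 2 by lia, Int.negOnePow_even _ (even_two_mul _)]
  have hs' : ((q'' - q) * (p + 1 + q)).negOnePow = 1 := by
    rw [show q'' - q = 2 by lia, Int.negOnePow_even _ (even_two_mul _)]
  rw [Cochain.ofHom_v, HomologicalComplex.comp_f, δ_v (-1) 0 (by lia) _ p p (by lia) (p - 1) (p + 1)
    rfl rfl, entries_v, entries_v, hs, hs', colD_f, colD_f]
  exact colD_comp_aux q q' q'' h h' (p + q) (p + q') (p + q'') (p - 1 + q'') (p + 1 + q)
    (by lia) (by lia) (by lia) (by lia) _ _ (by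
      rw [← Int.negOnePow_add, Int.negOnePow_odd _ ⟨p + q, by lia⟩])

lemma entries_succ_aux {X Y₁ Y₂ Y₃ Y₄ Z : A} (a : X ⟶ Y₁) (a' : Y₁ ⟶ Z) (b : X ⟶ Y₂) (b' : Y₂ ⟶ Z)
    (c : X ⟶ Y₃) (c' : Y₃ ⟶ Z) (d : X ⟶ Y₄) (d' : Y₄ ⟶ Z) (s s' e e' : ℤˣ) (he : e = -1)
    (he' : e' = 1) (hs : s' = -s) :
    s • ((a ≫ a' + b ≫ b') + e • (c ≫ c' + d ≫ d')) =
      (s • b) ≫ b' + e' • c ≫ (s' • c') + a ≫ (s • a') - (s • d) ≫ d' := by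
  subst he he' hs
  rcases Int.units_eq_one_or s with rfl | rfl <;> simp <;> abel

lemma entries_succ_aux' (z : Cochain M N 0) (q q' : ℤ) (h : q + 1 = q') (i i₁ i₂ i₃ : ℤ)
    (h₁ : i₁ = i) (h₂ : i + 1 = i₂) (h₃ : i₃ = i₂) (s s' e : ℤˣ) (hs : s' = -s) (he : e = 1) :
    s • ((δ 0 1 z).v i i₂ h₂).entry q q' =
      (s • (z.v i i₁ (by lia)).entry q q') ≫ (N.d i₁ i₂).entry q' q' +
        e • (M.d i i₃).entry q q ≫ (s' • (z.v i₃ i₂ (by lia)).entry q q') +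
        (z.v i i (by lia)).entry q q ≫ (s • (N.d i i₂).entry q q') -
        (s • (M.d i i₂).entry q q') ≫ (z.v i₂ i₂ (by lia)).entry q' q' := by
  subst h₁ h₃
  rw [δ_v 0 1 rfl z i₁ i₃ h₂ i₁ i₃ (by lia) h₂]
  refine (congrArg (s • ·) ((congrArg (_ + ·) (Gr.units_smul_entry _ _ _ _)).trans
    (congrArg₂ (fun x y => x + Int.negOnePow 1 • y) (Gr.comp_entry_succ _ _ _ _ h)
      (Gr.comp_entry_succ _ _ _ _ h)))).trans
    (entries_succ_aux _ _ _ _ _ _ _ _ _ _ _ _ Int.negOnePow_one he hs)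

/-- The entries of degree one of the coboundary of a cochain of degree zero. -/
lemma entries_δ_succ (z : Cochain M N 0) (q q' : ℤ) (h : q + 1 = q') :
    entries (δ 0 1 z) q q' 0 (by lia) = δ (-1) 0 (entries z q q' (-1) (by lia)) +
      (entries z q q 0 rfl).comp (Cochain.ofHom (colD N q q')) (add_zero 0) -
        (Cochain.ofHom (colD M q q')).comp (entries z q' q' 0 rfl) (add_zero 0) := by
  ext p
  have hs (p : ℤ) : ((q' - q) * (p + q)) = p + q := by
    rw [show q' - q = 1 by lia, one_mul]
  rw [entries_v, Cochain.sub_v, Cochain.add_v, δ_v (-1) 0 (by lia) _ p p (by lia) (p - 1) (p + 1)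
    rfl rfl, Cochain.comp_zero_cochain_v, Cochain.comp_zero_cochain_v, Cochain.ofHom_v,
    Cochain.ofHom_v, entries_self_v, entries_self_v, entries_v, entries_v, colD_f, colD_f, hs, hs]
  exact entries_succ_aux' z q q' h (p + q) (p - 1 + q') (p + q') (p + 1 + q) (by lia) (by lia)
    (by lia) _ _ _ (by rw [show p + 1 + q = p + q + 1 by lia, Int.negOnePow_succ])
    Int.negOnePow_zero

end Page

end EtaStable
end

noncomputable section
namespace EtaStable

section PageFunctor

set_option linter.unusedSectionVars false

universe v w

open CochainComplex.HomComplex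

variable {A : Type w} [Category.{v} A] [Preadditive A]

lemma quotient_map_eq_iff {E F : CochainComplex A ℤ} (f g : E ⟶ F) :
    (HomotopyCategory.quotient A (ComplexShape.up ℤ)).map f =
      (HomotopyCategory.quotient A (ComplexShape.up ℤ)).map g ↔
    ∃ z : Cochain E F (-1), Cochain.ofHom f = δ (-1) 0 z + Cochain.ofHom g := by
  constructor
  · intro h
    obtain ⟨z, hz⟩ := Cochain.equivHomotopy _ _ (HomotopyCategory.homotopyOfEq _ _ h)
    exact ⟨z, hz⟩
  · rintro ⟨z, hz⟩
    exact HomotopyCategory.eq_of_homotopy _ _ ((Cochain.equivHomotopy _ _).symm ⟨z, hz⟩)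

lemma entries_zero {M N : CochainComplex (Gr A) ℤ} {n : ℤ} (q q' m : ℤ) (hm : m + q' = n + q) :
    entries (0 : Cochain M N n) q q' m hm = 0 :=
  Cochain.ext _ _ fun p p' _ => smul_zero (A := (M.X (p + q)).X q ⟶ (N.X (p' + q')).X q') _

lemma quotient_map_colD_comp (M : CochainComplex (Gr A) ℤ) (q q' q'' : ℤ) (h : q + 1 = q')
    (h' : q' + 1 = q'') : (HomotopyCategory.quotient A (ComplexShape.up ℤ)).map (colD M q q') ≫
      (HomotopyCategory.quotient A (ComplexShape.up ℤ)).map (colD M q' q'') = 0 := by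
  rw [← Functor.map_comp, ← Functor.map_zero, quotient_map_eq_iff]
  exact ⟨_, by rw [colD_comp_colD _ _ _ h h', Cochain.ofHom_zero, add_zero]⟩

/-- A chain map commutes up to homotopy with the maps between columns; the homotopy is given by
its entries which raise the degree of graded objects by one. -/
lemma quotient_map_col_comp {M N : CochainComplex (Gr A) ℤ} (f : M ⟶ N) (q q' : ℤ)
    (h : q + 1 = q') :
    (HomotopyCategory.quotient A (ComplexShape.up ℤ)).map ((col A q).map f) ≫
      (HomotopyCategory.quotient A (ComplexShape.up ℤ)).map (colD N q q') =
    (HomotopyCategory.quotient A (ComplexShape.up ℤ)).map (colD M q q') ≫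
      (HomotopyCategory.quotient A (ComplexShape.up ℤ)).map ((col A q').map f) := by
  rw [← Functor.map_comp, ← Functor.map_comp, quotient_map_eq_iff]
  have e := entries_δ_succ (Cochain.ofHom f) q q' h
  rw [δ_ofHom, entries_ofHom, entries_ofHom] at e
  refine ⟨-entries (Cochain.ofHom f) q q' (-1) (by lia), ?_⟩
  rw [Cochain.ofHom_comp, Cochain.ofHom_comp, δ_neg, neg_add_eq_sub, eq_sub_iff_add_eq]
  rw [entries_zero, eq_comm, sub_eq_zero, add_comm] at e
  exact e

variable (A) in
/-- The complex in `K(A)` formed by the columns of a complex of graded objects, with the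
differential induced by the entries which raise the degree of graded objects by one. -/
def page : CochainComplex (Gr A) ℤ ⥤ CochainComplex (HomotopyCategory A (ComplexShape.up ℤ)) ℤ where
  obj M :=
    { X q := (HomotopyCategory.quotient A _).obj ((col A q).obj M)
      d q q' := (HomotopyCategory.quotient A _).map (colD M q q')
      shape q q' h := by rw [colD_of_ne q q' h, Functor.map_zero]
      d_comp_d' q q' q'' h h' := quotient_map_colD_comp M q q' q'' h h' }
  map f :=
    { f q := (HomotopyCategory.quotient A _).map ((col A q).map f)
      comm' q q' h := quotient_map_col_comp f q q' h }
  map_id M := by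
    ext q
    exact (col A q ⋙ HomotopyCategory.quotient A (ComplexShape.up ℤ)).map_id M
  map_comp f g := by
    ext q
    exact (col A q ⋙ HomotopyCategory.quotient A (ComplexShape.up ℤ)).map_comp f g

lemma page_map_f {M N : CochainComplex (Gr A) ℤ} (f : M ⟶ N) (q : ℤ) :
    ((page A).map f).f q = (HomotopyCategory.quotient A _).map ((col A q).map f) := rfl

instance : (page A).Additive where
  map_add {M N f g} := by
    ext q
    exact (HomotopyCategory.quotient A (ComplexShape.up ℤ)).map_add
      (f := (col A q).map f) (g := (col A q).map g)

variable {P N : CochainComplex (Gr A) ℤ} (hP : IsBanded P) (hN : IsBanded N)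
    (hV : ∀ q q', NegVanishing ((col A q).obj P) ((col A q').obj N))
include hP hN hV

/-- Every morphism between the complexes of columns lifts to a chain map: the obstructions to a lift
are cocycles of negative degree between columns. -/
lemma exists_page_map_eq (α : (page A).obj P ⟶ (page A).obj N) :
    ∃ f : P ⟶ N, (page A).map f = α := by
  have ha : ∀ q, ∃ a : (col A q).obj P ⟶ (col A q).obj N,
    (HomotopyCategory.quotient A _).map a = α.f q := fun q =>
      (HomotopyCategory.quotient A _).map_surjective _
  choose a ha using ha
  obtain ⟨z, hz⟩ := exists_entries_eq (P := P) (N := N) (fun q => Cochain.ofHom (a q))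
  -- the entries of weight zero of `δ z` vanish because the maps `a q` are chain maps
  have hw : HasWeight (δ 0 1 z) 1 := by
    refine HasWeight.succ (w := 0) (hasWeight_zero _) fun q => ?_
    have e : ∀ q' (hq : q = q'), entries (δ 0 1 z) q q' 1 (by lia) = 0 := by
      rintro _ rfl
      rw [entries_δ (by lia) z q q 0 1 (by lia) (by lia) ((hasWeight_zero z).mono (by lia)), hz,
        δ_ofHom]
    exact e (q + 0) (by lia)
  obtain ⟨y, hy, hyz⟩ : ∃ y : Cochain P N 0, HasWeight y 1 ∧ δ 0 1 y = δ 0 1 z :=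
    exists_δ_eq_of_entries hP hN hV (by lia) (δ 0 1 z) hw (δ_δ _ _ _ _)
    fun q q' h => by
      -- the entries of weight one are coboundaries because the maps `a q` commute up to homotopy
      -- with the differentials
      have h₁ := α.comm q q'
      rw [← ha, ← ha] at h₁
      replace h₁ := ((Functor.map_comp _ _ _).trans h₁).trans
        ((HomotopyCategory.quotient A (ComplexShape.up ℤ)).map_comp (colD P q q') (a q')).symm
      rw [quotient_map_eq_iff] at h₁
      obtain ⟨y, hy⟩ := h₁
      refine ⟨entries z q q' (-1) (by lia) + y, ?_⟩
      rw [entries_δ_succ z q q' h, hz, hz, δ_add, ← Cochain.ofHom_comp, ← Cochain.ofHom_comp, hy]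
      abel
  have hδ : δ 0 1 (z - y) = 0 := by rw [δ_sub, sub_eq_zero]; exact hyz.symm
  refine ⟨Cocycle.homOf (Cocycle.mk (z - y) 1 rfl hδ), ?_⟩
  ext q
  rw [page_map_f, ← ha]
  congr 1
  apply Cochain.ofHom_injective
  rw [← entries_ofHom, Cocycle.cochain_ofHom_homOf_eq_coe, ← hz, Cocycle.mk_coe, entries_sub]
  refine sub_eq_self.2 (Cochain.ext _ _ fun p p' h => ?_)
  rw [entries_self_v]
  exact hy _ _ _ _ _ (by lia)

/-- A chain map which induces zero between the complexes of columns is null-homotopic. -/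
lemma homotopy_of_page_map_eq_zero (f : P ⟶ N) (hf : (page A).map f = 0) :
    Nonempty (Homotopy f 0) := by
  obtain ⟨y, -, hy⟩ := exists_δ_eq_of_entries hP hN hV le_rfl (Cochain.ofHom f) (hasWeight_zero _)
    (δ_ofHom f) fun q q' hq => by
      obtain rfl : q = q' := by lia
      have h₁ : (HomotopyCategory.quotient A _).map ((col A q).map f) =
        (HomotopyCategory.quotient A _).map 0 :=
          (HomologicalComplex.congr_hom hf q).trans
            (Functor.map_zero (HomotopyCategory.quotient A (ComplexShape.up ℤ)) _ _).symm
      rw [quotient_map_eq_iff] at h₁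
      obtain ⟨y, hy⟩ := h₁
      exact ⟨y, by rw [entries_ofHom, hy, Cochain.ofHom_zero, add_zero]⟩
  exact ⟨(Cochain.equivHomotopy _ _).symm ⟨y, by rw [Cochain.ofHom_zero, add_zero]; exact hy.symm⟩⟩

end PageFunctor

end EtaStable
end

noncomputable section
namespace EtaStable

/-! ### The complex of columns and the shifts -/

section PageShift

set_option linter.unusedSectionVars false

universe v w

open CochainComplex.HomComplex

variable {A : Type w} [Category.{v} A] [Preadditive A]

/-- The signs relating the columns of `M[n](n)` to those of `M`, in total degree `i`. They change
by `(-1)^n` when `i` increases by one, and the term `n(n-1)/2` makes them compatible with the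
composition of shifts. -/
def twistSign (n i : ℤ) : ℤˣ := (n * i + n * (n - 1) / 2).negOnePow

lemma twistSign_zero (i : ℤ) : twistSign 0 i = 1 := by simp [twistSign]

lemma twistSign_one (i : ℤ) : twistSign 1 i = i.negOnePow := by simp [twistSign]

lemma twistSign_succ (n i : ℤ) : twistSign n (i + 1) = n.negOnePow * twistSign n i := by
  rw [twistSign, twistSign, ← Int.negOnePow_add]
  congr 1
  ring

lemma twistSign_add (n m i : ℤ) : twistSign (n + m) i = twistSign m i * twistSign n (i + m) := by
  have h (k : ℤ) : k * (k - 1) / 2 * 2 = k * (k - 1) := by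
    refine Int.ediv_mul_cancel ?_
    have := Int.even_mul_pred_self k
    exact this.two_dvd
  rw [twistSign, twistSign, twistSign, ← Int.negOnePow_add]
  congr 1
  have h₁ := h n
  have h₂ := h m
  have h₃ := h (n + m)
  have e : (n + m) * (n + m - 1) = n * (n - 1) + m * (m - 1) + 2 * (n * m) := by ring
  have e' : (n + m) * i = n * i + m * i := by ring
  have e'' : n * (i + m) = n * i + n * m := by ring
  rw [e', e'']
  lia

lemma Gr.eqToHom_entry {X Y : Gr A} (h : X = Y) (q : ℤ) :
    (eqToHom h).entry q q = eqToHom (by rw [h]) := by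
  subst h
  exact Gr.id_entry_self X q

lemma eqToHom_comp_d_entry (M : CochainComplex (Gr A) ℤ) {i i' j j' : ℤ} (hi : i = i')
    (hj : j = j') (q q' : ℤ) :
    eqToHom (by rw [hi]) ≫ (M.d i' j').entry q q' =
      (M.d i j).entry q q' ≫ eqToHom (by rw [hj]) := by
  subst hi hj
  simp

lemma eqToHom_comp_f_entry {M N : CochainComplex (Gr A) ℤ} (f : M ⟶ N) {i i' : ℤ} (hi : i = i')
    (q q' : ℤ) :
    eqToHom (by rw [hi]) ≫ (f.f i').entry q q' = (f.f i).entry q q' ≫ eqToHom (by rw [hi]) := by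
  subst hi
  simp

lemma units_smul_comp_aux {X Y Z W : A} {a : X ⟶ Y} {b : Y ⟶ Z} {c : X ⟶ W} {d : W ⟶ Z}
    {s t u r : ℤˣ} (h : a ≫ b = c ≫ d) (hs : s * t = u * r) :
    (s • a) ≫ (t • b) = (u • c) ≫ (r • d) := by
  rw [Linear.units_smul_comp, Linear.units_smul_comp, Linear.comp_units_smul,
    Linear.comp_units_smul, smul_smul, smul_smul, hs, h]

lemma twistShift_d_entry (n : ℤ) (M : CochainComplex (Gr A) ℤ) (i i' q q' : ℤ) :
    (((twistShift (Gr A) n).obj M).d i i').entry q q' =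
      n.negOnePow • (M.d (i + n) (i' + n)).entry (q + n) (q' + n) :=
  Gr.units_smul_entry _ _ _ _

lemma comp_units_smul_eqToHom {X Y Z : A} (s : ℤˣ) (h : X = Y) (h' : Y = Z) :
    eqToHom h ≫ (s • eqToHom h') = s • eqToHom (h.trans h') := by
  rw [Linear.comp_units_smul, eqToHom_trans]

/-- The columns of `M[n](n)` are columns of `M`. -/
def colTwistShift (n q : ℤ) (M : CochainComplex (Gr A) ℤ) :
    (col A q).obj ((twistShift (Gr A) n).obj M) ≅ (col A (q + n)).obj M :=
  HomologicalComplex.Hom.isoOfComponents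
    (fun p => twistSign n (p + q) • eqToIso (show (M.X (p + q + n)).X (q + n) =
      (M.X (p + (q + n))).X (q + n) by rw [add_assoc]))
    (fun p p' hp => by
      obtain rfl : p + 1 = p' := hp
      have h := eqToHom_comp_d_entry M (show p + q + n = p + (q + n) by lia)
        (show p + 1 + q + n = p + 1 + (q + n) by lia) (q + n) (q + n)
      refine Eq.trans ?_ ((units_smul_comp_aux (s := twistSign n (p + q)) (t := 1)
        (u := n.negOnePow) (r := twistSign n (p + 1 + q)) h ?_).trans
          (congrArg (· ≫ _) (twistShift_d_entry n M (p + q) (p + 1 + q) q q).symm))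
      · exact congrArg (_ ≫ ·) (one_smul _ _).symm
      · rw [mul_one, show p + 1 + q = p + q + 1 by lia, twistSign_succ, ← mul_assoc,
          ← Int.negOnePow_add, Int.negOnePow_even _ ⟨n, rfl⟩, one_mul])

lemma colTwistShift_hom_f (n q : ℤ) (M : CochainComplex (Gr A) ℤ) (p : ℤ) :
    (colTwistShift n q M).hom.f p = twistSign n (p + q) •
      eqToHom (show (M.X (p + q + n)).X (q + n) =
      (M.X (p + (q + n))).X (q + n) by rw [add_assoc]) := rfl

lemma colTwistShift_comp_colD (n q q' : ℤ) (M : CochainComplex (Gr A) ℤ) (hq : q + 1 = q') :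
    (colTwistShift n q M).hom ≫ (n.negOnePow • colD M (q + n) (q' + n)) =
      colD ((twistShift (Gr A) n).obj M) q q' ≫ (colTwistShift n q' M).hom :=
  HomologicalComplex.hom_ext _ _ fun p => by
    have h := eqToHom_comp_d_entry M (show p + q + n = p + (q + n) by lia)
      (show p + q' + n = p + (q' + n) by lia) (q + n) (q' + n)
    refine Eq.trans ?_ ((units_smul_comp_aux (s := twistSign n (p + q))
      (t := n.negOnePow * (p + (q + n)).negOnePow) (u := (p + q).negOnePow * n.negOnePow)
      (r := twistSign n (p + q')) h ?_).trans ?_)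
    · exact congrArg (_ ≫ ·) (smul_smul _ _ _)
    · rw [← hq, show p + (q + 1) = p + q + 1 by lia, twistSign_succ, ← add_assoc,
        Int.negOnePow_add (p + q) n]
      ac_rfl
    · exact congrArg (· ≫ _) ((smul_smul _ _ _).symm.trans
        (congrArg ((p + q).negOnePow • ·) (twistShift_d_entry n M (p + q) (p + q') q q').symm))

/-- The complex of columns of `M[n](n)` is the shift of the one of `M`. -/
def pageTwistShift (n : ℤ) (M : CochainComplex (Gr A) ℤ) :
    (page A).obj ((twistShift (Gr A) n).obj M) ≅ ((page A).obj M)⟦n⟧ :=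
  HomologicalComplex.Hom.isoOfComponents
    (fun q => (HomotopyCategory.quotient A _).mapIso (colTwistShift n q M))
    (fun q q' hq => by
      have h := congrArg (HomotopyCategory.quotient A (ComplexShape.up ℤ)).map
        (colTwistShift_comp_colD n q q' M hq)
      rw [Functor.map_comp, Functor.map_comp, Functor.map_units_smul] at h
      exact h)

/-- The identification of two columns with the same index. -/
def colCongr (M : CochainComplex (Gr A) ℤ) {q q' : ℤ} (h : q = q') :
    (col A q).obj M ⟶ (col A q').obj M := eqToHom (by rw [h])

lemma colCongr_f (M : CochainComplex (Gr A) ℤ) {q q' : ℤ} (h : q = q') (p : ℤ) :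
    (colCongr M h).f p = eqToHom (show (M.X (p + q)).X q = (M.X (p + q')).X q' by rw [h]) := by
  subst h
  rfl

lemma page_XIsoOfEq_hom (M : CochainComplex (Gr A) ℤ) {q q' : ℤ} (h : q = q') :
    (((page A).obj M).XIsoOfEq h).hom =
      (HomotopyCategory.quotient A (ComplexShape.up ℤ)).map (colCongr M h) := by
  subst h
  exact ((HomotopyCategory.quotient A (ComplexShape.up ℤ)).map_id _).symm

lemma XIsoOfEq_hom_entry (M : CochainComplex (Gr A) ℤ) {i i' : ℤ} (h : i = i') (q : ℤ) :
    (M.XIsoOfEq h).hom.entry q q = eqToHom (by rw [h]) := by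
  subst h
  exact Gr.id_entry_self _ q

lemma colTwistShift_naturality (n q : ℤ) {M N : CochainComplex (Gr A) ℤ} (f : M ⟶ N) :
    (col A q).map ((twistShift (Gr A) n).map f) ≫ (colTwistShift n q N).hom =
      (colTwistShift n q M).hom ≫ (col A (q + n)).map f :=
  HomologicalComplex.hom_ext _ _ fun p => by
    have h := eqToHom_comp_f_entry f (show p + q + n = p + (q + n) by lia) (q + n) (q + n)
    refine Eq.trans ?_ ((units_smul_comp_aux (s := 1) (t := twistSign n (p + q))
      (u := twistSign n (p + q)) (r := 1) h.symm (mul_comm _ _)).trans ?_)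
    · exact congrArg (· ≫ _) (one_smul _ _).symm
    · exact congrArg (_ ≫ ·) (one_smul _ _)

lemma twistShiftZero_entry (M : CochainComplex (Gr A) ℤ) (i q : ℤ) :
    (((twistShiftZero (Gr A)).hom.app M).f i).entry q q =
      eqToHom (show (M.X (i + 0)).X (q + 0) = (M.X i).X q by rw [add_zero, add_zero]) :=
  (Gr.comp_entry_self _ _ _).trans ((congrArg₂ (· ≫ ·)
    (Gr.eqToHom_entry (Gr.shift_zero_obj (M.X (i + 0))) q)
      (XIsoOfEq_hom_entry M (add_zero i) q)).trans (eqToHom_trans _ _))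

lemma twistShiftAdd_entry (n m : ℤ) (M : CochainComplex (Gr A) ℤ) (i q : ℤ) :
    (((twistShiftAdd (Gr A) n m).hom.app M).f i).entry q q =
      eqToHom (show (M.X (i + (n + m))).X (q + (n + m)) = (M.X (i + m + n)).X (q + m + n) by
        rw [add_comm n m, add_assoc, add_assoc]) :=
  (Gr.comp_entry_self _ _ _).trans ((congrArg₂ (· ≫ ·)
    (Gr.eqToHom_entry (Gr.shift_add_obj n m (M.X (i + (n + m)))) q)
      (XIsoOfEq_hom_entry M (show i + (n + m) = i + m + n by lia) (q + m + n))).trans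
        (eqToHom_trans _ _))

lemma colTwistShift_zero (q : ℤ) (M : CochainComplex (Gr A) ℤ) :
    (colTwistShift 0 q M).hom ≫ colCongr M (add_zero q) =
      (col A q).map ((twistShiftZero (Gr A)).hom.app M) :=
  HomologicalComplex.hom_ext _ _ fun p => by
    refine Eq.trans ?_ (twistShiftZero_entry M (p + q) q).symm
    have h : (colTwistShift 0 q M).hom.f p = eqToHom (show (M.X (p + q + 0)).X (q + 0) =
        (M.X (p + (q + 0))).X (q + 0) by rw [add_assoc]) := by
      rw [colTwistShift_hom_f, twistSign_zero, one_smul]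
    exact (congrArg₂ (· ≫ ·) h (colCongr_f M (add_zero q) p)).trans (eqToHom_trans _ _)

lemma colTwistShift_add (n m q : ℤ) (M : CochainComplex (Gr A) ℤ) :
    (colTwistShift (n + m) q M).hom ≫ colCongr M (show q + (n + m) = q + m + n by lia) =
      (col A q).map ((twistShiftAdd (Gr A) n m).hom.app M) ≫
        (colTwistShift m q ((twistShift (Gr A) n).obj M)).hom ≫ (colTwistShift n (q + m) M).hom :=
  HomologicalComplex.hom_ext _ _ fun p => by
    have h₁ := colCongr_f M (show q + (n + m) = q + m + n by lia) p
    have h₂ : (eqToHom _ : (M.X (p + q + (n + m))).X (q + (n + m)) ⟶ _) ≫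
          (eqToHom _ : _ ⟶ (M.X (p + (q + m + n))).X (q + m + n)) =
        (eqToHom _ : _ ⟶ (M.X (p + (q + m) + n)).X (q + m + n)) ≫ eqToHom _ :=
      (eqToHom_trans (show _ = (M.X (p + (q + (n + m)))).X (q + (n + m)) by rw [add_assoc])
        (show _ = _ by rw [show q + (n + m) = q + m + n by lia])).trans
        (eqToHom_trans (by
          rw [show q + (n + m) = q + m + n by lia,
            show p + q + (n + m) = p + (q + m) + n by lia])
          (by rw [show p + (q + m) + n = p + (q + m + n) by lia])).symm
    have h₃ := twistShiftAdd_entry n m M (p + q) q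
    refine (congrArg (_ ≫ ·) (h₁.trans (one_smul ℤˣ _).symm)).trans
      ((units_smul_comp_aux (u := twistSign m (p + q)) (r := twistSign n (p + (q + m))) h₂
        ?_).trans ?_)
    · rw [mul_one, twistSign_add, ← add_assoc]
    · refine Eq.trans ?_ (Category.assoc _ _ _)
      refine congrArg (· ≫ _) ?_
      refine Eq.trans ?_ (congrArg (· ≫ _) h₃.symm)
      exact (comp_units_smul_eqToHom (twistSign m (p + q)) _
        (show (M.X (p + q + m + n)).X (q + m + n) = (M.X (p + (q + m) + n)).X (q + m + n) by
          rw [add_assoc p q m])).symm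

variable (A) in
/-- The functor `page` on the category of complexes with the shift `[1](1)`. -/
def pageEta : EtaComplex (Gr A) ⥤ CochainComplex (HomotopyCategory A (ComplexShape.up ℤ)) ℤ :=
  page A

instance : (pageEta A).CommShift ℤ :=
  commShiftMk (pageEta A) (fun n M => pageTwistShift n M)
    (fun n {M N} f => HomologicalComplex.hom_ext _ _ fun q =>
      ((HomotopyCategory.quotient A (ComplexShape.up ℤ)).map_comp _ _).symm.trans
        ((congrArg (HomotopyCategory.quotient A (ComplexShape.up ℤ)).map
          (colTwistShift_naturality n q f)).trans
            ((HomotopyCategory.quotient A (ComplexShape.up ℤ)).map_comp _ _)))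
    (fun M => HomologicalComplex.hom_ext _ _ fun q => by
      refine (HomologicalComplex.comp_f _ _ q).trans ?_
      rw [CochainComplex.shiftFunctorZero_hom_app_f]
      exact (congrArg (_ ≫ ·) (page_XIsoOfEq_hom M (add_zero q))).trans
        (((HomotopyCategory.quotient A (ComplexShape.up ℤ)).map_comp _ _).symm.trans
          (congrArg (HomotopyCategory.quotient A (ComplexShape.up ℤ)).map
            (colTwistShift_zero q M))))
    (fun n m M => HomologicalComplex.hom_ext _ _ fun q => by
      refine (HomologicalComplex.comp_f _ _ q).trans ?_
      rw [CochainComplex.shiftFunctorAdd_hom_app_f]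
      exact (congrArg (_ ≫ ·) (page_XIsoOfEq_hom M (show q + (n + m) = q + m + n by lia))).trans
        (((HomotopyCategory.quotient A (ComplexShape.up ℤ)).map_comp _ _).symm.trans
          ((congrArg (HomotopyCategory.quotient A (ComplexShape.up ℤ)).map
            (colTwistShift_add n m q M)).trans
          (((HomotopyCategory.quotient A (ComplexShape.up ℤ)).map_comp _ _).trans
            (congrArg (_ ≫ ·) ((HomotopyCategory.quotient A (ComplexShape.up ℤ)).map_comp _ _))))))

end PageShift

end EtaStable
end

noncomputable section
namespace EtaStable

/-! ### Degreewise split extensions and cones -/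

section ConeRecognition

set_option linter.unusedSectionVars false

open CochainComplex (mappingCone)
open CochainComplex.HomComplex CochainComplex.mappingCone

variable {C : Type*} [Category* C] [Preadditive C] [HasBinaryBiproducts C]
  {K L E : CochainComplex C ℤ} (φ : K ⟶ L) (i : L ⟶ E) (γ : E ⟶ K⟦(1 : ℤ)⟧)
  (s : ∀ n, E.X n ⟶ L.X n) (t : ∀ n, (K⟦(1 : ℤ)⟧).X n ⟶ E.X n)
  (his : ∀ n, i.f n ≫ s n = 𝟙 _) (htγ : ∀ n, t n ≫ γ.f n = 𝟙 _) (hts : ∀ n, t n ≫ s n = 0)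
  (hγi : i ≫ γ = 0)
  (hid : ∀ n, γ.f n ≫ t n + s n ≫ i.f n = 𝟙 _)
  (hd : ∀ n, E.d n (n + 1) ≫ s (n + 1) + γ.f n ≫ (φ.f (n + 1) : _ ⟶ L.X (n + 1)) =
    s n ≫ L.d n (n + 1))

lemma toCone_aux (n : ℤ) : ((Cocycle.ofHom (-γ)).rightUnshift 1 (zero_add 1)).1.v n (n + 1) rfl =
    -γ.f n := by
  refine (Cochain.rightUnshift_v (Cocycle.ofHom (-γ)).1 1 (zero_add 1) n (n + 1) rfl n
    (add_zero n)).trans ?_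
  refine (congrArg (· ≫ _) (Cochain.ofHom_v (-γ) n)).trans ?_
  exact Category.comp_id (-γ.f n)

include hd in
lemma δ_add_comp_eq_zero : δ 0 1 (Cochain.ofHoms s) +
    ((Cocycle.ofHom (-γ)).rightUnshift 1 (zero_add 1)).1.comp (Cochain.ofHom φ) (add_zero 1) =
      0 := by
  ext n _ rfl
  rw [Cochain.add_v, δ_zero_cochain_v, Cochain.comp_zero_cochain_v, toCone_aux, Cochain.ofHoms_v,
    Cochain.ofHoms_v, Cochain.ofHom_v, ← hd, Cochain.zero_v, add_sub_cancel_left]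
  exact (congrArg (_ + ·) (Preadditive.neg_comp _ _)).trans (add_neg_cancel _)

/-- The comparison of a degreewise split extension of `K[1]` by `L` with the cone of `φ : K ⟶ L`,
when the extension is classified by `φ`. -/
def toCone : E ⟶ mappingCone φ :=
  lift φ ((Cocycle.ofHom (-γ)).rightUnshift 1 (zero_add 1)) (Cochain.ofHoms s)
    (δ_add_comp_eq_zero φ γ s hd)

lemma toCone_fst (n : ℤ) : (toCone φ γ s hd).f n ≫ (fst φ).1.v n (n + 1) rfl = -γ.f n := by
  rw [toCone, lift_f_fst_v, toCone_aux]

lemma toCone_snd (n : ℤ) : (toCone φ γ s hd).f n ≫ (snd φ).v n n (add_zero n) = s n := by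
  rw [toCone, lift_f_snd_v, Cochain.ofHoms_v]

include his hγi in
lemma comp_toCone : i ≫ toCone φ γ s hd = inr φ := by
  ext n
  rw [HomologicalComplex.comp_f, ext_to_iff _ n (n + 1) rfl, Category.assoc, Category.assoc,
    toCone_fst, toCone_snd, inr_f_fst_v, inr_f_snd_v, his]
  have h : i.f n ≫ γ.f n = 0 := by
    rw [← HomologicalComplex.comp_f, hγi, HomologicalComplex.zero_f]
  exact ⟨(Preadditive.comp_neg _ _).trans ((congrArg (- ·) h).trans neg_zero), rfl⟩

lemma toCone_comp : toCone φ γ s hd ≫ coneδ φ = γ := by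
  ext n
  have h : (coneδ φ).f n = -(fst φ).1.v n (n + 1) rfl := by
    refine (Cochain.rightShift_v _ 1 0 (zero_add 1) n n (add_zero n) (n + 1) rfl).trans ?_
    exact Category.comp_id _
  rw [HomologicalComplex.comp_f, h]
  exact (Preadditive.comp_neg _ _).trans ((congrArg (- ·) (toCone_fst φ γ s hd n)).trans
    (neg_neg _))

include his htγ hts hγi hid in
lemma isIso_toCone : IsIso (toCone φ γ s hd) := by
  have hn : ∀ n, IsIso ((toCone φ γ s hd).f n) := fun n => by
    have hγi' : i.f n ≫ γ.f n = 0 := by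
      rw [← HomologicalComplex.comp_f, hγi, HomologicalComplex.zero_f]
    have e₁ := toCone_fst φ γ s hd n
    have e₂ := toCone_snd φ γ s hd n
    let u : (mappingCone φ).X n ⟶ (K⟦(1 : ℤ)⟧).X n := (fst φ).1.v n (n + 1) rfl
    have hu : (toCone φ γ s hd).f n ≫ u = -γ.f n := e₁
    refine ⟨-u ≫ t n + (snd φ).v n n (add_zero n) ≫ i.f n, ?_, ?_⟩
    · rw [Preadditive.comp_add, Preadditive.comp_neg, ← Category.assoc, ← Category.assoc, e₂, hu,
        Preadditive.neg_comp, neg_neg, hid]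
    · refine ext_to φ n (n + 1) rfl ?_ ?_
      · change (_ ≫ _) ≫ u = 𝟙 _ ≫ u
        rw [Category.assoc, hu, Preadditive.comp_neg, Preadditive.add_comp, Category.assoc, hγi',
          Preadditive.neg_comp, Category.assoc, htγ, comp_zero, add_zero, Category.comp_id,
          neg_neg, Category.id_comp]
      · rw [Category.assoc, e₂, Preadditive.add_comp, Preadditive.neg_comp, Category.assoc, hts,
          comp_zero, neg_zero, zero_add, Category.assoc, his, Category.comp_id, Category.id_comp]
  exact HomologicalComplex.Hom.isIso_of_components _

include his htγ hts hγi hid hd in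
/-- A degreewise split extension of `K[1]` by `L` is part of a distinguished triangle whose first
morphism is the map `φ : K ⟶ L` measuring the failure of the splitting to commute with the
differentials. -/
lemma triangle_distinguished_of_splitting [HasZeroObject C] :
    Triangle.mk ((HomotopyCategory.quotient C (ComplexShape.up ℤ)).map φ)
      ((HomotopyCategory.quotient C (ComplexShape.up ℤ)).map i)
      ((HomotopyCategory.quotient C (ComplexShape.up ℤ)).map γ ≫
        ((HomotopyCategory.quotient C (ComplexShape.up ℤ)).commShiftIso (1 : ℤ)).hom.app K) ∈
      distTriang (HomotopyCategory C (ComplexShape.up ℤ)) := by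
  have hiso : IsIso (toCone φ γ s hd) := isIso_toCone φ i γ s t his htγ hts hγi hid hd
  let e : E ≅ mappingCone φ := asIso (toCone φ γ s hd)
  refine isomorphic_distinguished _ (HomotopyCategory.mappingCone_triangleh_distinguished φ) _
    (Triangle.isoMk _ _ (Iso.refl _) (Iso.refl _)
      ((HomotopyCategory.quotient C (ComplexShape.up ℤ)).mapIso e) ?_ ?_ ?_)
  · exact (Category.comp_id ((HomotopyCategory.quotient C (ComplexShape.up ℤ)).map φ)).trans
      (Category.id_comp _).symm
  · exact ((Functor.map_comp _ _ _).symm.trans (congrArg _ (comp_toCone φ i γ s his hγi hd))).trans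
      (Category.id_comp ((HomotopyCategory.quotient C (ComplexShape.up ℤ)).map (inr φ))).symm
  · refine ((congrArg (_ ≫ ·) (CategoryTheory.Functor.map_id _ _)).trans
      (Category.comp_id _)).trans ?_
    refine Eq.trans ?_ (Category.assoc _ _ _)
    exact congrArg (· ≫ _) ((congrArg _ (toCone_comp φ γ s hd)).symm.trans (Functor.map_comp _ _ _))

end ConeRecognition

end EtaStable
end

noncomputable section
namespace EtaStable

/-! ### The complex of columns and the cones -/

section PageCone

set_option linter.unusedSectionVars false

universe v w

open CochainComplex (mappingCone)
open CochainComplex.HomComplex CochainComplex.mappingCone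

variable {A : Type w} [Category.{v} A] [Preadditive A] [HasBinaryBiproducts A] [HasZeroObject A]

variable {X Y : CochainComplex (Gr A) ℤ}

lemma Gr.sub_entry {X Y : Gr A} (f g : X ⟶ Y) (j k : ℤ) :
    (f - g).entry j k = f.entry j k - g.entry j k := by
  rw [sub_eq_add_neg, sub_eq_add_neg]
  rfl

/-- The map `η_X f` has no diagonal entries, so that it does not contribute to the differentials of
columns. -/
lemma Gr.eta_comp_entry_self {X Y : Gr A} (f : X ⟶ Y) (q : ℤ) :
    (etaApp X ≫ f).entry q q = 0 := by
  rw [Gr.comp_entry_self]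
  exact (congrArg (· ≫ _) (Gr.eta_entry_ne X (by lia))).trans zero_comp

lemma Gr.eta_comp_entry_succ {X Y : Gr A} (f : X ⟶ Y) (q q' : ℤ) (h : q + 1 = q') :
    (etaApp X ≫ f).entry q q' = (f.entry (q + 1) q') := by
  rw [Gr.comp_entry_succ _ _ _ _ h]
  subst h
  refine (congrArg₂ (fun a b => a ≫ f.entry q (q + 1) + b ≫ f.entry (q + 1) (q + 1))
    (Gr.eta_entry_ne X (by lia) : (Gr.eta X).entry q q = 0) (Gr.eta_entry_self X q)).trans ?_
  exact (congrArg₂ (· + ·) zero_comp (Category.id_comp _)).trans (zero_add _)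

variable (f : X ⟶ Y)

/-- The projection of a column of the cone of `η_X f` to the column of `Y`. -/
def colSnd (q : ℤ) : (col A q).obj (mappingCone (etaC X ≫ f)) ⟶ (col A q).obj Y where
  f p := ((snd (etaC X ≫ f)).v (p + q) (p + q) (add_zero _)).entry q q
  comm' p p' hp := by
    obtain rfl : p + 1 = p' := hp
    have h := congrArg (fun g => Gr.Hom.entry g q q)
      (d_snd_v (etaC X ≫ f) (p + q) (p + 1 + q) (by lia))
    have h₁ : ((fst (etaC X ≫ f)).1.v (p + q) (p + 1 + q) (by lia) ≫
        (etaC X ≫ f).f (p + 1 + q)).entry q q = 0 :=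
      (Gr.comp_entry_self _ _ _).trans ((congrArg (_ ≫ ·)
        (Gr.eta_comp_entry_self (f.f (p + 1 + q)) q)).trans comp_zero)
    exact ((Gr.comp_entry_self _ _ _).symm.trans (h.trans
      ((congrArg (· + _) h₁).trans ((zero_add _).trans (Gr.comp_entry_self _ _ _))))).symm

lemma colInl_aux (q i i' j k : ℤ) (h : i = i') (hi : i + (-1) = j) (hk : k + (-1) = i') :
    (-((inl (etaC X ≫ f)).v i j hi).entry q q) ≫ ((mappingCone (etaC X ≫ f)).d j i').entry q q =
      (Int.negOnePow 1 • (((twist (Gr A) 1).obj X).d i k).entry q q) ≫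
        (-((inl (etaC X ≫ f)).v k i' hk).entry q q) := by
  subst h
  have h := congrArg (fun g => Gr.Hom.entry g q q) (inl_v_d (etaC X ≫ f) i j k hi hk)
  have h₁ : ((etaC X ≫ f).f i ≫ (inr (etaC X ≫ f)).f i).entry q q = 0 :=
    (Gr.comp_entry_self _ _ _).trans ((congrArg (· ≫ _)
      (Gr.eta_comp_entry_self (f.f i) q)).trans zero_comp)
  have h₂ := (Gr.comp_entry_self _ _ _).symm.trans h
  rw [Preadditive.neg_comp, Int.negOnePow_one, Units.neg_smul, one_smul, Preadditive.neg_comp,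
    Preadditive.comp_neg, neg_neg, neg_eq_iff_eq_neg]
  refine h₂.trans ((Gr.sub_entry _ _ _ _).trans ((congrArg₂ (· - ·) h₁ (Gr.comp_entry_self
    (((twist (Gr A) 1).obj X).d i k) ((inl (etaC X ≫ f)).v k i hk) q)).trans (zero_sub _)))

/-- The inclusion of a column of `X[1](1)` in a column of the cone of `η_X f`. -/
def colInl (q : ℤ) : (col A q).obj ((twistShift (Gr A) 1).obj X) ⟶
    (col A q).obj (mappingCone (etaC X ≫ f)) where
  f p := -((inl (etaC X ≫ f)).v (p + q + 1) (p + q) (by lia)).entry q q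
  comm' p p' hp := by
    obtain rfl : p + 1 = p' := hp
    refine (colInl_aux f q (p + q + 1) (p + 1 + q) (p + q) (p + 1 + q + 1) (by lia) (by lia)
      (by lia)).trans (congrArg (· ≫ _) ?_)
    exact (Gr.units_smul_entry _ _ _ _).symm

lemma inr_colSnd (q : ℤ) : (col A q).map (inr (etaC X ≫ f)) ≫ colSnd f q = 𝟙 _ :=
  HomologicalComplex.hom_ext _ _ fun p => (Gr.comp_entry_self _ _ _).symm.trans
    ((congrArg (fun g => Gr.Hom.entry g q q) (inr_f_snd_v (etaC X ≫ f) (p + q))).trans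
      (Gr.id_entry_self _ _))

lemma colInl_colSnd (q : ℤ) : colInl f q ≫ colSnd f q = 0 :=
  HomologicalComplex.hom_ext _ _ fun p => (Preadditive.neg_comp _ _).trans
    (neg_eq_zero.2 ((Gr.comp_entry_self _ _ _).symm.trans
    (congrArg (fun g => Gr.Hom.entry g q q)
      (inl_v_snd_v (etaC X ≫ f) (p + q + 1) (p + q) (by lia)))))

lemma colInl_etaδ (q : ℤ) : colInl f q ≫ (col A q).map (etaδ f) = 𝟙 _ :=
  HomologicalComplex.hom_ext _ _ fun p => (Preadditive.neg_comp _ _).trans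
    (neg_eq_iff_eq_neg.2 ((Gr.comp_entry_self _ _ _).symm.trans
    ((congrArg (fun g => Gr.Hom.entry g q q)
      (inl_v_coneδ_f (etaC X ≫ f) (p + q + 1) (p + q) (by lia))).trans
        (congrArg (- ·) (Gr.id_entry_self _ _)))))

lemma coneδ_f (p : ℤ) : (coneδ (etaC X ≫ f)).f p = -(fst (etaC X ≫ f)).1.v p (p + 1) rfl := by
  refine (Cochain.rightShift_v _ 1 0 (zero_add 1) p p (add_zero p) (p + 1) rfl).trans ?_
  exact Category.comp_id _

lemma col_id (q : ℤ) : (col A q).map (etaδ f) ≫ colInl f q + colSnd f q ≫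
    (col A q).map (inr (etaC X ≫ f)) = 𝟙 _ :=
  HomologicalComplex.hom_ext _ _ fun p => by
    have h := congrArg (fun g => Gr.Hom.entry g q q) (id_X (etaC X ≫ f) (p + q) (p + q + 1) rfl)
    have h₁ : (-((fst (etaC X ≫ f)).1.v (p + q) (p + q + 1) rfl).entry q q) ≫
        (-((inl (etaC X ≫ f)).v (p + q + 1) (p + q) (by lia)).entry q q) =
          ((fst (etaC X ≫ f)).1.v (p + q) (p + q + 1) rfl ≫
            (inl (etaC X ≫ f)).v (p + q + 1) (p + q) (by lia)).entry q q := by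
      rw [Gr.comp_entry_self, Preadditive.neg_comp, Preadditive.comp_neg, neg_neg]
    refine (congrArg₂ (· + ·) ((congrArg (· ≫ _)
      (congrArg (fun g => Gr.Hom.entry g q q) (coneδ_f f (p + q)))).trans h₁)
      (Gr.comp_entry_self _ _ _).symm).trans (h.trans (Gr.id_entry_self _ _))

lemma δ_snd_entry (q i i' : ℤ) (h : i + 1 = i') :
    ((δ 0 1 (snd (etaC X ≫ f))).v i i' h).entry q (q + 1) =
      ((coneδ (etaC X ≫ f)).f i).entry q q ≫
        eqToHom (show (X.X (i + 1)).X (q + 1) = (X.X i').X (q + 1) by rw [h]) ≫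
          (f.f i').entry (q + 1) (q + 1) := by
  subst h
  refine Eq.trans ?_ (congrArg (_ ≫ ·) (Category.id_comp _).symm)
  rw [coneδ_f, δ_snd, Cochain.neg_v, Cochain.comp_zero_cochain_v,
    Cochain.ofHom_v, ← Preadditive.neg_comp, Gr.comp_entry_succ _ _ _ _ rfl]
  exact (congrArg₂ (fun a b => _ ≫ a + _ ≫ b) (Gr.eta_comp_entry_succ (f.f (i + 1)) q _ rfl)
    (Gr.eta_comp_entry_self (f.f (i + 1)) (q + 1))).trans
      ((congrArg (_ + ·) comp_zero).trans (add_zero _))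

lemma entries_δ_snd (q : ℤ) : entries (δ 0 1 (snd (etaC X ≫ f))) q (q + 1) 0 (by lia) =
    Cochain.ofHom (((col A q).map (etaδ f) ≫ (colTwistShift 1 q X).hom) ≫
      (col A (q + 1)).map f) := by
  ext p
  have hs : ((q + 1 - q) * (p + q)).negOnePow = (p + q).negOnePow := by
    rw [add_sub_cancel_left, one_mul]
  rw [entries_v, Cochain.ofHom_v, hs]
  refine (congrArg (_ • ·) (δ_snd_entry f q (p + q) (p + (q + 1)) (by lia))).trans ?_
  refine Eq.trans ?_ (congrArg (fun t => (_ ≫ t) ≫ _) ((colTwistShift_hom_f 1 q X p).trans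
    (congrArg (· • _) (twistSign_one (p + q)))).symm)
  refine Eq.trans ?_ (congrArg (· ≫ _) (Linear.comp_units_smul _ _ _).symm)
  refine Eq.trans ?_ (Linear.units_smul_comp _ _ _).symm
  exact congrArg (_ • ·) (Category.assoc _ _ _).symm

/-- The failure of the projections `colSnd` to commute with the differentials of the complexes of
columns is given by `f`. -/
lemma colD_colSnd (q : ℤ) :
    (HomotopyCategory.quotient A (ComplexShape.up ℤ)).map
      (colD (mappingCone (etaC X ≫ f)) q (q + 1) ≫ colSnd f (q + 1) +
      ((col A q).map (etaδ f) ≫ (colTwistShift 1 q X).hom) ≫ (col A (q + 1)).map f) =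
    (HomotopyCategory.quotient A (ComplexShape.up ℤ)).map (colSnd f q ≫ colD Y q (q + 1)) := by
  rw [quotient_map_eq_iff]
  have h := entries_δ_succ (snd (etaC X ≫ f)) q (q + 1) rfl
  have hz : ∀ q, entries (snd (etaC X ≫ f)) q q 0 rfl = Cochain.ofHom (colSnd f q) := fun q => by
    ext p
    rw [entries_self_v, Cochain.ofHom_v]
    rfl
  rw [hz, hz, entries_δ_snd, ← Cochain.ofHom_comp, ← Cochain.ofHom_comp] at h
  exact ⟨_, by rw [Cochain.ofHom_add, h]; abel⟩

/-- The complex of columns of the cone of `η_X f` is degreewise split, and it is classified by the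
map induced by `f`. -/
lemma exists_page_splitting :
    ∃ (s : ∀ q, ((page A).obj (mappingCone (etaC X ≫ f))).X q ⟶ ((page A).obj Y).X q)
      (t : ∀ q, (((page A).obj X)⟦(1 : ℤ)⟧).X q ⟶ ((page A).obj (mappingCone (etaC X ≫ f))).X q),
      (∀ q, ((page A).map (inr (etaC X ≫ f))).f q ≫ s q = 𝟙 _) ∧
      (∀ q, t q ≫ ((page A).map (etaδ f) ≫ (pageTwistShift 1 X).hom).f q = 𝟙 _) ∧
      (∀ q, t q ≫ s q = 0) ∧
      (page A).map (inr (etaC X ≫ f)) ≫ (page A).map (etaδ f) ≫ (pageTwistShift 1 X).hom = 0 ∧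
      (∀ q, ((page A).map (etaδ f) ≫ (pageTwistShift 1 X).hom).f q ≫ t q +
        s q ≫ ((page A).map (inr (etaC X ≫ f))).f q = 𝟙 _) ∧
      (∀ q, ((page A).obj (mappingCone (etaC X ≫ f))).d q (q + 1) ≫ s (q + 1) +
        ((page A).map (etaδ f) ≫ (pageTwistShift 1 X).hom).f q ≫
          (((page A).map f).f (q + 1) : _ ⟶ ((page A).obj Y).X (q + 1)) =
        s q ≫ ((page A).obj Y).d q (q + 1)) := by
  let Q := HomotopyCategory.quotient A (ComplexShape.up ℤ)
  refine ⟨fun q => Q.map (colSnd f q), fun q => Q.map ((colTwistShift 1 q X).inv ≫ colInl f q),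
    fun q => ?_, fun q => ?_, fun q => ?_, ?_, fun q => ?_, fun q => ?_⟩
  · exact (Q.map_comp _ _).symm.trans ((congrArg Q.map (inr_colSnd f q)).trans (Q.map_id _))
  · refine (congrArg (_ ≫ ·) (Q.map_comp _ _).symm).trans ((Q.map_comp _ _).symm.trans
      ((congrArg Q.map (?_ : _ = 𝟙 _)).trans (Q.map_id _)))
    rw [Category.assoc, ← Category.assoc (colInl f q), colInl_etaδ, Category.id_comp,
      Iso.inv_hom_id]
  · refine (Q.map_comp _ _).symm.trans ((congrArg Q.map
      (?_ : _ = (0 : (col A (q + 1)).obj X ⟶ (col A q).obj Y))).trans (Q.map_zero _ _))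
    rw [Category.assoc, colInl_colSnd, comp_zero]
  · refine (Category.assoc _ _ _).symm.trans ?_
    have h : (page A).map (inr (etaC X ≫ f)) ≫ (page A).map (etaδ f) = 0 :=
      ((page A).map_comp _ _).symm.trans
        ((congrArg (page A).map (inr_coneδ (etaC X ≫ f))).trans ((page A).map_zero _ _))
    rw [h, zero_comp]
  · refine (congrArg₂ (· + ·) ((congrArg (· ≫ _) (Q.map_comp _ _).symm).trans (Q.map_comp _ _).symm)
      (Q.map_comp _ _).symm).trans (Q.map_add.symm.trans
        ((congrArg Q.map (?_ : _ = 𝟙 _)).trans (Q.map_id _)))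
    rw [Category.assoc, Iso.hom_inv_id_assoc, col_id]
  · refine (congrArg₂ (· + ·) (Q.map_comp _ _).symm ((congrArg (· ≫ _)
      (Q.map_comp _ _).symm).trans (Q.map_comp _ _).symm)).trans (Q.map_add.symm.trans
        ((colD_colSnd f q).trans (Q.map_comp _ _)))

/-- The functor of columns sends standard triangles to distinguished triangles. -/
lemma page_triangle_distinguished :
    Triangle.mk ((HomotopyCategory.quotient _ (ComplexShape.up ℤ)).map ((page A).map f))
      ((HomotopyCategory.quotient _ (ComplexShape.up ℤ)).map ((page A).map (inr (etaC X ≫ f))))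
      ((HomotopyCategory.quotient _ (ComplexShape.up ℤ)).map
        ((page A).map (etaδ f) ≫ (pageTwistShift 1 X).hom) ≫
        ((HomotopyCategory.quotient _ (ComplexShape.up ℤ)).commShiftIso (1 : ℤ)).hom.app
          ((page A).obj X)) ∈
      distTriang (HomotopyCategory (HomotopyCategory A (ComplexShape.up ℤ))
        (ComplexShape.up ℤ)) := by
  obtain ⟨s, t, his, htγ, hts, hγi, hid, hd⟩ := exists_page_splitting f
  exact triangle_distinguished_of_splitting _ _ _ s t his htγ hts hγi hid hd

/-- A map from the complex of columns of `Y` which is null-homotopic after composition with `f`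
extends to the complex of columns of the cone of `η_X f`. -/
lemma exists_page_extension {Z : CochainComplex (HomotopyCategory A (ComplexShape.up ℤ)) ℤ}
    (a : (page A).obj Y ⟶ Z) (h : Homotopy ((page A).map f ≫ a) 0) :
    ∃ b : (page A).obj (mappingCone (etaC X ≫ f)) ⟶ Z, (page A).map (inr (etaC X ≫ f)) ≫ b = a := by
  obtain ⟨s, t, his, htγ, hts, hγi, hid, hd⟩ := exists_page_splitting f
  obtain ⟨b, hb⟩ : ∃ b : mappingCone ((page A).map f) ⟶ Z, inr _ ≫ b = a := by
    obtain ⟨z, hz⟩ := Cochain.equivHomotopy _ _ h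
    exact ⟨desc _ z a (by rw [Cochain.ofHom_zero, add_zero] at hz; exact hz.symm), inr_desc _ _ _ _⟩
  exact ⟨toCone _ _ s hd ≫ b, (Category.assoc _ _ _).symm.trans
    ((congrArg (· ≫ b) (comp_toCone _ _ _ s his hγi hd)).trans hb)⟩

end PageCone

end EtaStable
end

noncomputable section
namespace EtaStable

/-! ### The triangle functor of columns -/

section PageFunctor

set_option linter.unusedSectionVars false

universe v w

open CochainComplex (mappingCone)
open CochainComplex.HomComplex CochainComplex.mappingCone

variable {A : Type w} [Category.{v} A] [Preadditive A] [HasBinaryBiproducts A] [HasZeroObject A]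

/-- The inclusion of a complex in the cone of `η` is zero on complexes of columns, up to homotopy.
-/
lemma quotient_page_inr (I : CochainComplex (Gr A) ℤ) :
    (HomotopyCategory.quotient _ (ComplexShape.up ℤ)).map
      ((page A).map (inr (etaC I ≫ 𝟙 I))) = 0 := by
  have h := comp_distTriang_mor_zero₁₂ _ (page_triangle_distinguished (𝟙 I))
  refine Eq.trans ?_ h
  refine Eq.trans (Category.id_comp _).symm (congrArg (· ≫ _) ?_)
  exact ((CategoryTheory.Functor.map_id _ _).symm.trans
    (congrArg _ ((page A).map_id I).symm))

/-- Every injective complex is a direct summand of the cone of its `η`, by the inclusion, which is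
zero on complexes of columns up to homotopy. Hence the functor of columns is defined on
`K_η(gr A)`. -/
lemma quotient_page_map_eq (X Y : CochainComplex (Gr A) ℤ) (f g : X ⟶ Y) (h : StablyEqual f g) :
    (pageEta A ⋙ HomotopyCategory.quotient _ (ComplexShape.up ℤ)).map (X := X) (Y := Y) f =
      (pageEta A ⋙ HomotopyCategory.quotient _ (ComplexShape.up ℤ)).map (X := X) (Y := Y) g := by
  obtain ⟨I, a, b, hI, hab⟩ := h
  obtain ⟨r, hr⟩ : ∃ r : mappingCone (etaC I ≫ 𝟙 I) ⟶ I, inr (etaC I ≫ 𝟙 I) ≫ r = 𝟙 I :=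
    hI (standardPair (etaC I ≫ 𝟙 I))
      ⟨_, _, _, 𝟙 _, by rw [Category.id_comp, Category.comp_id], ⟨Iso.refl _⟩⟩ (𝟙 I)
  let F := page A ⋙ HomotopyCategory.quotient _ (ComplexShape.up ℤ)
  have h₁ : F.map (𝟙 I) = 0 := by
    rw [← hr, F.map_comp]
    exact (congrArg (· ≫ _) (quotient_page_inr I)).trans zero_comp
  have h₂ : F.map (f - g) = 0 := by
    rw [hab, ← Category.id_comp b, F.map_comp, F.map_comp, h₁, zero_comp, comp_zero]
  rw [F.map_sub, sub_eq_zero] at h₂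
  exact h₂

variable (A) in
/-- The triangle functor from `K_η(gr A)` to the homotopy category of complexes in `K(A)`, which
sends a complex to the complex of its columns. -/
def pageK : KEta (Gr A) ⥤
    HomotopyCategory (HomotopyCategory A (ComplexShape.up ℤ)) (ComplexShape.up ℤ) :=
  ketaLift (pageEta A ⋙ HomotopyCategory.quotient _ (ComplexShape.up ℤ)) quotient_page_map_eq

instance : (pageK A).CommShift ℤ :=
  ketaLiftCommShift (pageEta A ⋙ HomotopyCategory.quotient _ (ComplexShape.up ℤ)) _

instance : (pageK A).IsTriangulated :=
  ketaLift_isTriangulated (pageEta A ⋙ HomotopyCategory.quotient _ (ComplexShape.up ℤ)) _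
    fun X Y f => by
      have h := page_triangle_distinguished f
      have e : (HomotopyCategory.quotient _ (ComplexShape.up ℤ)).map
          ((page A).map (etaδ f) ≫ (pageTwistShift 1 X).hom) ≫
        ((HomotopyCategory.quotient _ (ComplexShape.up ℤ)).commShiftIso (1 : ℤ)).hom.app
          ((page A).obj X) =
          (pageEta A ⋙ HomotopyCategory.quotient _ (ComplexShape.up ℤ)).map
            (X := mappingCone (etaC X ≫ f)) (Y := (twistShift (Gr A) 1).obj X) (etaδ f) ≫
          ((pageEta A ⋙ HomotopyCategory.quotient _ (ComplexShape.up ℤ)).commShiftIso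
            (1 : ℤ)).hom.app X :=
        (congrArg (· ≫ _) (Functor.map_comp _ _ _)).trans ((Category.assoc _ _ _).trans
          (congrArg (_ ≫ ·) (Functor.commShiftIso_comp_hom_app (pageEta A)
            (HomotopyCategory.quotient _ (ComplexShape.up ℤ)) (1 : ℤ) X).symm))
      rw [e] at h
      exact h

lemma pageK_map {X Y : CochainComplex (Gr A) ℤ} (f : X ⟶ Y) : (pageK A).map (qMap f) =
    (HomotopyCategory.quotient _ (ComplexShape.up ℤ)).map ((page A).map f) := rfl

end PageFunctor

end EtaStable
end

noncomputable section
namespace EtaStable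

/-! ### Full faithfulness of the functor of columns -/

section Good

set_option linter.unusedSectionVars false

universe v w

open CochainComplex (mappingCone)
open CochainComplex.HomComplex CochainComplex.mappingCone

variable {A : Type w} [Category.{v} A] [Preadditive A] [HasBinaryBiproducts A] [HasZeroObject A]

/-- A class of objects of `K(A)` which is closed under isomorphisms and finite direct sums, and such
that there are no nonzero morphisms `E ⟶ F⟦m⟧` between its objects for `m < 0`. -/
structure IsNegVanishing (V : ObjectProperty (HomotopyCategory A (ComplexShape.up ℤ))) : Prop where
  of_iso {K L : HomotopyCategory A (ComplexShape.up ℤ)} (e : K ≅ L) : V K → V L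
  of_isZero {Z : HomotopyCategory A (ComplexShape.up ℤ)} (h : IsZero Z) : V Z
  of_split {K E L : HomotopyCategory A (ComplexShape.up ℤ)} (i : K ⟶ E) (s : E ⟶ K) (t : L ⟶ E)
    (p : E ⟶ L) (his : i ≫ s = 𝟙 K) (htp : t ≫ p = 𝟙 L) (hts : t ≫ s = 0) (hip : i ≫ p = 0)
    (hid : p ≫ t + s ≫ i = 𝟙 E) : V K → V L → V E
  negVanishing {E F : CochainComplex A ℤ} :
    V ((HomotopyCategory.quotient A (ComplexShape.up ℤ)).obj E) →
    V ((HomotopyCategory.quotient A (ComplexShape.up ℤ)).obj F) → NegVanishing E F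

/-- A banded complex of graded objects all of whose columns belong to `V`. -/
structure HasColumnsIn (V : ObjectProperty (HomotopyCategory A (ComplexShape.up ℤ)))
    (M : CochainComplex (Gr A) ℤ) : Prop where
  banded : IsBanded M
  col_mem (q : ℤ) : V ((HomotopyCategory.quotient A (ComplexShape.up ℤ)).obj ((col A q).obj M))

/-- The property of being isomorphic in `K_η(gr A)` to a banded complex with columns in `V`. -/
def goodObjects (V : ObjectProperty (HomotopyCategory A (ComplexShape.up ℤ))) :
    ObjectProperty (KEta (Gr A)) :=
  fun X => ∃ M : CochainComplex (Gr A) ℤ, HasColumnsIn V M ∧ Nonempty (X ≅ qObj M)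

lemma isZero_of_isZero_complex {M : CochainComplex (Gr A) ℤ} (hM : IsZero M) (i q : ℤ) :
    IsZero ((M.X i).X q) := by
  have h : IsZero (((col A q).obj M).X (i - q)) :=
    (HomologicalComplex.eval A (ComplexShape.up ℤ) (i - q)).map_isZero ((col A q).map_isZero hM)
  have e : i - q + q = i := by lia
  rw [col_obj_X, e] at h
  exact h

variable {V : ObjectProperty (HomotopyCategory A (ComplexShape.up ℤ))}

lemma IsBanded.twistShift {M : CochainComplex (Gr A) ℤ} (hM : IsBanded M) (n : ℤ) :
    IsBanded ((twistShift (Gr A) n).obj M) := by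
  obtain ⟨a, b, h⟩ := hM
  exact ⟨a, b, fun i q hiq => h (i + n) (q + n) (by lia)⟩

lemma IsBanded.cone {X Y : CochainComplex (Gr A) ℤ} (hX : IsBanded X) (hY : IsBanded Y)
    (f : X ⟶ Y) : IsBanded (mappingCone (etaC X ≫ f)) := by
  obtain ⟨a, b, hX⟩ := hX
  obtain ⟨a', b', hY⟩ := hY
  refine ⟨min a a', max b b', fun i q hiq => ?_⟩
  have h : IsZero (((col A q).obj (mappingCone (etaC X ≫ f))).X (i - q)) := by
    rw [IsZero.iff_id_eq_zero]
    refine (HomologicalComplex.congr_hom (col_id f q) (i - q)).symm.trans ?_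
    rw [HomologicalComplex.add_f_apply, HomologicalComplex.comp_f, HomologicalComplex.comp_f]
    have h₁ : IsZero (((col A q).obj ((EtaStable.twistShift (Gr A) 1).obj X)).X (i - q)) :=
      hX (i - q + q + 1) (q + 1) (by lia)
    have h₂ : IsZero (((col A q).obj Y).X (i - q)) := hY (i - q + q) q (by lia)
    rw [h₁.eq_of_src ((colInl f q).f (i - q)) 0, h₂.eq_of_tgt ((colSnd f q).f (i - q)) 0, comp_zero,
      zero_comp, add_zero]
  have e : i - q + q = i := by lia
  rw [col_obj_X, e] at h
  exact h

lemma goodObjects_isClosedUnderIsomorphisms (V : ObjectProperty (HomotopyCategory A _)) :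
    (goodObjects V).IsClosedUnderIsomorphisms :=
  ⟨fun e ⟨M, hM, ⟨e'⟩⟩ => ⟨M, hM, ⟨e.symm ≪≫ e'⟩⟩⟩

variable (hV : IsNegVanishing V)
include hV

lemma IsNegVanishing.twistShift {M : CochainComplex (Gr A) ℤ} (hM : HasColumnsIn V M) (n : ℤ) :
    HasColumnsIn V ((twistShift (Gr A) n).obj M) :=
  ⟨hM.banded.twistShift n, fun q => hV.of_iso ((HomotopyCategory.quotient A _).mapIso
    (colTwistShift n q M).symm) (hM.col_mem (q + n))⟩

/-- The columns of `cone(f η_X)` are direct sums of columns of `X[1](1)` and of `Y`. -/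
lemma IsNegVanishing.cone {X Y : CochainComplex (Gr A) ℤ} (hX : HasColumnsIn V X)
    (hY : HasColumnsIn V Y) (f : X ⟶ Y) : HasColumnsIn V (mappingCone (etaC X ≫ f)) := by
  refine ⟨hX.banded.cone hY.banded f, fun q => ?_⟩
  obtain ⟨s, t, his, htγ, hts, hγi, hid, hd⟩ := exists_page_splitting f
  exact hV.of_split _ (s q) (t q) _ (his q) (htγ q) (hts q) (HomologicalComplex.congr_hom hγi q)
    (hid q) (hY.col_mem q) (hX.col_mem (q + 1))

/-- The complexes with columns in `V` form a triangulated subcategory of `K_η(gr A)`. -/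
lemma IsNegVanishing.goodObjects_isTriangulated : (goodObjects V).IsTriangulated := by
  have := goodObjects_isClosedUnderIsomorphisms V
  have h₀ : (goodObjects V).ContainsZero := by
    obtain ⟨Z, hZ⟩ := HasZeroObject.zero (C := CochainComplex (Gr A) ℤ)
    refine ⟨⟨qObj Z, ?_, Z, ⟨⟨0, 0, fun i q _ => isZero_of_isZero_complex hZ i q⟩, fun q => ?_⟩,
      ⟨Iso.refl _⟩⟩⟩
    · exact (KEta.quotient (Gr A)).map_isZero (X := Z) hZ
    · exact hV.of_isZero (Functor.map_isZero _ ((col A q).map_isZero hZ))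
  have h₁ : (goodObjects V).IsStableUnderShift ℤ := ⟨fun n => ⟨fun X ⟨M, hM, ⟨e⟩⟩ =>
    ⟨_, hV.twistShift hM n, ⟨(shiftFunctor _ n).mapIso e ≪≫
      (((KEta.quotient (Gr A)).commShiftIso n).app M).symm⟩⟩⟩⟩
  have h₃ : (goodObjects V).IsTriangulatedClosed₃ := .mk' fun T hT ⟨M, hM, ⟨e⟩⟩ ⟨N, hN, ⟨e'⟩⟩ => by
    obtain ⟨f, hf⟩ := qMap_surjective (e.inv ≫ T.mor₁ ≫ e'.hom)
    refine ⟨_, hV.cone hM hN f, ?_⟩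
    have := (mem_distTriang_iff _).2 (etaTriangle_mem f)
    obtain ⟨φ, -⟩ := exists_iso_of_arrow_iso T _ hT this
      (Arrow.isoMk e e' ((congrArg (e.hom ≫ ·) hf).trans (Iso.hom_inv_id_assoc e _)))
    exact ⟨Triangle.π₃.mapIso φ⟩
  have h₂ : (goodObjects V).IsTriangulatedClosed₂ := .of_isTriangulatedClosed₃
  exact {}

/-- On banded complexes with columns in `V`, the functor `pageK` is faithful: a chain map which is
null-homotopic on columns extends to the cone of `η` there, the extension lifts to a chain map
`r`, and the difference of the given map and the restriction of `r` is null-homotopic, while the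
cone of `η` is zero in `K_η(gr A)`. -/
lemma IsNegVanishing.qMap_eq_zero {M N : CochainComplex (Gr A) ℤ} (hM : HasColumnsIn V M)
    (hN : HasColumnsIn V N) (φ : M ⟶ N) (h : (pageK A).map (qMap φ) = 0) : qMap φ = 0 := by
  have h₁ : Homotopy ((page A).map (𝟙 M) ≫ (page A).map φ) 0 :=
    HomotopyCategory.homotopyOfEq _ _ (by
      rw [← Functor.map_comp, Category.id_comp, Functor.map_zero]
      exact h)
  obtain ⟨b, hb⟩ := exists_page_extension (𝟙 M) _ h₁
  have hC := hV.cone hM hM (𝟙 M)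
  obtain ⟨r, hr⟩ := exists_page_map_eq hC.banded hN.banded
    (fun q q' => hV.negVanishing (hC.col_mem q) (hN.col_mem q')) b
  have hv : (page A).map (φ - inr (etaC M ≫ 𝟙 M) ≫ r) = 0 := by
    rw [Functor.map_sub, Functor.map_comp, hr, hb, sub_self]
  obtain ⟨H⟩ := homotopy_of_page_map_eq_zero hM.banded hN.banded
    (fun q q' => hV.negVanishing (hM.col_mem q) (hN.col_mem q')) _ hv
  have h₂ : qMap (φ - inr (etaC M ≫ 𝟙 M) ≫ r) = 0 :=
    ((qMap_eq_iff_homotopy _ _).2 ⟨H.compLeft (etaC M)⟩).trans (qMap_zero M N)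
  have h₃ : qMap (inr (etaC M ≫ 𝟙 M)) = 0 := by
    have := comp_distTriang_mor_zero₁₂ _ ((mem_distTriang_iff _).2 (etaTriangle_mem (𝟙 M)))
    refine Eq.trans ?_ this
    exact ((Category.id_comp _).symm.trans (congrArg (· ≫ _) (qMap_id M).symm))
  rw [qMap_sub, qMap_comp, h₃] at h₂
  exact (sub_eq_zero.1 h₂).trans zero_comp

lemma IsNegVanishing.exists_pageK_map_eq {M N : CochainComplex (Gr A) ℤ} (hM : HasColumnsIn V M)
    (hN : HasColumnsIn V N) (α : (pageK A).obj (qObj M) ⟶ (pageK A).obj (qObj N)) :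
    ∃ φ, (pageK A).map φ = α := by
  obtain ⟨a, ha⟩ := (HomotopyCategory.quotient (HomotopyCategory A (ComplexShape.up ℤ))
    (ComplexShape.up ℤ)).map_surjective (X := (page A).obj M) (Y := (page A).obj N) α
  obtain ⟨φ, hφ⟩ := exists_page_map_eq hM.banded hN.banded
    (fun q q' => hV.negVanishing (hM.col_mem q) (hN.col_mem q')) a
  exact ⟨qMap φ, by rw [pageK_map, hφ]; exact ha⟩

/-- The functor `pageK` is fully faithful on the objects isomorphic to banded complexes with columns
in `V`. -/
lemma IsNegVanishing.pageK_map_bijective {X Y : KEta (Gr A)} (hX : goodObjects V X)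
    (hY : goodObjects V Y) : Function.Bijective ((pageK A).map : (X ⟶ Y) → _) := by
  obtain ⟨M, hM, ⟨e⟩⟩ := hX
  obtain ⟨N, hN, ⟨e'⟩⟩ := hY
  constructor
  · intro f g hfg
    obtain ⟨φ, hφ⟩ := qMap_surjective (e.inv ≫ f ≫ e'.hom)
    obtain ⟨ψ, hψ⟩ := qMap_surjective (e.inv ≫ g ≫ e'.hom)
    have h : qMap φ = qMap ψ := by
      rw [← sub_eq_zero, ← qMap_sub]
      refine hV.qMap_eq_zero hM hN _ ?_
      rw [qMap_sub, hφ, hψ, Functor.map_sub, Functor.map_comp, Functor.map_comp, Functor.map_comp,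
        Functor.map_comp, hfg, sub_self]
    rw [hφ, hψ] at h
    exact (cancel_mono e'.hom).1 ((cancel_epi e.inv).1 h)
  · intro α
    obtain ⟨φ, hφ⟩ := hV.exists_pageK_map_eq hM hN
      ((pageK A).map e.inv ≫ α ≫ (pageK A).map e'.hom)
    refine ⟨e.hom ≫ φ ≫ e'.inv, ?_⟩
    rw [Functor.map_comp, Functor.map_comp, hφ, Category.assoc, Category.assoc, ← Functor.map_comp,
      Iso.hom_inv_id]
    refine ((congrArg (_ ≫ ·) (congrArg (_ ≫ ·) (congrArg (α ≫ ·)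
      (CategoryTheory.Functor.map_id _ _)))).trans ?_)
    rw [Category.comp_id, ← Category.assoc, ← Functor.map_comp, Iso.hom_inv_id]
    exact (congrArg (· ≫ _) (CategoryTheory.Functor.map_id _ _)).trans (Category.id_comp _)

end Good

end EtaStable
end

noncomputable section
namespace EtaStable

/-! ### Morphisms between direct sums of copies of a complex -/

section Vanishing

universe v w

open CochainComplex.HomComplex

/-- Cochains up to coboundaries compute the morphisms in the homotopy category. -/
lemma negVanishing_iff {A : Type w} [Category.{v} A] [Preadditive A] (E F : CochainComplex A ℤ) :
    NegVanishing E F ↔ ∀ m : ℤ, m < 0 →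
      ∀ f : (HomotopyCategory.quotient A (ComplexShape.up ℤ)).obj E ⟶
        ((HomotopyCategory.quotient A (ComplexShape.up ℤ)).obj F)⟦m⟧, f = 0 := by
  have h (m : ℤ) (x : Cocycle E F m) : x ∈ coboundaries E F m ↔
      ∃ y : Cochain E F (m - 1), δ (m - 1) m y = x.1 := by
    constructor
    · rintro ⟨m', hm, y, hy⟩
      obtain rfl : m' = m - 1 := by lia
      exact ⟨y, hy⟩
    · rintro ⟨y, hy⟩
      exact ⟨m - 1, by lia, y, hy⟩
  constructor
  · intro hEF m hm f
    obtain ⟨x, hx⟩ := (CohomologyClass.toHom_bijective E F m).2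
      (f ≫ ((HomotopyCategory.quotient A (ComplexShape.up ℤ)).commShiftIso m).inv.app F)
    obtain ⟨z, rfl⟩ := x.mk_surjective
    have hz := hEF m hm z.1 (Cocycle.δ_eq_zero z _)
    rw [← h, ← CohomologyClass.toHom_mk_eq_zero_iff, hx] at hz
    rw [← cancel_mono
      (((HomotopyCategory.quotient A (ComplexShape.up ℤ)).commShiftIso m).inv.app F), zero_comp]
    exact hz
  · intro hEF m hm z hz
    refine (h m (Cocycle.mk z (m + 1) rfl hz)).1 ?_
    rw [← CohomologyClass.toHom_mk_eq_zero_iff]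
    rw [← cancel_mono
      (((HomotopyCategory.quotient A (ComplexShape.up ℤ)).commShiftIso m).hom.app F), zero_comp]
    exact hEF m hm _

lemma NegVanishing.of_iso {A : Type w} [Category.{v} A] [Preadditive A]
    {E F E' F' : CochainComplex A ℤ} (h : NegVanishing E F)
    (e : (HomotopyCategory.quotient A (ComplexShape.up ℤ)).obj E' ≅
      (HomotopyCategory.quotient A (ComplexShape.up ℤ)).obj E)
    (e' : (HomotopyCategory.quotient A (ComplexShape.up ℤ)).obj F' ≅
      (HomotopyCategory.quotient A (ComplexShape.up ℤ)).obj F) : NegVanishing E' F' := by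
  rw [negVanishing_iff] at h ⊢
  intro m hm f
  have := h m hm (e.inv ≫ f ≫ e'.hom⟦m⟧')
  rw [← cancel_mono (e'.hom⟦m⟧'), ← cancel_epi e.inv, this, zero_comp, comp_zero]

end Vanishing

section Copies

open CochainComplex.HomComplex

variable {Λ : Type u} [Ring Λ]

/-- The inclusion of a summand. -/
def ιCopies (ι : Type u) (i : ι) : 𝟭 (ProjMod Λ) ⟶ copies Λ ι where
  app _ := ObjectProperty.homMk (ModuleCat.ofHom (Finsupp.lsingle i))
  naturality _ _ f := InducedCategory.hom_ext (ModuleCat.hom_ext (LinearMap.ext fun _ =>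
    (Finsupp.mapRange_single (f := f.hom.hom) (hf := map_zero _)).symm))

/-- The projection onto a summand. -/
def πCopies (ι : Type u) (i : ι) : copies Λ ι ⟶ 𝟭 (ProjMod Λ) where
  app _ := ObjectProperty.homMk (ModuleCat.ofHom (Finsupp.lapply i))
  naturality _ _ _ := rfl

/-- The inclusion of a summand in `T^{(ι)}`. -/
def ιSum (T : CochainComplex (ProjMod Λ) ℤ) {ι : Type u} (i : ι) : T ⟶ sumCopies T ι where
  f p := (ιCopies ι i).app (T.X p)
  comm' _ _ _ := ((ιCopies ι i).naturality _).symm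

/-- The projection of `T^{(ι)}` onto a summand. -/
def πSum (T : CochainComplex (ProjMod Λ) ℤ) {ι : Type u} (i : ι) : sumCopies T ι ⟶ T where
  f p := (πCopies ι i).app (T.X p)
  comm' _ _ _ := ((πCopies ι i).naturality _).symm

/-- The morphism from a direct sum of copies given by its restrictions to the summands. -/
def descCopies {M N : ProjMod Λ} {ι : Type u} (f : ι → (M ⟶ N)) : (copies Λ ι).obj M ⟶ N :=
  ObjectProperty.homMk (ModuleCat.ofHom (Finsupp.lsum ℕ fun i => (f i).hom.hom))

lemma ιCopies_descCopies {M N : ProjMod Λ} {ι : Type u} (f : ι → (M ⟶ N)) (i : ι) :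
    (ιCopies ι i).app M ≫ descCopies f = f i :=
  InducedCategory.hom_ext (ModuleCat.hom_ext (LinearMap.ext fun x =>
    (Finsupp.lsum_single ℕ (fun i => (f i).hom.hom) i x)))

lemma ιCopies_πCopies (M : ProjMod Λ) {ι : Type u} (i : ι) :
    (ιCopies ι i).app M ≫ (πCopies ι i).app M = 𝟙 M :=
  InducedCategory.hom_ext (ModuleCat.hom_ext (LinearMap.ext fun _ => Finsupp.single_eq_same))

lemma ιCopies_πCopies_of_ne (M : ProjMod Λ) {ι : Type u} {i j : ι} (h : i ≠ j) :
    (ιCopies ι i).app M ≫ (πCopies ι j).app M = 0 :=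
  InducedCategory.hom_ext (ModuleCat.hom_ext (LinearMap.ext fun _ =>
    Finsupp.single_eq_of_ne h.symm))

lemma copies_hom_ext {M N : ProjMod Λ} {ι : Type u} {f g : (copies Λ ι).obj M ⟶ N}
    (h : ∀ i, (ιCopies ι i).app M ≫ f = (ιCopies ι i).app M ≫ g) : f = g :=
  InducedCategory.hom_ext (ModuleCat.hom_ext (Finsupp.lhom_ext' fun i =>
    congrArg (fun a => a.hom.hom) (h i)))

lemma copies_hom_ext' {M N : ProjMod Λ} {ι : Type u} {f g : M ⟶ (copies Λ ι).obj N}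
    (h : ∀ i, f ≫ (πCopies ι i).app N = g ≫ (πCopies ι i).app N) : f = g :=
  InducedCategory.hom_ext (ModuleCat.hom_ext (LinearMap.ext fun x => Finsupp.ext fun i =>
    congrArg (fun a => a.hom.hom x) (h i)))

lemma NegVanishing.sumCopies_left {T F : CochainComplex (ProjMod Λ) ℤ} (h : NegVanishing T F)
    (ι : Type u) : NegVanishing (sumCopies T ι) F := by
  intro m hm z hz
  have hi (i : ι) := h m hm ((Cochain.ofHom (ιSum T i)).comp z (zero_add m))
    (by rw [δ_ofHom_comp, hz, Cochain.comp_zero])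
  choose y hy using hi
  refine ⟨Cochain.mk fun p q hpq => descCopies fun i => (y i).v p q hpq, ?_⟩
  have key (i : ι) : (Cochain.ofHom (ιSum T i)).comp
      (Cochain.mk fun p q hpq => descCopies fun i => (y i).v p q hpq) (zero_add (m - 1)) = y i :=
    Cochain.ext _ _ fun p q hpq => (Cochain.zero_cochain_comp_v _ _ p q hpq).trans
      (ιCopies_descCopies _ i)
  refine Cochain.ext _ _ fun p q hpq => copies_hom_ext fun i => ?_
  have := hy i
  rw [← key i, δ_ofHom_comp] at this
  replace this := Cochain.congr_v this p q hpq
  rw [Cochain.zero_cochain_comp_v, Cochain.zero_cochain_comp_v] at this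
  exact this

lemma exists_finite_support {M N : ProjMod Λ} [Module.Finite Λ M.obj] {ι : Type u}
    (f : M ⟶ (copies Λ ι).obj N) : ∃ s : Finset ι, ∀ i ∉ s, f ≫ (πCopies ι i).app N = 0 := by
  classical
  obtain ⟨t, ht⟩ := Module.Finite.fg_top (R := Λ) (M := M.obj)
  let g : M.obj →ₗ[Λ] (ι →₀ N.obj) := f.hom.hom
  refine ⟨t.biUnion fun x => (g x).support, fun i hi => ?_⟩
  have : (Finsupp.lapply i : (ι →₀ N.obj) →ₗ[Λ] N.obj) ∘ₗ g = 0 := by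
    refine LinearMap.ext_on ht fun x hx => ?_
    simp only [Finset.mem_biUnion, not_exists, not_and] at hi
    simpa using hi x hx
  exact InducedCategory.hom_ext (ModuleCat.hom_ext this)

/-- As `T` is bounded with finitely generated terms, a cochain from `T` to a direct sum takes
values in a finite partial sum, so that the coboundaries found on the components can be summed. -/
lemma NegVanishing.sumCopies_right {T F : CochainComplex (ProjMod Λ) ℤ} (h : NegVanishing T F)
    (hT : {i : ℤ | ¬ IsZero (T.X i)}.Finite) (hT' : ∀ i, Module.Finite Λ (T.X i).obj)
    (κ : Type u) : NegVanishing T (sumCopies F κ) := by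
  classical
  intro m hm z hz
  have hk (k : κ) := h m hm (z.comp (Cochain.ofHom (πSum F k)) (add_zero m))
    (by rw [δ_comp_ofHom, hz, Cochain.zero_comp])
  have hs (p : ℤ) := exists_finite_support (M := T.X p) (z.v p (p + m) rfl)
  choose s hs using hs
  -- outside the finite set `S` the components of `z` vanish, and `0` is chosen as a preimage
  let S : Finset κ := hT.toFinset.biUnion s
  have hS (k : κ) (hk : k ∉ S) : z.comp (Cochain.ofHom (πSum F k)) (add_zero m) = 0 := by
    refine Cochain.ext _ _ fun p q hpq => ?_
    obtain rfl := hpq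
    by_cases hp : IsZero (T.X p)
    · exact hp.eq_of_src _ _
    · rw [Cochain.comp_zero_cochain_v]
      refine hs p k fun hk' => hk ?_
      exact Finset.mem_biUnion.2 ⟨p, by simpa using hp, hk'⟩
  have hy : ∃ y : κ → Cochain T F (m - 1), (∀ k ∉ S, y k = 0) ∧
      ∀ k, δ (m - 1) m (y k) = z.comp (Cochain.ofHom (πSum F k)) (add_zero m) := by
    choose y hy using hk
    refine ⟨fun k => if k ∈ S then y k else 0, fun k hk => if_neg hk, fun k => ?_⟩
    dsimp only
    split_ifs with hk
    · exact hy k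
    · rw [hS k hk, δ_zero]
  obtain ⟨y, hyS, hy⟩ := hy
  let Y : Cochain T (sumCopies F κ) (m - 1) :=
    Cochain.mk fun p q hpq => ∑ k ∈ S, (y k).v p q hpq ≫ (ιCopies κ k).app (F.X q)
  have key (k : κ) : Y.comp (Cochain.ofHom (πSum F k)) (add_zero (m - 1)) = y k := by
    refine Cochain.ext _ _ fun p q hpq => (Cochain.comp_zero_cochain_v _ _ p q hpq).trans
      ((Preadditive.sum_comp _ _ _).trans ?_)
    refine (Finset.sum_eq_single k (fun k' _ hk' => ?_) fun hk => ?_).trans ?_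
    · refine (Category.assoc _ _ _).trans ((congrArg (_ ≫ ·) ?_).trans comp_zero)
      exact ιCopies_πCopies_of_ne _ hk'
    · rw [hyS k hk]
      exact (congrArg (· ≫ _) zero_comp).trans zero_comp
    · exact (Category.assoc _ _ _).trans ((congrArg (_ ≫ ·) (ιCopies_πCopies _ k)).trans
        (Category.comp_id _))
  refine ⟨Y, Cochain.ext _ _ fun p q hpq => copies_hom_ext' fun k => ?_⟩
  have := hy k
  rw [← key k, δ_comp_ofHom] at this
  replace this := Cochain.congr_v this p q hpq
  rw [Cochain.comp_zero_cochain_v, Cochain.comp_zero_cochain_v] at this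
  exact this

variable (T : TiltingComplex Λ)

/-- The direct sums of copies of `T`, up to isomorphism in `K(Proj Λ)`. -/
def isSum : ObjectProperty (KProj Λ) := fun Y => ∃ X : SumT T.T, Nonempty (Y ≅ X.toKProj)

lemma negVanishing_sumCopies (ι κ : Type u) :
    NegVanishing (sumCopies T.T ι) (sumCopies T.T κ) := by
  refine NegVanishing.sumCopies_left (NegVanishing.sumCopies_right ?_ T.bounded T.finite κ) ι
  rw [negVanishing_iff]
  exact fun m hm => T.hom_eq_zero m hm.ne

/-- Two direct sums of isomorphic objects are isomorphic. -/
def isoOfSplit {C : Type*} [Category* C] [Preadditive C] {K E L K' E' L' : C}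
    (i : K ⟶ E) (s : E ⟶ K) (t : L ⟶ E) (p : E ⟶ L) (his : i ≫ s = 𝟙 K) (htp : t ≫ p = 𝟙 L)
    (hts : t ≫ s = 0) (hip : i ≫ p = 0) (hid : p ≫ t + s ≫ i = 𝟙 E)
    (i' : K' ⟶ E') (s' : E' ⟶ K') (t' : L' ⟶ E') (p' : E' ⟶ L') (his' : i' ≫ s' = 𝟙 K')
    (htp' : t' ≫ p' = 𝟙 L') (hts' : t' ≫ s' = 0) (hip' : i' ≫ p' = 0)
    (hid' : p' ≫ t' + s' ≫ i' = 𝟙 E') (e : K ≅ K') (e' : L ≅ L') : E ≅ E' where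
  hom := s ≫ e.hom ≫ i' + p ≫ e'.hom ≫ t'
  inv := s' ≫ e.inv ≫ i + p' ≫ e'.inv ≫ t
  hom_inv_id := by
    rw [← hid]
    simp [reassoc_of% his', reassoc_of% htp', reassoc_of% hts', reassoc_of% hip', add_comm]
  inv_hom_id := by
    rw [← hid']
    simp [reassoc_of% his, reassoc_of% htp, reassoc_of% hts, reassoc_of% hip, add_comm]

/-- For the condition on split extensions: an object which is a direct sum of `T^{(ι)}` and
`T^{(κ)}` is isomorphic to `T^{(ι ⊕ κ)}`. -/
lemma isSum_isNegVanishing : IsNegVanishing (isSum T) where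
  of_iso := fun e ⟨X, ⟨e'⟩⟩ => ⟨X, ⟨e.symm ≪≫ e'⟩⟩
  of_isZero h := by
    obtain ⟨Z, hZ⟩ := HasZeroObject.zero (C := SumT T.T)
    exact ⟨Z, ⟨h.iso ((inducedFunctor (SumT.toKProj (T := T.T))).map_isZero hZ)⟩⟩
  of_split i s t p his htp hts hip hid := fun ⟨⟨ι⟩, ⟨e⟩⟩ ⟨⟨κ⟩, ⟨e'⟩⟩ => by
    let b := SumT.bicone T.T ι κ
    let F := inducedFunctor (SumT.toKProj (T := T.T))
    have h₁ : F.map b.inl ≫ F.map b.fst = 𝟙 _ :=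
      (F.map_comp _ _).symm.trans ((congrArg F.map b.inl_fst).trans (F.map_id _))
    have h₂ : F.map b.inl ≫ F.map b.snd = 0 :=
      (F.map_comp _ _).symm.trans ((congrArg F.map b.inl_snd).trans (F.map_zero _ _))
    have h₃ : F.map b.inr ≫ F.map b.fst = 0 :=
      (F.map_comp _ _).symm.trans ((congrArg F.map b.inr_fst).trans (F.map_zero _ _))
    have h₄ : F.map b.inr ≫ F.map b.snd = 𝟙 _ :=
      (F.map_comp _ _).symm.trans ((congrArg F.map b.inr_snd).trans (F.map_id _))
    have h₅ : F.map b.fst ≫ F.map b.inl + F.map b.snd ≫ F.map b.inr = 𝟙 _ :=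
      (congrArg₂ (· + ·) (F.map_comp _ _).symm (F.map_comp _ _).symm).trans
        (F.map_add.symm.trans ((congrArg F.map (SumT.bicone_total T.T ι κ)).trans (F.map_id _)))
    exact ⟨⟨ι ⊕ κ⟩, ⟨isoOfSplit i s t p his htp hts hip hid (F.map b.inl) (F.map b.fst)
      (F.map b.inr) (F.map b.snd) h₁ h₄ h₃ h₂ ((add_comm _ _).trans h₅) e e'⟩⟩
  negVanishing := fun ⟨X, ⟨e⟩⟩ ⟨Y, ⟨e'⟩⟩ => (negVanishing_sumCopies T X.ι Y.ι).of_iso e e'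

end Copies

end EtaStable
end

noncomputable section
namespace EtaStable

/-! ### The columns of `Ψ(X**)`, and `(-)**` on morphisms -/

section ColumnsOfStar

set_option linter.unusedSectionVars false

universe v w

section

variable {A : Type w} [Category.{v} A] [Preadditive A]

lemma eq_units_smul_of_eq {X Y : A} {s : ℤˣ} {f g : X ⟶ Y} (h : f = s • g) : g = s • f := by
  rw [h, smul_smul, Int.units_mul_self, one_smul]

lemma GDiff.eqToHom_comp_d {X : ℤ → ℤ → A} (D : GDiff X) {p r p' r' : ℤ} (q q' : ℤ) (h : r = p)
    (h' : r' = p') : eqToHom (show X r q = X p q by rw [h]) ≫ D.d p q p' q' =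
      D.d r q r' q' ≫ eqToHom (show X r' q' = X p' q' by rw [h']) := by
  subst h h'
  simp

lemma GHom.eqToHom_comp_f {X Y : GObj A} (α : GHom X Y) {p r p' r' : ℤ} (q q' : ℤ) (h : r = p)
    (h' : r' = p') : eqToHom (show X.X r q = X.X p q by rw [h]) ≫ α.f p q p' q' =
      α.f r q r' q' ≫ eqToHom (show Y.X r' q' = Y.X p' q' by rw [h']) := by
  subst h h'
  simp

/-- The entry of a morphism between graded objects of the form `X^{i-j,j}`, as a morphism between
objects `X^{pq}`. -/
def bientry {X Y : ℤ → ℤ → A} {i i' : ℤ}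
    (φ : (⟨fun j => X (i - j) j⟩ : Gr A) ⟶ ⟨fun j => Y (i' - j) j⟩) (p q p' q' : ℤ)
    (h : p + q = i) (h' : p' + q' = i') : X p q ⟶ Y p' q' :=
  eqToHom (show X p q = X (i - q) q by rw [← h, add_sub_cancel_right]) ≫ φ.entry q q' ≫
    eqToHom (show Y (i' - q') q' = Y p' q' by rw [← h', add_sub_cancel_right])

lemma bientry_comp {X Y Z : ℤ → ℤ → A} {i i' i'' : ℤ}
    (φ : (⟨fun j => X (i - j) j⟩ : Gr A) ⟶ ⟨fun j => Y (i' - j) j⟩)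
    (ψ : (⟨fun j => Y (i' - j) j⟩ : Gr A) ⟶ ⟨fun j => Z (i'' - j) j⟩) (p q p'' q'' : ℤ)
    (h : p + q = i) (h'' : p'' + q'' = i'') :
    bientry (φ ≫ ψ) p q p'' q'' h h'' = ∑ k ∈ Finset.Icc q q'',
      bientry φ p q (i' - k) k h (by lia) ≫ bientry ψ (i' - k) k p'' q'' (by lia) h'' := by
  simp only [bientry, Gr.comp_entry, Preadditive.sum_comp, Preadditive.comp_sum, Category.assoc,
    eqToHom_refl, Category.id_comp]

lemma bientry_of_lt {X Y : ℤ → ℤ → A} {i i' : ℤ}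
    (φ : (⟨fun j => X (i - j) j⟩ : Gr A) ⟶ ⟨fun j => Y (i' - j) j⟩) (p q p' q' : ℤ)
    (h : p + q = i) (h' : p' + q' = i') (hq : q' < q) : bientry φ p q p' q' h h' = 0 := by
  rw [bientry, φ.entry_eq_zero q q' hq, zero_comp, comp_zero]

lemma bientry_self {X Y : ℤ → ℤ → A} {i i' : ℤ}
    (φ : (⟨fun j => X (i - j) j⟩ : Gr A) ⟶ ⟨fun j => Y (i' - j) j⟩) (j k : ℤ) :
    bientry φ (i - j) j (i' - k) k (by lia) (by lia) = φ.entry j k := by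
  rw [bientry, eqToHom_refl, eqToHom_refl, Category.id_comp, Category.comp_id]

lemma bientry_psi_d (X : GObj A) {i i' : ℤ} (p q p' q' : ℤ) (h : p + q = i) (h' : p' + q' = i') :
    bientry (X.psi.d i i') p q p' q' h h' = X.D.d p q p' q' := by
  obtain rfl : p = i - q := by lia
  obtain rfl : p' = i' - q' := by lia
  exact bientry_self _ _ _

/-- The morphism of `G(A)` given by a chain map `Ψ(X) ⟶ Ψ(Y)`. -/
def GHom.ofPsi {X Y : GObj A} (φ : X.psi ⟶ Y.psi) : GHom X Y where
  f p q p' q' := if h : p' + q' = p + q then bientry (φ.f (p + q)) p q p' q' rfl h else 0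
  f_eq_zero p q p' q' h := by
    split_ifs with h'
    · exact bientry_of_lt _ _ _ _ _ _ _ (by lia)
    · rfl
  comm p q p'' q'' m hm := by
    have hf (i p q p' q' : ℤ) (h : p + q = i) (h' : p' + q' = i) :
        (if h : p' + q' = p + q then bientry (φ.f (p + q)) p q p' q' rfl h else 0) =
          bientry (φ.f i) p q p' q' h h' := by
      subst h
      exact dif_pos h'
    by_cases h'' : p'' + q'' = m + 1
    · have h := congrArg (fun f => bientry f p q p'' q'' hm.symm h'') (φ.comm m (m + 1))
      replace h := (bientry_comp _ _ _ _ _ _ _ _).symm.trans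
        (h.trans (bientry_comp _ _ _ _ _ _ _ _))
      refine Eq.trans (Finset.sum_congr rfl fun k _ => ?_) (h.symm.trans
        (Finset.sum_congr rfl fun k _ => ?_))
      · exact congrArg₂ (· ≫ ·) (bientry_psi_d X _ _ _ _ _ _).symm (hf _ _ _ _ _ _ _)
      · exact congrArg₂ (· ≫ ·) (hf _ _ _ _ _ _ _).symm (bientry_psi_d Y _ _ _ _ _ _)
    · refine (Finset.sum_eq_zero fun k _ => ?_).trans (Finset.sum_eq_zero fun k _ => ?_).symm
      · exact (congrArg (_ ≫ ·) (dif_neg (by lia))).trans comp_zero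
      · rw [Y.D.d_eq_zero _ _ _ _ (by lia), comp_zero]

end

variable {Λ : Type u} [Ring Λ] {T : TiltingComplex Λ} {X Y Z : CochainComplex (SumT T.T) ℤ}

variable (T) in
/-- The inclusion of `C(Sum T)` in the category of complexes in `K(Proj Λ)`. -/
abbrev sumIncl : CochainComplex (SumT T.T) ℤ ⥤ CochainComplex (KProj Λ) ℤ :=
  (inducedFunctor (SumT.toKProj (T := T.T))).mapHomologicalComplex (ComplexShape.up ℤ)

lemma bigraded_congr {p r : ℤ} (h : r = p) (q : ℤ) : bigraded X r q = bigraded X p q := by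
  rw [h]

/-- The columns of `Ψ(X**)` are the components of `X`. -/
def StarObj.colPsi (S : StarObj X) (q : ℤ) :
    (col (ProjMod Λ) q).obj S.toGObj.psi ≅ sumCopies T.T (X.X q).ι :=
  HomologicalComplex.Hom.isoOfComponents
    (fun p => eqToIso (bigraded_congr (show p + q - q = p by lia) q))
    (fun p p' hp => by
      obtain rfl : p + 1 = p' := hp
      exact (congrArg (eqToHom _ ≫ ·) (S.d_zero p q).symm).trans
        (S.D.eqToHom_comp_d q q (by lia) (by lia)))

lemma StarObj.colPsi_hom_comp (S : StarObj X) (q : ℤ) :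
    (S.colPsi q).hom ≫ S.δ₁ q = colD S.toGObj.psi q (q + 1) ≫ (S.colPsi (q + 1)).hom := by
  refine HomologicalComplex.hom_ext _ _ fun p => ?_
  have h : (S.δ₁ q).f p = (p + q).negOnePow • S.D.d p q p (q + 1) := by
    exact eq_units_smul_of_eq (S.d_one p q)
  refine (congrArg ((S.colPsi q).hom.f p ≫ ·) h).trans ?_
  refine (Linear.comp_units_smul _ _ _).trans ?_
  refine (congrArg (_ • ·) (S.D.eqToHom_comp_d q (q + 1) (show p + q - q = p by lia)
    (show p + (q + 1) - (q + 1) = p by lia))).trans ?_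
  exact (Linear.units_smul_comp _ _ _).symm

lemma StarHom.colPsi_hom_comp {SX : StarObj X} {SY : StarObj Y} {α : X ⟶ Y} (f : StarHom SX SY α)
    (q : ℤ) : (SX.colPsi q).hom ≫ f.α₀ q =
      (col (ProjMod Λ) q).map f.hom.psi ≫ (SY.colPsi q).hom :=
  HomologicalComplex.hom_ext _ _ fun p => (congrArg (eqToHom _ ≫ ·) (f.hom_zero p q).symm).trans
    (f.hom.eqToHom_comp_f q q (show p + q - q = p by lia) (show p + q - q = p by lia))

/-- The complex of columns of `Ψ(X**)` is `X`, viewed as a complex in `K(Proj Λ)`. -/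
def StarObj.pagePsi (S : StarObj X) : (page (ProjMod Λ)).obj S.toGObj.psi ≅ (sumIncl T).obj X :=
  HomologicalComplex.Hom.isoOfComponents (fun q => (quotProj Λ).mapIso (S.colPsi q))
    (fun q q' hq => by
      obtain rfl : q + 1 = q' := hq
      refine (congrArg (_ ≫ ·) (S.quot_δ₁ q).symm).trans ?_
      exact ((quotProj Λ).map_comp _ _).symm.trans ((congrArg _ (S.colPsi_hom_comp q)).trans
        ((quotProj Λ).map_comp _ _)))

lemma StarHom.pagePsi_hom_comp {SX : StarObj X} {SY : StarObj Y} {α : X ⟶ Y} (f : StarHom SX SY α) :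
    SX.pagePsi.hom ≫ (sumIncl T).map α =
      (page (ProjMod Λ)).map f.hom.psi ≫ SY.pagePsi.hom :=
  HomologicalComplex.hom_ext _ _ fun q => (congrArg (_ ≫ ·) (f.quot_α₀ q).symm).trans
    (((quotProj Λ).map_comp _ _).symm.trans ((congrArg _ (f.colPsi_hom_comp q)).trans
        ((quotProj Λ).map_comp _ _)))

/-- The complex `Ψ(X**)` is banded because `T` is bounded. -/
lemma StarObj.hasColumnsIn (S : StarObj X) : HasColumnsIn (isSum T) S.toGObj.psi where
  banded := by
    obtain ⟨a, ha⟩ := T.bounded.bddBelow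
    obtain ⟨b, hb⟩ := T.bounded.bddAbove
    refine ⟨a, b, fun i q h => ?_⟩
    by_contra hz
    refine h ?_
    have : ¬ IsZero (T.T.X (i - q)) := fun h' => hz ((copies Λ (X.X q).ι).map_isZero h')
    exact ⟨ha this, hb this⟩
  col_mem q := ⟨X.X q, ⟨(quotProj Λ).mapIso (S.colPsi q)⟩⟩

/-- The operation `(-)**` on morphisms exists: `Ψ(α**)` is a lift of `α` to a chain map between
complexes of graded objects. -/
lemma exists_starHom (SX : StarObj X) (SY : StarObj Y) (α : X ⟶ Y) :
    Nonempty (StarHom SX SY α) := by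
  have hV := isSum_isNegVanishing T
  obtain ⟨φ, hφ⟩ := exists_page_map_eq SX.hasColumnsIn.banded SY.hasColumnsIn.banded
    (fun q q' => hV.negVanishing (SX.hasColumnsIn.col_mem q) (SY.hasColumnsIn.col_mem q'))
    (SX.pagePsi.hom ≫ (sumIncl T).map α ≫ SY.pagePsi.inv)
  refine ⟨⟨GHom.ofPsi φ, fun q => (SX.colPsi q).inv ≫ (col _ q).map φ ≫ (SY.colPsi q).hom,
    fun q => ?_, fun p q => dif_pos rfl⟩⟩
  have h := HomologicalComplex.congr_hom hφ q
  refine ((quotProj Λ).map_comp _ _).trans ((congrArg (_ ≫ ·) (((quotProj Λ).map_comp _ _).trans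
    (congrArg (· ≫ _) h))).trans ?_)
  have h₁ : SX.pagePsi.inv.f q ≫ (SX.pagePsi.hom ≫ (sumIncl T).map α ≫ SY.pagePsi.inv).f q ≫
      SY.pagePsi.hom.f q = ((sumIncl T).map α).f q := by
    rw [← HomologicalComplex.comp_f, ← HomologicalComplex.comp_f]
    simp only [Category.assoc, Iso.inv_hom_id, Iso.inv_hom_id_assoc, Category.comp_id]
  exact h₁

end ColumnsOfStar

end EtaStable
end

noncomputable section
namespace EtaStable

/-! ### The Maurer–Cartan equation -/

section MaurerCartan

set_option linter.unusedSectionVars false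

universe v w

open CochainComplex.HomComplex

variable {A : Type w} [Category.{v} A] [Preadditive A]

section Curvature

variable {M : CochainComplex (Gr A) ℤ}

/-- The curvature `δθ + θ²` of a cochain of degree one, which vanishes if and only if adding `θ`
to the differential gives a differential. -/
def curvature (θ : Cochain M M 1) : Cochain M M 2 := δ 1 2 θ + θ.comp θ one_add_one_eq_two

/-- The Bianchi identity. -/
lemma δ_curvature (θ : Cochain M M 1) : δ 2 3 (curvature θ) =
    θ.comp (curvature θ) (by lia) - (curvature θ).comp θ (by lia) := by
  rw [curvature, δ_add, δ_δ, zero_add, δ_comp θ θ one_add_one_eq_two 2 2 3 rfl rfl rfl,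
    Cochain.comp_add, Cochain.add_comp,
    Cochain.comp_assoc θ θ θ (n₁₂ := 2) (n₂₃ := 2) (n₁₂₃ := 3) rfl rfl rfl,
    Int.negOnePow_one, Units.neg_smul, one_smul]
  abel

lemma curvature_sub (θ h : Cochain M M 1) : curvature (θ - h) =
    (curvature θ - δ 1 2 h) + (h.comp h one_add_one_eq_two - θ.comp h one_add_one_eq_two -
      h.comp θ one_add_one_eq_two) := by
  rw [curvature, curvature, δ_sub, Cochain.sub_comp, Cochain.comp_sub, Cochain.comp_sub]
  abel

/-- If the curvature has weight at least `w`, and its entries of weight `w` are coboundaries, then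
the weight of the curvature can be increased by subtracting a cochain of weight `w`. -/
lemma exists_curvature_succ {w : ℤ} (hw : 1 ≤ w) (θ : Cochain M M 1) (hθ : HasWeight θ 1)
    (hc : HasWeight (curvature θ) w)
    (h : ∀ q q' : ℤ, ∀ hq : q + w = q', ∃ y : Cochain ((col A q).obj M) ((col A q').obj M) (1 - w),
      δ (1 - w) (2 - w) y = entries (curvature θ) q q' (2 - w) (by lia)) :
    ∃ y : Cochain M M 1, HasWeight y w ∧ HasWeight (curvature (θ - y)) (w + 1) := by
  obtain ⟨y, hy, hcy⟩ : ∃ y : Cochain M M 1, HasWeight y w ∧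
      HasWeight (curvature θ - δ 1 2 y) (w + 1) :=
    exists_sub_δ_hasWeight (by lia) (curvature θ) hc (1 - w) (2 - w) (by lia) rfl h
  refine ⟨y, hy, ?_⟩
  rw [curvature_sub]
  exact hcy.add ((((hy.comp hy _).mono (by lia)).sub ((hθ.comp hy _).mono (by lia))).sub
    ((hy.comp hθ _).mono (by lia)))

/-- The entries of lowest weight of the curvature are cocycles, by the Bianchi identity. -/
lemma δ_entries_curvature {w : ℤ} (θ : Cochain M M 1) (hθ : HasWeight θ 1)
    (hc : HasWeight (curvature θ) w) (q q' m : ℤ) (hq : q + w = q') (hm : m = 2 - w) :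
    δ m (m + 1) (entries (curvature θ) q q' m (by lia)) = 0 := by
  refine δ_entries_eq_zero (curvature θ) hc ?_ q q' m hq hm
  change HasWeight (δ 2 3 (curvature θ)) (w + 1)
  rw [δ_curvature]
  exact ((hθ.comp hc _).mono (by lia)).sub ((hc.comp hθ _).mono (by lia))

/-- A cochain whose curvature has large weight can be modified in large weight so that its curvature
vanishes. -/
lemma exists_curvature_eq_zero (hM : IsBanded M)
    (hV : ∀ q q', NegVanishing ((col A q).obj M) ((col A q').obj M)) {w : ℤ} (hw : 3 ≤ w)
    (θ : Cochain M M 1) (hθ : HasWeight θ 1) (hc : HasWeight (curvature θ) w) :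
    ∃ y : Cochain M M 1, HasWeight y w ∧ curvature (θ - y) = 0 := by
  obtain ⟨W, hW⟩ := hM.exists_weight hM 2
  obtain ⟨k, hk⟩ : ∃ k : ℕ, W ≤ w + k := ⟨(W - w).toNat, by lia⟩
  induction k generalizing w θ with
  | zero => exact ⟨0, fun _ _ _ _ _ _ => rfl, by rw [sub_zero, hW _ (hc.mono (by lia))]⟩
  | succ k ih =>
    obtain ⟨y, hy, hcy⟩ := exists_curvature_succ (by lia) θ hθ hc fun q q' hq => by
      obtain ⟨y, hy⟩ := hV q q' (2 - w) (by lia) _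
        (δ_entries_curvature θ hθ hc q q' (2 - w) hq rfl)
      have e : 2 - w - 1 = 1 - w := by lia
      rw [← e]
      exact ⟨y, hy⟩
    obtain ⟨y', hy', hcy'⟩ := ih (w := w + 1) (by lia) (θ - y) (hθ.sub (hy.mono (by lia))) hcy
      (by push_cast at hk; lia)
    exact ⟨y + y', hy.add (hy'.mono (by lia)), by rw [← sub_sub, hcy']⟩

lemma comp_aux {X Y Z : A} {a : X ⟶ Y} {b : Y ⟶ Z} {c : X ⟶ Z} (h : c = a ≫ b) (s t r : ℤˣ)
    (hs : r = -(s * t)) : r • c = -((s • a) ≫ (t • b)) := by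
  rw [h, hs, Linear.units_smul_comp, Linear.comp_units_smul, smul_smul, Units.neg_smul]

lemma entries_comp_aux (θ : Cochain M M 1) (hθ : HasWeight θ 1) (q q' q'' : ℤ) (h : q + 1 = q')
    (h' : q' + 1 = q'') (i i' i'' : ℤ) (hi : i + 1 = i') (hi' : i' + 1 = i'') :
    ((θ.comp θ one_add_one_eq_two).v i i'' (by lia)).entry q q'' =
      (θ.v i i' hi).entry q q' ≫ (θ.v i' i'' hi').entry q' q'' := by
  rw [Cochain.comp_v θ θ one_add_one_eq_two i i' i'' hi hi', Gr.comp_entry]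
  refine Finset.sum_eq_single_of_mem q' (by simp; lia) fun l hl hl' => ?_
  by_cases h₁ : l < q + 1
  · rw [hθ _ _ _ _ _ h₁, zero_comp]
  · rw [hθ i' i'' hi' l q'' (by lia), comp_zero]

lemma entries_comp (θ : Cochain M M 1) (hθ : HasWeight θ 1) (q q' q'' : ℤ) (h : q + 1 = q')
    (h' : q' + 1 = q'') : entries (θ.comp θ one_add_one_eq_two) q q'' 0 (by lia) =
      -(entries θ q q' 0 (by lia)).comp (entries θ q' q'' 0 (by lia)) (add_zero 0) := by
  ext p
  rw [Cochain.neg_v, Cochain.comp_v _ _ (add_zero 0) p p p (by lia) (by lia), entries_v, entries_v,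
    entries_v]
  refine comp_aux (entries_comp_aux θ hθ q q' q'' h h' (p + q) (p + q') (p + q'') (by lia) (by lia))
    _ _ _ ?_
  rw [← Int.negOnePow_add, ← Int.negOnePow_succ, Int.negOnePow_eq_iff]
  rw [← h', ← h]
  exact ⟨-1, by ring⟩

end Curvature

section Diagonal

variable (E : ℤ → CochainComplex A ℤ)

/-- The complex of graded objects with diagonal differential and prescribed columns. -/
def diagComplex : CochainComplex (Gr A) ℤ where
  X i := ⟨fun j => (E j).X (i - j)⟩
  d i i' := Gr.diag fun j => (E j).d (i - j) (i' - j)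
  shape i i' h := (congrArg Gr.diag (funext fun j => (E j).shape _ _ fun h' => h (by
    have h' : i - j + 1 = i' - j := h'
    change i + 1 = i'
    lia))).trans (Gr.diag_zero _ _)
  d_comp_d' i i' i'' _ _ := (Gr.diag_comp_diag _ _).trans
    ((congrArg Gr.diag (funext fun j => (E j).d_comp_d _ _ _)).trans (Gr.diag_zero _ _))

lemma diagComplex_d_entry_self (i i' j : ℤ) :
    ((diagComplex E).d i i').entry j j = (E j).d (i - j) (i' - j) := Gr.diag_entry_self _ _

lemma diagComplex_d_entry_ne (i i' : ℤ) {j k : ℤ} (h : j ≠ k) :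
    ((diagComplex E).d i i').entry j k = 0 := Gr.diag_entry_ne _ h

lemma eqToHom_comp_d_aux {E : CochainComplex A ℤ} {p p' r r' : ℤ} (h : r = p) (h' : r' = p') :
    eqToHom (show E.X r = E.X p by rw [h]) ≫ E.d p p' = E.d r r' ≫ eqToHom (by rw [h']) := by
  subst h h'
  simp

/-- The columns of `diagComplex E` are the given complexes. -/
def colDiagComplex (q : ℤ) : (col A q).obj (diagComplex E) ≅ E q :=
  HomologicalComplex.Hom.isoOfComponents
    (fun p => eqToIso (show (E q).X (p + q - q) = (E q).X p by rw [add_sub_cancel_right]))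
    (fun p p' _ => (eqToHom_comp_d_aux (by lia) (by lia)).trans
      (congrArg (· ≫ eqToHom _) (diagComplex_d_entry_self E (p + q) (p' + q) q).symm))

/-- Chain maps between the columns define a cocycle of weight one. -/
lemma δ_ofEntries_eq_zero (c : ∀ q q' : ℤ, q + 1 = q' →
    ((col A q).obj (diagComplex E) ⟶ (col A q').obj (diagComplex E))) :
    δ 1 2 (ofEntries (n := 1) zero_le_one (zero_add 1)
      fun q q' h => Cochain.ofHom (c q q' h)) = 0 := by
  set θ := ofEntries (P := diagComplex E) (N := diagComplex E) (n := 1) zero_le_one (zero_add 1)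
    fun q q' h => Cochain.ofHom (c q q' h) with hθ
  have hw : HasWeight θ 1 := hasWeight_ofEntries _ _ _
  have h₁ : HasWeight (δ 1 2 θ) 2 := HasWeight.succ (hw.δ rfl) fun q => by
    have e := entries_ofEntries (P := diagComplex E) (N := diagComplex E) (n := 1) zero_le_one
      (zero_add 1) (fun q q' h => Cochain.ofHom (c q q' h)) q (q + 1) rfl
    have h := entries_δ (show (1 : ℤ) + 1 = 2 from rfl) θ q (q + 1) 0 1 (by lia) (by lia)
      (hw.mono (by lia))
    rw [e, δ_ofHom] at h
    exact h
  refine Cochain.ext _ _ fun i i' hi => Gr.hom_ext fun j k => ?_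
  by_cases hk : k < j + 2
  · exact h₁ i i' hi j k hk
  have h₂ (a b : ℤ) (hab : a + 1 = b) : (θ.v a b hab).entry j k = 0 :=
    ofEntries_v_entry_of_ne _ _ _ _ _ _ _ _ (by lia)
  rw [δ_v 1 2 rfl θ i i' hi (i + 1) (i + 1) (by lia) rfl, Int.negOnePow_even 2 ⟨1, rfl⟩, one_smul]
  refine (congrArg₂ (· + ·) (Gr.comp_diag_entry _ _ j k) (Gr.diag_comp_entry _ _ j k)).trans ?_
  rw [h₂, h₂]
  exact (congrArg₂ (· + ·) zero_comp comp_zero).trans (add_zero 0)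

/-- A sequence of maps between complexes `E q` whose successive compositions are null-homotopic is
the part of weight one of a differential on the complex of graded objects with columns `E q`. -/
lemma exists_curvature_eq_zero_of_diagComplex (hE : IsBanded (diagComplex E))
    (hV : ∀ q q', NegVanishing ((col A q).obj (diagComplex E)) ((col A q').obj (diagComplex E)))
    (c : ∀ q q' : ℤ, q + 1 = q' →
      ((col A q).obj (diagComplex E) ⟶ (col A q').obj (diagComplex E)))
    (hc : ∀ (q q' q'' : ℤ) (h : q + 1 = q') (h' : q' + 1 = q''),
      ∃ y, δ (-1) 0 y = Cochain.ofHom (c q q' h ≫ c q' q'' h')) :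
    ∃ θ : Cochain (diagComplex E) (diagComplex E) 1, HasWeight θ 1 ∧ curvature θ = 0 ∧
      ∀ (q q' : ℤ) (h : q + 1 = q'), entries θ q q' 0 (by lia) = Cochain.ofHom (c q q' h) := by
  set θ := ofEntries (P := diagComplex E) (N := diagComplex E) (n := 1) zero_le_one (zero_add 1)
    fun q q' h => Cochain.ofHom (c q q' h) with hθ
  have hw : HasWeight θ 1 := hasWeight_ofEntries _ _ _
  have he (q q' : ℤ) (h : q + 1 = q') : entries θ q q' 0 (by lia) = Cochain.ofHom (c q q' h) :=
    entries_ofEntries zero_le_one _ _ q q' h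
  have hcurv : curvature θ = θ.comp θ one_add_one_eq_two := by
    rw [curvature, δ_ofEntries_eq_zero, zero_add]
  have h₂ : HasWeight (curvature θ) 2 := by
    rw [hcurv]
    exact hw.comp hw _
  -- the entries of weight two of the curvature are, up to sign, the compositions `c ≫ c`:
  -- removing them gives the part of the differential of weight two
  obtain ⟨y, hy, hcy⟩ := exists_curvature_succ (w := 2) (by lia) θ hw h₂ fun q q'' h => by
    obtain ⟨y, hy⟩ := hc q (q + 1) q'' rfl (by lia)
    refine ⟨-y, ?_⟩
    change δ (-1) 0 (-y) = entries (curvature θ) q q'' 0 _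
    rw [δ_neg, hy, Cochain.ofHom_comp, ← he, ← he, ← entries_comp θ hw _ _ _ rfl (by lia)]
    congr 1
    exact hcurv.symm
  obtain ⟨y', hy', hcy'⟩ := exists_curvature_eq_zero hE hV le_rfl (θ - y)
    (hw.sub (hy.mono (by lia))) hcy
  have hyy : HasWeight (y + y') 2 := hy.add (hy'.mono (by lia))
  refine ⟨θ - (y + y'), hw.sub (hyy.mono (by lia)), by rw [← sub_sub, hcy'], fun q q' h => ?_⟩
  rw [entries_sub, he q q' h, sub_eq_self]
  refine Cochain.ext _ _ fun p p' hp => ?_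
  rw [entries_v, hyy _ _ _ _ _ (by lia)]
  exact smul_zero (A := ((diagComplex E).X (p + q)).X q ⟶ ((diagComplex E).X (p' + q')).X q') _

end Diagonal

end MaurerCartan

end EtaStable
end

noncomputable section
namespace EtaStable

/-! ### The operation `(-)**` on objects -/

section StarExistence

set_option linter.unusedSectionVars false

universe v w

open CochainComplex.HomComplex

section

variable {A : Type w} [Category.{v} A] [Preadditive A]

/-- The differentials of an object of `G(A)` given by the differential of a complex of graded
objects of the form `X^{i-j,j}`. -/
def GDiff.ofGr (X : ℤ → ℤ → A)
    (d : ∀ i i' : ℤ, i + 1 = i' → ((⟨fun j => X (i - j) j⟩ : Gr A) ⟶ ⟨fun j => X (i' - j) j⟩))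
    (hd : ∀ (i i' i'' : ℤ) (h : i + 1 = i') (h' : i' + 1 = i''), d i i' h ≫ d i' i'' h' = 0) :
    GDiff X where
  d p q p' q' := if h : p + q + 1 = p' + q' then bientry (d (p + q) (p' + q') h) p q p' q' rfl rfl
    else 0
  d_eq_zero p q p' q' h := by
    split_ifs with h'
    · exact bientry_of_lt _ _ _ _ _ _ _ (by lia)
    · rfl
  d_comp_d p q p'' q'' m hm := by
    have he (i i' p q p' q' : ℤ) (h : p + q = i) (h' : p' + q' = i') (hi : i + 1 = i') :
        (if h : p + q + 1 = p' + q' then bientry (d (p + q) (p' + q') h) p q p' q' rfl rfl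
          else 0) = bientry (d i i' hi) p q p' q' h h' := by
      subst h h'
      exact dif_pos hi
    by_cases h'' : m + 1 = p'' + q''
    · have h := congrArg (fun f => bientry f p q p'' q'' rfl rfl)
        (hd (p + q) m (p'' + q'') (by lia) h'')
      replace h := (bientry_comp _ _ _ _ _ _ _ _).symm.trans h
      refine (Finset.sum_congr rfl fun k _ => ?_).trans (h.trans ?_)
      · exact congrArg₂ (· ≫ ·) (he _ _ _ _ _ _ _ _ _) (he _ _ _ _ _ _ _ _ _)
      · exact (congrArg (_ ≫ ·) zero_comp).trans comp_zero
    · exact Finset.sum_eq_zero fun k _ =>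
        (congrArg (_ ≫ ·) (dif_neg (by lia))).trans comp_zero

lemma bientry_add {X Y : ℤ → ℤ → A} {i i' : ℤ}
    (φ ψ : (⟨fun j => X (i - j) j⟩ : Gr A) ⟶ ⟨fun j => Y (i' - j) j⟩) (p q p' q' : ℤ)
    (h : p + q = i) (h' : p' + q' = i') :
    bientry (φ + ψ) p q p' q' h h' = bientry φ p q p' q' h h' + bientry ψ p q p' q' h h' := by
  have e : (φ + ψ).entry q q' = φ.entry q q' + ψ.entry q q' := rfl
  rw [bientry, bientry, bientry, e, Preadditive.add_comp, Preadditive.comp_add]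

lemma bientry_eq_zero {X Y : ℤ → ℤ → A} {i i' : ℤ}
    (φ : (⟨fun j => X (i - j) j⟩ : Gr A) ⟶ ⟨fun j => Y (i' - j) j⟩) (p q p' q' : ℤ)
    (h : p + q = i) (h' : p' + q' = i') (hφ : φ.entry q q' = 0) :
    bientry φ p q p' q' h h' = 0 := by
  rw [bientry, hφ, zero_comp, comp_zero]

lemma eqToHom_comp_eq {E : CochainComplex A ℤ} {p p' r r' : ℤ} {f : E.X r ⟶ E.X r'}
    (hf : f = E.d r r') (h : r = p) (h' : r' = p') :
    eqToHom (show E.X p = E.X r by rw [h]) ≫ f ≫ eqToHom (show E.X r' = E.X p' by rw [h']) =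
      E.d p p' := by
  subst h h' hf
  simp

lemma eqToHom_comp_eq_units_smul {X X' Y Y' : A} (hX : X = X') (hY : Y = Y') {f : X ⟶ Y}
    {g : X' ⟶ Y'} {s t : ℤˣ} (hst : s = t) (h : s • f = eqToHom hX ≫ g ≫ eqToHom hY.symm) :
    eqToHom hX.symm ≫ f ≫ eqToHom hY = t • g := by
  subst hX hY hst
  rw [eqToHom_refl, eqToHom_refl, Category.id_comp, Category.comp_id] at h
  rw [eqToHom_refl, eqToHom_refl, Category.id_comp, Category.comp_id, ← h, smul_smul,
    Int.units_mul_self, one_smul]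

end

variable {Λ : Type u} [Ring Λ] {T : TiltingComplex Λ} (X : CochainComplex (SumT T.T) ℤ)

/-- The components of a complex in `Sum T`, as complexes of modules. -/
abbrev sumColumns (q : ℤ) : CochainComplex (ProjMod Λ) ℤ := sumCopies T.T (X.X q).ι

lemma isBanded_sumColumns : IsBanded (diagComplex (sumColumns X)) := by
  obtain ⟨a, ha⟩ := T.bounded.bddBelow
  obtain ⟨b, hb⟩ := T.bounded.bddAbove
  refine ⟨a, b, fun i q h => ?_⟩
  by_contra hz
  refine h ?_
  have : ¬ IsZero (T.T.X (i - q)) := fun h' => hz ((copies Λ (X.X q).ι).map_isZero h')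
  exact ⟨ha this, hb this⟩

lemma negVanishing_sumColumns (q q' : ℤ) :
    NegVanishing ((col (ProjMod Λ) q).obj (diagComplex (sumColumns X)))
      ((col (ProjMod Λ) q').obj (diagComplex (sumColumns X))) :=
  (negVanishing_sumCopies T (X.X q).ι (X.X q').ι).of_iso
    ((quotProj Λ).mapIso (colDiagComplex (sumColumns X) q))
    ((quotProj Λ).mapIso (colDiagComplex (sumColumns X) q'))

/-- The vanishing of the curvature means that the modified differential has square zero. -/
lemma starObj_d_aux {A : Type w} [Category.{v} A] [Preadditive A] {E : ℤ → CochainComplex A ℤ}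
    (θ : Cochain (diagComplex E) (diagComplex E) 1) (hθ : curvature θ = 0) (i i' i'' : ℤ)
    (h : i + 1 = i') (h' : i' + 1 = i'') :
    ((diagComplex E).d i i' + θ.v i i' h) ≫ ((diagComplex E).d i' i'' + θ.v i' i'' h') = 0 := by
  have e := Cochain.congr_v hθ i i'' (by lia)
  rw [curvature, Cochain.add_v, δ_v 1 2 rfl θ i i'' (by lia) i' i' (by lia) h,
    Cochain.comp_v θ θ one_add_one_eq_two i i' i'' h h', Int.negOnePow_even 2 ⟨1, rfl⟩,
    one_smul] at e
  rw [Preadditive.add_comp, Preadditive.comp_add, Preadditive.comp_add,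
    HomologicalComplex.d_comp_d, zero_add]
  refine Eq.trans ?_ e
  abel

/-- The operation `(-)**` on objects exists: the differential of `X**` is the sum of the
differentials of the complexes `X^{∗,q}` and of a cochain `θ` of vanishing curvature, whose
entries of weight one are chain maps `δ'` representing the differential of `X`. -/
lemma exists_starObj : Nonempty (StarObj X) := by
  have hδ : ∀ q q', ∃ δ' : sumColumns X q ⟶ sumColumns X q', (quotProj Λ).map δ' = (X.d q q').hom :=
    fun q q' => (quotProj Λ).map_surjective _
  choose δ' hδ' using hδ
  have hδδ (q q' q'' : ℤ) : (quotProj Λ).map (δ' q q' ≫ δ' q' q'') = (quotProj Λ).map 0 := by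
    refine ((quotProj Λ).map_comp _ _).trans ((congrArg₂ (· ≫ ·) (hδ' q q') (hδ' q' q'')).trans
      (Eq.trans ?_ ((quotProj Λ).map_zero _ _).symm))
    exact congrArg (fun f => f.hom) (X.d_comp_d q q' q'')
  let I := colDiagComplex (sumColumns X)
  obtain ⟨θ, hθ, hc, he⟩ := exists_curvature_eq_zero_of_diagComplex (sumColumns X)
    (isBanded_sumColumns X) (negVanishing_sumColumns X)
    (fun q q' _ => (I q).hom ≫ δ' q q' ≫ (I q').inv)
    (fun q q' q'' _ _ => by
      have h : (quotProj Λ).map ((((I q).hom ≫ δ' q q' ≫ (I q').inv) ≫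
          ((I q').hom ≫ δ' q' q'' ≫ (I q'').inv))) = (quotProj Λ).map 0 := by
        have e : ((I q).hom ≫ δ' q q' ≫ (I q').inv) ≫ ((I q').hom ≫ δ' q' q'' ≫ (I q'').inv) =
          (I q).hom ≫ (δ' q q' ≫ δ' q' q'') ≫ (I q'').inv := by simp
        rw [e, Functor.map_comp, Functor.map_comp (quotProj Λ) (δ' q q' ≫ δ' q' q''), hδδ,
          Functor.map_zero, zero_comp, comp_zero, Functor.map_zero]
      rw [quotient_map_eq_iff] at h
      obtain ⟨y, hy⟩ := h
      exact ⟨y, by rw [hy, Cochain.ofHom_zero, add_zero]⟩)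
  refine ⟨⟨GDiff.ofGr (bigraded X) (fun i i' h => (diagComplex (sumColumns X)).d i i' + θ.v i i' h)
    (fun i i' i'' h h' => starObj_d_aux θ hc i i' i'' h h'), fun q => δ' q (q + 1),
    fun q => hδ' _ _, fun p q => ?_, fun p q => ?_⟩⟩
  · refine (dif_pos (show p + q + 1 = p + 1 + q by lia)).trans ?_
    refine (bientry_add _ _ _ _ _ _ _ _).trans ?_
    refine (congrArg (_ + ·) (bientry_eq_zero _ _ _ _ _ _ _ (hθ _ _ _ _ _ (by lia)))).trans
      ((add_zero _).trans ?_)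
    exact eqToHom_comp_eq (diagComplex_d_entry_self (sumColumns X) (p + q) (p + 1 + q) q)
      (show p + q - q = p by lia) (show p + 1 + q - q = p + 1 by lia)
  · refine (dif_pos (show p + q + 1 = p + (q + 1) by lia)).trans ?_
    refine (bientry_add _ _ _ _ _ _ _ _).trans ?_
    refine (congrArg (· + _) (bientry_eq_zero _ _ _ _ _ _ _
      (diagComplex_d_entry_ne _ _ _ (by lia)))).trans ((zero_add _).trans ?_)
    have h := Cochain.congr_v (he q (q + 1) rfl) p p (by lia)
    rw [entries_v, Cochain.ofHom_v] at h
    exact eqToHom_comp_eq_units_smul (g := (δ' q (q + 1)).f p)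
      (bigraded_congr (show p + q - q = p by lia) q)
      (bigraded_congr (show p + (q + 1) - (q + 1) = p by lia) (q + 1))
      (by rw [add_sub_cancel_left, one_mul]) h

variable (T) in
/-- The operation `(-)**` exists. -/
lemma nonempty_starOperation : Nonempty (StarOperation T) :=
  ⟨⟨fun X => (exists_starObj X).some, fun α => (exists_starHom _ _ α).some⟩⟩

end StarExistence

end EtaStable
end

noncomputable section
namespace EtaStable

/-! ### The functor `Θ` -/

section Theta

set_option linter.unusedSectionVars false

variable {Λ : Type u} [Ring Λ] (T : TiltingComplex Λ)

instance : (goodObjects (isSum T)).IsClosedUnderIsomorphisms :=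
  goodObjects_isClosedUnderIsomorphisms _

instance : (goodObjects (isSum T)).IsTriangulated :=
  (isSum_isNegVanishing T).goodObjects_isTriangulated

/-- The property of objects of `K_η(gr^b Proj Λ)` of being isomorphic in `K_η(gr Proj Λ)` to a
banded complex whose columns are direct sums of copies of `T`. -/
abbrev sumObjects : ObjectProperty (KEta (GrB (ProjMod Λ))) :=
  (goodObjects (isSum T)).inverseImage (ketaIncl (ProjMod Λ))

instance : (sumObjects T).IsTriangulated := inferInstance

/-- The functor of columns on the objects whose columns are direct sums of copies of `T`. -/
abbrev sumPage : (sumObjects T).FullSubcategory ⥤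
    HomotopyCategory (KProj Λ) (ComplexShape.up ℤ) :=
  (sumObjects T).ι ⋙ ketaIncl (ProjMod Λ) ⋙ pageK (ProjMod Λ)

instance : (sumPage T).IsTriangulated := inferInstance

instance : (sumPage T).Faithful where
  map_injective {X Y} f g h := by
    ext
    exact (ketaIncl (ProjMod Λ)).map_injective
      (((isSum_isNegVanishing T).pageK_map_bijective X.property Y.property).1 h)

instance : (sumPage T).Full where
  map_surjective {X Y} α := by
    obtain ⟨φ, hφ⟩ := ((isSum_isNegVanishing T).pageK_map_bijective X.property Y.property).2 α
    obtain ⟨ψ, rfl⟩ := (ketaIncl (ProjMod Λ)).map_surjective φ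
    exact ⟨(sumObjects T).homMk ψ, hφ⟩

/-- The inclusion of `K(Sum T)` in the homotopy category of complexes in `K(Proj Λ)`. -/
abbrev sumInclK : HomotopyCategory (SumT T.T) (ComplexShape.up ℤ) ⥤
    HomotopyCategory (KProj Λ) (ComplexShape.up ℤ) :=
  (inducedFunctor (SumT.toKProj (T := T.T))).mapHomotopyCategory (ComplexShape.up ℤ)

variable {T}

namespace StarOperation

variable (S : StarOperation T)

/-- The object `Ψ(X**)` of `K_η(gr^b Proj Λ)`. -/
def thetaObj (X : CochainComplex (SumT T.T) ℤ) : (sumObjects T).FullSubcategory :=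
  ⟨S.thetaB.obj X, (S.obj X).toGObj.psi, (S.obj X).hasColumnsIn, ⟨Iso.refl _⟩⟩

/-- The morphism `Ψ(α**)` of `K_η(gr^b Proj Λ)`. -/
def thetaMap {X Y : CochainComplex (SumT T.T) ℤ} (α : X ⟶ Y) : S.thetaObj X ⟶ S.thetaObj Y :=
  (sumObjects T).homMk (S.thetaB.map α)

/-- The complex of columns of `Ψ(X**)` is `X`. -/
def sumPageThetaObj (X : CochainComplex (SumT T.T) ℤ) : (sumPage T).obj (S.thetaObj X) ≅
    (HomotopyCategory.quotient _ _).obj ((sumIncl T).obj X) :=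
  (HomotopyCategory.quotient (KProj Λ) (ComplexShape.up ℤ)).mapIso (S.obj X).pagePsi

lemma sumPage_map_thetaMap {X Y : CochainComplex (SumT T.T) ℤ} (α : X ⟶ Y) :
    (sumPage T).map (S.thetaMap α) ≫ (S.sumPageThetaObj Y).hom = (S.sumPageThetaObj X).hom ≫
      (HomotopyCategory.quotient _ _).map ((sumIncl T).map α) :=
  ((HomotopyCategory.quotient (KProj Λ) (ComplexShape.up ℤ)).map_comp _ _).symm.trans
    ((congrArg _ (S.map α).pagePsi_hom_comp.symm).trans (Functor.map_comp _ _ _))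

/-- The operation `Θ` is a functor on `C(Sum T)`, because `Ψ(α**)` is determined by `α`, as the
functor of columns is faithful. -/
def thetaFunctor : CochainComplex (SumT T.T) ℤ ⥤ (sumObjects T).FullSubcategory where
  obj := S.thetaObj
  map := S.thetaMap
  map_id X := (sumPage T).map_injective (by
    rw [← cancel_mono (S.sumPageThetaObj X).hom, sumPage_map_thetaMap]
    simp)
  map_comp {X Y Z} α β := (sumPage T).map_injective (by
    rw [← cancel_mono (S.sumPageThetaObj Z).hom, sumPage_map_thetaMap, Functor.map_comp,
      Functor.map_comp, Functor.map_comp, Category.assoc, sumPage_map_thetaMap,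
      ← Category.assoc, ← Category.assoc, sumPage_map_thetaMap])

/-- The functor induced by `Θ` on `K(Sum T)`. -/
def thetaK : HomotopyCategory (SumT T.T) (ComplexShape.up ℤ) ⥤ (sumObjects T).FullSubcategory :=
  CategoryTheory.Quotient.lift _ S.thetaFunctor (fun X Y α β ⟨h⟩ => (sumPage T).map_injective (by
    refine (cancel_mono (S.sumPageThetaObj Y).hom).1 ?_
    refine (S.sumPage_map_thetaMap α).trans (Eq.trans (congrArg (_ ≫ ·) ?_)
      (S.sumPage_map_thetaMap β).symm)
    exact HomotopyCategory.eq_of_homotopy _ _ (Functor.mapHomotopy _ h)))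

/-- The functor induced by `Θ` lifts the inclusion of `K(Sum T)` through the functor of columns. -/
def thetaKCompSumPage : S.thetaK ⋙ sumPage T ≅ sumInclK T :=
  CategoryTheory.Quotient.natIsoLift _ (NatIso.ofComponents (fun X => S.sumPageThetaObj X)
    (fun α => S.sumPage_map_thetaMap α))

/-- The commutation with the shifts is transported from the one of the inclusion of `K(Sum T)`,
along the fully faithful functor `sumPage T`. -/
instance : S.thetaK.CommShift ℤ := Functor.CommShift.ofComp S.thetaKCompSumPage ℤ

instance : S.thetaK.IsTriangulated := by
  have := Functor.CommShift.ofComp_compatibility S.thetaKCompSumPage ℤ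
  rw [Functor.isTriangulated_iff_comp_right S.thetaKCompSumPage]
  infer_instance

end StarOperation

end Theta

end EtaStable
end

theorem mainTheorem8 {Λ : Type u} [Ring Λ] (T : TiltingComplex Λ) :
    ∃ (_ : Pretriangulated (KEta (Gr (ProjMod Λ)))) (_ : Pretriangulated (KEta (GrB (ProjMod Λ)))),
      distinguishedTriangles = etaDistinguished (Gr (ProjMod Λ)) ∧
      distinguishedTriangles = etaDistinguished (GrB (ProjMod Λ)) ∧
      ∃ J : KEta (GrB (ProjMod Λ)) ⥤ KEta (Gr (ProjMod Λ)),
        (KEta.quotient (GrB (ProjMod Λ)) ⋙ J : CochainComplex (GrB (ProjMod Λ)) ℤ ⥤ _) =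
          inclC (ProjMod Λ) ⋙ KEta.quotient (Gr (ProjMod Λ)) ∧
        J.Full ∧ J.Faithful ∧ IsTriangleFunctor J ∧
      ∃ Ξ : KEta (GrB (ProjMod Λ)) ⥤ KProj Λ,
        (KEta.quotient (GrB (ProjMod Λ)) ⋙ Ξ : CochainComplex (GrB (ProjMod Λ)) ℤ ⥤ _) =
          xiC (ProjMod Λ) ⋙ quotProj Λ ∧
        IsTriangleFunctor Ξ ∧
      Nonempty (StarOperation T) ∧
      ∀ S : StarOperation T,
        ∃ (Φ : HomotopyCategory (SumT T.T) (ComplexShape.up ℤ) ⥤ KProj Λ)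
          (ΘB : HomotopyCategory (SumT T.T) (ComplexShape.up ℤ) ⥤ KEta (GrB (ProjMod Λ)))
          (Θ : HomotopyCategory (SumT T.T) (ComplexShape.up ℤ) ⥤ KEta (Gr (ProjMod Λ))),
          (HomotopyCategory.quotient _ _ ⋙ Φ).toPrefunctor = S.phi ∧
          (HomotopyCategory.quotient _ _ ⋙ ΘB).toPrefunctor = S.thetaB ∧
          (HomotopyCategory.quotient _ _ ⋙ Θ).toPrefunctor = S.theta ∧
          IsTriangleFunctor Φ ∧ IsTriangleFunctor ΘB ∧ IsTriangleFunctor Θ ∧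
          Θ = ΘB ⋙ J ∧ Φ = ΘB ⋙ Ξ := by
  refine ⟨inferInstance, inferInstance, rfl, rfl, ketaIncl (ProjMod Λ), quotient_comp_ketaIncl _,
    inferInstance, inferInstance, ⟨inferInstance, inferInstance⟩,
    (xiInvariance (ProjMod Λ)).ketaFunctor, (xiInvariance (ProjMod Λ)).quotient_comp_ketaFunctor,
    ⟨(xiInvariance (ProjMod Λ)).ketaFunctorCommShift,
      (xiInvariance (ProjMod Λ)).ketaFunctor_isTriangulated⟩,
    nonempty_starOperation T, fun S => ?_⟩
  let : (xiInvariance (ProjMod Λ)).ketaFunctor.CommShift ℤ :=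
    (xiInvariance (ProjMod Λ)).ketaFunctorCommShift
  have : (xiInvariance (ProjMod Λ)).ketaFunctor.IsTriangulated :=
    (xiInvariance (ProjMod Λ)).ketaFunctor_isTriangulated
  let ΘB := S.thetaK ⋙ (sumObjects T).ι
  -- the total complex of `X**` is `Ξ(Ψ(X**))` by definition, so that `Φ` is induced by `ΘB ⋙ Ξ`
  exact ⟨ΘB ⋙ (xiInvariance (ProjMod Λ)).ketaFunctor, ΘB, ΘB ⋙ ketaIncl (ProjMod Λ), rfl, rfl, rfl,
    ⟨inferInstance, inferInstance⟩, ⟨inferInstance, inferInstance⟩, ⟨inferInstance, inferInstance⟩,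
    rfl, rfl⟩
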